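/- Let $d\ge 1$, let $\zeta$ be a primitive $d$-th root of unity, and let $W=G(d,1,2)\subset GL_2(\mathbb C)$ be the group of $2\times 2$ monomial matrices whose nonzero entries are $d$-th roots of unity, acting on $V=\mathbb C^2$ with coordinate functions $X,Y$. Put $s=\begin{pmatrix}0&1\\1&0\end{pmatrix}$ and $t=\mathrm{diag}(\zeta,1)$. Let $\mathbf c:\mathrm{Ref}(W)\to\mathbb C$ be constant on conjugacy classes of reflections; put $c_0=c_s$, $c_k=c_{t^k}$ for $1\le k\le d-1$, and $k^\#_i=\frac1d\sum_{k=1}^{d-1}\zeta^{ki}c_k$ for $1\le i\le d$. The irreducible representations of $W$ are $\eta_i,\eta'_i$ ($1\le i\le d$), of dimension one, with $\eta_i(s)=1$, $\eta'_i(s)=-1$, $\eta_i(t)=\eta'_i(t)=\zeta^{i-1}$, and $\rho_{i,j}$ ($1\le i<j\le d$), of dimension two, with $\rho_{i,j}(s)=\begin{pmatrix}0&1\\1&0\end{pmatrix}$ and $\rho_{i,j}(t)=\mathrm{diag}(\zeta^{i-1},\zeta^{j-1})$. Their characters are denoted by $\xi_i,\xi'_i,\chi_{i,j}$. For each reflection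 $s'$ of $W$ choose a linear form $\alpha_{s'}$ on $V$ with $\ker\alpha_{s'}=\ker(s'-1)$. For $y\in V$ put $\mathcal D_y=\sum_{s'\in \mathrm{Ref}(W)}c_{s'}\det(s')\frac{\alpha_{s'}(y)}{\alpha_{s'}}\,s'$, and let $A=\mathbb C(X,Y)\mathrm{Gau}_{\mathbf c}(W)$ be the $\mathbb C(X,Y)$-subalgebra of the group algebra $\mathbb C(X,Y)W$ generated by the $\mathcal D_y$, $y\in V$. The $\mathbf c$-cellular character attached to a simple $A$-module $L$ is $$\gamma_L=\sum_{\chi\in\mathrm{Irr}(W)}[\mathrm{Res}_A\,\mathbb C(X,Y)V_\chi:L]\,\chi ,$$ where $V_\chi$ affords $\chi$ and $[M:L]$ is the multiplicity of $L$ as a composition factor of $M$. Let $\mathcal L_i,\mathcal L'_i,\mathcal L_{i,j}$ be the restrictions to $A$ of $\eta_i,\eta'_i,\rho_{i,j}$ extended to $\mathbb C(X,Y)$. For $d$ even and $i<j$ let $\mathcal L^{\pm}_{i,j}\subset\mathcal L_{i,j}$ be the $A$-submodule generated by $(X^{d/2-(j-i)},\mp Y^{d/2-(j-i)})$. Let $\sim$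 be the equivalence relation on $\{1,\dots,d\}$ given by $i\sim j\iff k^\#_i=k^\#_j$. Suppose that $c_0\ne 0$. (1) Let $\mathcal O$ be an equivalence class and $\delta\in\{c_0,-c_0\}$. There is at most one equivalence class $\mathcal O'$ with $k^\#_i-k^\#_j=\delta$ for $i\in\mathcal O$, $j\in\mathcal O'$; if it exists, denote it by $\mathcal O_\delta$, and otherwise put $\mathcal O_\delta=\emptyset$. (2) For every equivalence class $\mathcal O$, the modules $\mathcal L_i$, $i\in\mathcal O$, are simple and isomorphic to each other, and their $\mathbf c$-cellular character is $$\gamma_{\mathcal O}=\sum_{i\in\mathcal O}\Big(\xi_i+\sum_{j\in\mathcal O_{c_0},\,i<j}\chi_{i,j}+\sum_{j\in\mathcal O_{c_0},\,j<i}\chi_{j,i}\Big).$$ (3) For every equivalence class $\mathcal O$, the modules $\mathcal L'_i$, $i\in\mathcal O$, are simple and isomorphic to each other, and their $\mathbf c$-cellular character is $$\gamma'_{\mathcal O}=\sum_{i\in\mathcal O}\Big(\xi'_i+\sum_{j\in\mathcal O_{-c_0},\,i<j}\chi_{i,j}+\sum_{j\in\mathcal O_{-c_0},\,j<i}\chi_{j,i}\Big).$$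 (4) Let $\mathcal O\neq\mathcal O'$ be equivalence classes with $c_0^2\ne(k^\#_i-k^\#_j)^2$ for $i\in\mathcal O$, $j\in\mathcal O'$. The modules $\mathcal L_{i,j}$, where $i<j$ and one of $i,j$ lies in $\mathcal O$ and the other one in $\mathcal O'$, are simple and isomorphic to each other, and their $\mathbf c$-cellular character is $$\gamma_{\mathcal O,\mathcal O'}=\sum_{i\in\mathcal O,\,j\in\mathcal O',\,i<j}\chi_{i,j}+\sum_{i\in\mathcal O,\,j\in\mathcal O',\,j<i}\chi_{j,i}.$$ (5) Let $\mathcal O$ be an equivalence class with at least two elements and put $\gamma_{\mathcal O,\mathcal O}=\sum_{i,j\in\mathcal O,\,i<j}\chi_{i,j}$. If $d$ is odd, the modules $\mathcal L_{i,j}$, $i<j$ in $\mathcal O$, are simple and isomorphic to each other, with $\mathbf c$-cellular character $\gamma_{\mathcal O,\mathcal O}$. If $d$ is even, the modules $\mathcal L^{+}_{i,j}$, $i<j$ in $\mathcal O$, are simple and isomorphic to each other, so are the modules $\mathcal L^-_{i,j}$, $\mathcal L^+_{i,j}\not\simeq\mathcal L^-_{i,j}$, and in both cases the $\mathbf c$-cellular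 character is $\gamma_{\mathcal O,\mathcal O}$. (6) Every simple $A$-module is isomorphic to one of those in (2)-(5). Consequently the set of $\mathbf c$-cellular characters of $W$ consists exactly of the $\gamma_{\mathcal O}$ and the $\gamma'_{\mathcal O}$ for all equivalence classes $\mathcal O$, the $\gamma_{\mathcal O,\mathcal O'}$ for $\mathcal O,\mathcal O'$ as in (4), and the $\gamma_{\mathcal O,\mathcal O}$ for the classes $\mathcal O$ with $|\mathcal O|\ge2$. -/

import Mathlib

namespace CalogeroMoser

open Finset

noncomputable section

/-! ### Complex reflection groups and the Gaudin algebra -/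

/-- The field `ℂ(V)` of rational functions on `V = ℂⁿ`; the variable `MvPolynomial.X i` is the
`i`-th coordinate form, i.e. the `i`-th vector of the dual of the standard basis of `V`. -/
abbrev RatFun (n : ℕ) : Type := FractionRing (MvPolynomial (Fin n) ℂ)

/-- A linear form on `ℂⁿ`, seen as a polynomial function, hence as an element of `ℂ(V)`. -/
def formFun {n : ℕ} (a : Module.Dual ℂ (Fin n → ℂ)) : RatFun n :=
  algebraMap (MvPolynomial (Fin n) ℂ) (RatFun n)
    (∑ i, MvPolynomial.C (a (Pi.single i 1)) * MvPolynomial.X i)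

/-- The underlying matrix of an element of a subgroup of `GLₙ(ℂ)`. -/
def toMat {n : ℕ} {W : Subgroup (GL (Fin n) ℂ)} (w : W) : Matrix (Fin n) (Fin n) ℂ :=
  ((w : GL (Fin n) ℂ) : Matrix (Fin n) (Fin n) ℂ)

/-- The set `Ref(W)` of (pseudo-)reflections of `W`: the elements `s` such that `s - 1` has
rank one. -/
def Ref {n : ℕ} (W : Subgroup (GL (Fin n) ℂ)) : Set W := {s | (toMat s - 1).rank = 1}

/-- `c` is constant on the conjugacy classes of reflections of `W` (only the values of `c` on
reflections are ever used). -/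
def IsParameter {n : ℕ} (W : Subgroup (GL (Fin n) ℂ)) (c : W → ℂ) : Prop :=
  ∀ s ∈ Ref W, ∀ w : W, c (w * s * w⁻¹) = c s

/-- `α` chooses, for each reflection `s` of `W`, a linear form `α s` with
`ker (s - 1) = ker (α s)`. -/
def IsRootChoice {n : ℕ} (W : Subgroup (GL (Fin n) ℂ))
    (α : W → Module.Dual ℂ (Fin n → ℂ)) : Prop :=
  ∀ s ∈ Ref W, LinearMap.ker (Matrix.toLin' (toMat s - 1)) = LinearMap.ker (α s)

section Gaudin

variable {n : ℕ} (W : Subgroup (GL (Fin n) ℂ)) (c : W → ℂ)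
  (α : W → Module.Dual ℂ (Fin n → ℂ))

/-- `𝒟_y = ∑_{s ∈ Ref(W)} c_s det(s) (⟨y, α_s⟩ / α_s) s`, in the group algebra `ℂ(V) W`. -/
def gaudinElt (y : Fin n → ℂ) : MonoidAlgebra (RatFun n) W :=
  ∑ᶠ s ∈ Ref W, MonoidAlgebra.single s
    (algebraMap ℂ (RatFun n) (c s * (toMat s).det * α s y) / formFun (α s))

/-- The Gaudin algebra: the `ℂ[V]`-subalgebra generated by the `𝒟_y`, `y ∈ V`. -/
def gaudin : Subalgebra (MvPolynomial (Fin n) ℂ) (MonoidAlgebra (RatFun n) W) :=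
  Algebra.adjoin (MvPolynomial (Fin n) ℂ) (Set.range (gaudinElt W c α))

/-- The algebra `ℂ(V) Gau_c(W)`, i.e. the `ℂ(V)`-subalgebra of `ℂ(V) W` generated by the Gaudin
algebra. -/
def gaudinK : Subalgebra (RatFun n) (MonoidAlgebra (RatFun n) W) :=
  Algebra.adjoin (RatFun n) (gaudin W c α : Set (MonoidAlgebra (RatFun n) W))

/-- The ring `ℂ(V) Gau_c(W)`, as a type. -/
def GauK : Type := gaudinK W c α

instance : Ring (GauK W c α) := inferInstanceAs (Ring (gaudinK W c α))

instance : Algebra (RatFun n) (GauK W c α) :=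
  inferInstanceAs (Algebra (RatFun n) (gaudinK W c α))

/-- The inclusion of `ℂ(V) Gau_c(W)` in `ℂ(V) W`. -/
def GauK.incl : GauK W c α →ₐ[RatFun n] MonoidAlgebra (RatFun n) W := (gaudinK W c α).val

end Gaudin

/-! ### Representations, multiplicities and cellular characters -/

/-- Finite-dimensional complex representations of `G`, in matrix form. -/
abbrev MatRep (G : Type) [Group G] (m : ℕ) : Type := G →* Matrix (Fin m) (Fin m) ℂ

/-- The representation on the space `Fᵐ` of column vectors given by a complex matrix
representation, for a field extension `F` of `ℂ`. -/
def MatRep.over {G : Type} [Group G] {m : ℕ} (F : Type) [Field F] [Algebra ℂ F]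
    (r : MatRep G m) : Representation F G (Fin m → F) :=
  (Matrix.toLinAlgEquiv' : Matrix (Fin m) (Fin m) F ≃ₐ[F] _).toAlgHom.toRingHom.toMonoidHom.comp
    (((algebraMap ℂ F).mapMatrix.toMonoidHom).comp r)

/-- The character of a matrix representation. -/
def MatRep.char {G : Type} [Group G] {m : ℕ} (r : MatRep G m) : G → ℂ := fun g => (r g).trace

/-- `χ` is the character of the irreducible complex representation `r`. -/
def Affords {G : Type} [Group G] (r : Σ m, MatRep G m) (χ : G → ℂ) : Prop :=
  (r.2.over ℂ).IsIrreducible ∧ r.2.char = χ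

/-- The set `Irr(G)` of irreducible complex characters. -/
def irrChars (G : Type) [Group G] : Set (G → ℂ) := {χ | ∃ r, Affords r χ}

/-- A representation `V_χ` affording `χ ∈ Irr(G)`. -/
def affordingRep {G : Type} [Group G] (χ : irrChars G) : Σ m, MatRep G m := χ.2.choose

open Classical in
/-- The multiplicity `[M : L]` of `L` in the `A`-module `M`: the number of factors isomorphic to
`L` in a composition series of `M`. -/
def compMult (A M L : Type) [Ring A] [AddCommGroup M] [Module A M] [AddCommGroup L]
    [Module A L] : ℕ :=
  if h : ∃ σ : CompositionSeries (Submodule A M), σ.head = ⊥ ∧ σ.last = ⊤ then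
    Nat.card {i : Fin h.choose.length //
      Nonempty ((h.choose i.succ ⧸
        (h.choose i.castSucc).comap (h.choose i.succ).subtype) ≃ₗ[A] L)}
  else 0

section Cellular

variable {n : ℕ} (W : Subgroup (GL (Fin n) ℂ)) (c : W → ℂ)
  (α : W → Module.Dual ℂ (Fin n → ℂ))

/-- The space of the extension to `ℂ(V)` of a representation `r` of `W`. -/
def extMod {W : Subgroup (GL (Fin n) ℂ)} {m : ℕ} (_ : MatRep W m) : Type := Fin m → RatFun n

instance {W : Subgroup (GL (Fin n) ℂ)} {m : ℕ} (r : MatRep W m) : AddCommGroup (extMod r) :=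
  inferInstanceAs (AddCommGroup (Fin m → RatFun n))

/-- The `ℂ(V)W`-module `ℂ(V) r`. -/
instance {W : Subgroup (GL (Fin n) ℂ)} {m : ℕ} (r : MatRep W m) :
    Module (MonoidAlgebra (RatFun n) W) (extMod r) :=
  Module.compHom (Fin m → RatFun n) (r.over (RatFun n)).asAlgebraHom.toRingHom

/-- The restriction of the `ℂ(V)W`-module `ℂ(V) r` to `ℂ(V) Gau_c(W)`. -/
instance {m : ℕ} (r : MatRep W m) : Module (GauK W c α) (extMod r) :=
  Module.compHom (extMod r) (GauK.incl W c α).toRingHom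

/-- The character
`γ_L = ∑_{χ ∈ Irr(W)} [Res (ℂ(V) V_χ) : L] χ` attached to a `ℂ(V) Gau_c(W)`-module `L`. -/
def cellChar (L : Type) [AddCommGroup L] [Module (GauK W c α) L] : W → ℂ :=
  ∑ᶠ χ : irrChars W, compMult (GauK W c α) (extMod (affordingRep χ).2) L • (χ : W → ℂ)

/-- The set of Calogero-Moser `c`-cellular characters of `W`. -/
def cellularCharacters : Set (W → ℂ) :=
  {γ | ∃ (L : Type) (_ : AddCommGroup L) (_ : Module (GauK W c α) L),
    IsSimpleModule (GauK W c α) L ∧ cellChar W c α L = γ}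

end Cellular

/-! ### The groups `G(d,1,n)` -/

/-- The monomial matrix with entry `a i` at position `(i, π i)`. -/
def monoMat {n : ℕ} (π : Equiv.Perm (Fin n)) (a : Fin n → ℂˣ) : Matrix (Fin n) (Fin n) ℂ :=
  fun i j => if j = π i then (a i : ℂ) else 0

theorem monoMat_mul {n : ℕ} (π τ : Equiv.Perm (Fin n)) (a b : Fin n → ℂˣ) :
    monoMat π a * monoMat τ b = monoMat (τ * π) (fun i => a i * b (π i)) := by
  ext i k
  simp only [monoMat, Matrix.mul_apply, mul_ite, ite_mul, zero_mul, mul_zero]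
  rw [Finset.sum_eq_single (π i)]
  · rw [if_pos rfl]; rfl
  · intro j _ hj; simp [hj]
  · simp

theorem monoMat_one {n : ℕ} : monoMat (1 : Equiv.Perm (Fin n)) 1 = 1 := by
  ext i k
  simp [monoMat, Matrix.one_apply, eq_comm]

/-- The monomial matrix as an element of `GLₙ(ℂ)`. -/
def mono {n : ℕ} (π : Equiv.Perm (Fin n)) (a : Fin n → ℂˣ) : GL (Fin n) ℂ where
  val := monoMat π a
  inv := monoMat π⁻¹ (fun i => (a (π⁻¹ i))⁻¹)
  val_inv := by
    rw [monoMat_mul, ← monoMat_one]; congr 1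
    · simp
    · funext i; simp
  inv_val := by
    rw [monoMat_mul, ← monoMat_one]; congr 1
    · simp
    · funext i; simp

/-- `G(d,1,n)`: the monomial matrices whose nonzero entries are `d`-th roots of unity. -/
def Gd1 (d n : ℕ) : Subgroup (GL (Fin n) ℂ) where
  carrier := {g | ∃ π a, (∀ i, a i ^ d = 1) ∧ g = mono π a}
  one_mem' := ⟨1, 1, by simp, Units.ext monoMat_one.symm⟩
  mul_mem' := by
    rintro _ _ ⟨π, a, ha, rfl⟩ ⟨τ, b, hb, rfl⟩
    exact ⟨τ * π, fun i => a i * b (π i), fun i => by simp [mul_pow, ha, hb],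
      Units.ext (monoMat_mul π τ a b)⟩
  inv_mem' := by
    rintro _ ⟨π, a, ha, rfl⟩
    exact ⟨π⁻¹, fun i => (a (π⁻¹ i))⁻¹, fun i => by simp [ha], Units.ext rfl⟩

/-- The nonzero entry of row `p` of a monomial matrix, as the sum of the entries of that row. -/
def rowEntry {d n : ℕ} (g : Gd1 d n) (p : Fin n) : ℂ := ∑ q, toMat g p q

theorem exists_mono {d n : ℕ} (g : Gd1 d n) : ∃ π a, toMat g = monoMat π a ∧
    ∀ p, rowEntry g p = a p := by
  obtain ⟨g, π, a, -, rfl⟩ := g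
  exact ⟨π, a, rfl, fun p => by simp [rowEntry, toMat, mono, monoMat]⟩

theorem rowEntry_mul {d n : ℕ} (g h : Gd1 d n) (π : Equiv.Perm (Fin n)) (a : Fin n → ℂˣ)
    (hg : toMat g = monoMat π a) (p : Fin n) :
    rowEntry (g * h) p = a p * rowEntry h (π p) := by
  have : toMat (g * h) = toMat g * toMat h := rfl
  rw [rowEntry, this, hg]
  simp [monoMat, Matrix.mul_apply, rowEntry, Finset.mul_sum]

theorem rowEntry_one {d n : ℕ} (p : Fin n) : rowEntry (1 : Gd1 d n) p = 1 := by
  have : toMat (1 : Gd1 d n) = 1 := rfl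
  simp [rowEntry, this, Matrix.one_apply]

/-! ### The group `G(d,1,2)` and its irreducible representations -/

/-- The permutation matrix `s`. -/
def sElt (d : ℕ) : Gd1 d 2 :=
  ⟨mono (Equiv.swap 0 1) 1, Equiv.swap 0 1, 1, by simp, rfl⟩

/-- The diagonal matrix `t = diag(ζ, 1)`. -/
def tElt {d : ℕ} (ζ : rootsOfUnity d ℂ) : Gd1 d 2 :=
  ⟨mono 1 ![(ζ : ℂˣ), 1], 1, ![(ζ : ℂˣ), 1], by
    have : (ζ : ℂˣ) ^ d = 1 := ζ.2
    intro i; fin_cases i <;> simp [this], rfl⟩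

/-- The product of the nonzero entries of a monomial matrix. -/
def entryProd (d : ℕ) : Gd1 d 2 →* ℂ where
  toFun g := ∏ p, rowEntry g p
  map_one' := by simp [rowEntry_one]
  map_mul' g h := by
    obtain ⟨π, a, hg, ha⟩ := exists_mono g
    simp_rw [rowEntry_mul g h π a hg, Finset.prod_mul_distrib, ha]
    rw [Equiv.prod_comp π (rowEntry h)]

/-- The representation `η_i` (`i ≥ 1`): `s ↦ 1`, `t ↦ ζ^(i-1)`. -/
def etaRep (d i : ℕ) : MatRep (Gd1 d 2) 1 :=
  (Matrix.scalar (Fin 1)).toMonoidHom.comp ((powMonoidHom (i - 1)).comp (entryProd d))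

/-- The representation `η'_i` (`i ≥ 1`): `s ↦ -1`, `t ↦ ζ^(i-1)`. It is the product of `η_i` and
of the sign of the underlying permutation, i.e. the determinant divided by the product of the
nonzero entries. -/
def etaRep' (d i : ℕ) : MatRep (Gd1 d 2) 1 :=
  (Matrix.scalar (Fin 1)).toMonoidHom.comp
    { toFun := fun g => (toMat g).det * (entryProd d g)⁻¹ * entryProd d g ^ (i - 1)
      map_one' := by
        have : toMat (1 : Gd1 d 2) = 1 := rfl
        simp [this]
      map_mul' := fun g h => by
        have : toMat (g * h) = toMat g * toMat h := rfl
        rw [this, Matrix.det_mul, map_mul, mul_inv, mul_pow]; ring }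

/-- The representation `ρ_{i,j}` (`1 ≤ i < j`): `s ↦ !![0, 1; 1, 0]`,
`t ↦ diag(ζ^(i-1), ζ^(j-1))`. -/
def rhoRep (d i j : ℕ) : MatRep (Gd1 d 2) 2 where
  toFun g := Matrix.of fun p q => if toMat g p q = 0 then 0 else
    rowEntry g p ^ (i - 1) * rowEntry g p.rev ^ (j - 1)
  map_one' := by
    have : toMat (1 : Gd1 d 2) = 1 := rfl
    ext p q
    simp [this, rowEntry_one, Matrix.one_apply]
  map_mul' g h := by
    obtain ⟨π, a, hg, ha⟩ := exists_mono g
    obtain ⟨τ, b, hh, hb⟩ := exists_mono h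
    have hgh : toMat (g * h) = toMat g * toMat h := rfl
    have hrev : ∀ (σ : Equiv.Perm (Fin 2)) (p : Fin 2), σ p.rev = (σ p).rev := by decide
    ext p q
    simp only [Matrix.mul_apply, Matrix.of_apply, hgh, hg, hh, rowEntry_mul g h π a hg, hrev,
      ha, hb]
    rw [← Matrix.mul_apply, monoMat_mul, Finset.sum_eq_single (π p)]
    · simp only [monoMat, Equiv.Perm.mul_apply, if_true]
      split_ifs <;> simp_all [mul_pow]
      ring
    · intro l _ hl; simp [monoMat, hl]
    · simp

theorem etaRep_s (d i : ℕ) : etaRep d i (sElt d) = 1 := by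
  ext p q
  simp [etaRep, entryProd, rowEntry, sElt, toMat, mono, monoMat, Fin.prod_univ_two]

theorem etaRep_t {d : ℕ} (ζ : rootsOfUnity d ℂ) (i : ℕ) :
    etaRep d i (tElt ζ) = !![((ζ : ℂˣ) : ℂ) ^ (i - 1)] := by
  ext p q; fin_cases p; fin_cases q
  simp [etaRep, entryProd, rowEntry, tElt, toMat, mono, monoMat, Fin.prod_univ_two]

theorem etaRep'_s (d i : ℕ) : etaRep' d i (sElt d) = -1 := by
  ext p q
  simp [etaRep', entryProd, rowEntry, sElt, toMat, mono, monoMat, Fin.prod_univ_two,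
    Matrix.det_fin_two]
  fin_cases p; fin_cases q; simp

theorem etaRep'_t {d : ℕ} (ζ : rootsOfUnity d ℂ) (i : ℕ) :
    etaRep' d i (tElt ζ) = !![((ζ : ℂˣ) : ℂ) ^ (i - 1)] := by
  ext p q; fin_cases p; fin_cases q
  simp [etaRep', entryProd, rowEntry, tElt, toMat, mono, monoMat, Fin.prod_univ_two,
    Matrix.det_fin_two]

theorem rhoRep_s (d i j : ℕ) : rhoRep d i j (sElt d) = !![0, 1; 1, 0] := by
  ext p q
  fin_cases p <;> fin_cases q <;>
    simp [rhoRep, rowEntry, sElt, toMat, mono, monoMat, Fin.rev]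

theorem rhoRep_t {d : ℕ} (ζ : rootsOfUnity d ℂ) (i j : ℕ) :
    rhoRep d i j (tElt ζ) =
      !![((ζ : ℂˣ) : ℂ) ^ (i - 1), 0; 0, ((ζ : ℂˣ) : ℂ) ^ (j - 1)] := by
  ext p q
  fin_cases p <;> fin_cases q <;>
    simp [rhoRep, rowEntry, tElt, toMat, mono, monoMat, Fin.rev]

section Modules

variable {d : ℕ} (c : Gd1 d 2 → ℂ) (α : Gd1 d 2 → Module.Dual ℂ (Fin 2 → ℂ))

/-- `ℒ⁺_{i,j}` (for `ε = 1`) and `ℒ⁻_{i,j}` (for `ε = -1`), `d` even: the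
`ℂ(X,Y) Gau_c`-submodule of the restriction of `ℂ(X,Y) ρ_{i,j}` generated by the vector
`(X^(d/2-(j-i)), -ε Y^(d/2-(j-i)))`. -/
def pmSub (i j : ℕ) (ε : ℤ) : Submodule (GauK (Gd1 d 2) c α) (extMod (rhoRep d i j)) :=
  Submodule.span _ {show extMod (rhoRep d i j) from
    ![algebraMap (MvPolynomial (Fin 2) ℂ) (RatFun 2) (MvPolynomial.X 0)
        ^ ((d : ℤ) / 2 - ((j : ℤ) - i)),
      -(ε : RatFun 2) * algebraMap (MvPolynomial (Fin 2) ℂ) (RatFun 2) (MvPolynomial.X 1)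
        ^ ((d : ℤ) / 2 - ((j : ℤ) - i))]}

end Modules

/-! ### Parameters, equivalence classes and the listed characters -/

/-- The parameter `k_i = (1/d) ∑_{k=1}^{d-1} ζ^{k(1-i)} c_{t^k}` attached to the orbit of the
reflecting hyperplane of `t` (a function of `i` modulo `d`). -/
def kParam {d : ℕ} (ζ : rootsOfUnity d ℂ) (c : Gd1 d 2 → ℂ) (i : ℤ) : ℂ :=
  1 / d * ∑ k ∈ Ico 1 d, ((ζ : ℂˣ) : ℂ) ^ ((k : ℤ) * (1 - i)) * c (tElt ζ ^ k)

/-- `k♯_i = k_{1-i}`. -/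
def kSharp {d : ℕ} (ζ : rootsOfUnity d ℂ) (c : Gd1 d 2 → ℂ) (i : ℕ) : ℂ :=
  kParam ζ c (1 - i)

/-- `O` is an equivalence class of the relation `i ∼ j ↔ k_i = k_j` on `{1, …, d}`. -/
def IsSimClass (d : ℕ) (k : ℕ → ℂ) (O : Finset ℕ) : Prop :=
  ∃ i ∈ Icc 1 d, O = {j ∈ Icc 1 d | k j = k i}

/-- `O'` is an equivalence class with `k_i - k_j = δ` for `i ∈ O`, `j ∈ O'`. -/
def IsShift (d : ℕ) (k : ℕ → ℂ) (δ : ℂ) (O O' : Finset ℕ) : Prop :=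
  IsSimClass d k O' ∧ ∀ i ∈ O, ∀ j ∈ O', k i - k j = δ

/-- `O'` is the equivalence class with `k_i - k_j = δ` for `i ∈ O`, `j ∈ O'` if there is one, and
is empty otherwise. -/
def IsShiftOrEmpty (d : ℕ) (k : ℕ → ℂ) (δ : ℂ) (O O' : Finset ℕ) : Prop :=
  IsShift d k δ O O' ∨ (O' = ∅ ∧ ∀ P, ¬ IsShift d k δ O P)

/-- The character `ξ_i` of `η_i`. -/
def xi (d i : ℕ) : Gd1 d 2 → ℂ := (etaRep d i).char

/-- The character `ξ'_i` of `η'_i`. -/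
def xi' (d i : ℕ) : Gd1 d 2 → ℂ := (etaRep' d i).char

/-- The character `χ_{i,j}` of `ρ_{i,j}`. -/
def chi (d i j : ℕ) : Gd1 d 2 → ℂ := (rhoRep d i j).char

/-- `γ_O`, where `O'` is the class at distance `c₀` (or `∅`). -/
def gammaO (d : ℕ) (O O' : Finset ℕ) : Gd1 d 2 → ℂ :=
  ∑ i ∈ O, (xi d i + ∑ j ∈ O' with i < j, chi d i j + ∑ j ∈ O' with j < i, chi d j i)

/-- `γ'_O`, where `O'` is the class at distance `-c₀` (or `∅`). -/
def gammaO' (d : ℕ) (O O' : Finset ℕ) : Gd1 d 2 → ℂ :=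
  ∑ i ∈ O, (xi' d i + ∑ j ∈ O' with i < j, chi d i j + ∑ j ∈ O' with j < i, chi d j i)

/-- `γ_{O,O'}` for `O ≠ O'`. -/
def gammaPair (d : ℕ) (O O' : Finset ℕ) : Gd1 d 2 → ℂ :=
  ∑ i ∈ O, ∑ j ∈ O' with i < j, chi d i j + ∑ i ∈ O, ∑ j ∈ O' with j < i, chi d j i

/-- `γ_{O,O}`. -/
def gammaDiag (d : ℕ) (O : Finset ℕ) : Gd1 d 2 → ℂ :=
  ∑ i ∈ O, ∑ j ∈ O with i < j, chi d i j

end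

end CalogeroMoser

open CalogeroMoser

namespace CalogeroMoser

open Finset

noncomputable section

/-! ### Multiplicities in modules of length at most two -/

section Multiplicity

variable {A M L S S₁ S₂ : Type} [Ring A] [AddCommGroup M] [Module A M] [AddCommGroup L]
  [Module A L] [AddCommGroup S] [Module A S] [AddCommGroup S₁] [Module A S₁] [AddCommGroup S₂]
  [Module A S₂]

/-! Write `K = ℂ(X, Y)`, `k_i` for `k♯_i`, `x = (X/d) 𝒟_{(1,0)}` and `z = (X 𝒟_{(1,0)} + Y
𝒟_{(0,1)})/d`. As `𝒟_y` is linear in `y`, these two elements generate `A` over `K`. In `z` all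
denominators cancel, so `z` is `1/d` times the sum of the `c_s det(s) s`, and it acts on every
irreducible representation by a scalar: `2k_i ∓ c₀` on `η_i`, `η'_i` and `k_i + k_j` on `ρ_{i,j}`. A
partial fraction expansion (`sum_div_ratX_sub`) gives `x`: the scalar `k_i ∓ c₀ X^d/(X^d - Y^d)` on
`η_i`, `η'_i`, and on `ρ_{i,j}` a matrix of trace `k_i + k_j` and determinant `k_i k_j - c₀² X^d
Y^d/(X^d - Y^d)²`.

So in each listed representation `x² = q x - n` with `q` the scalar of `z`, and `A` acts through `K
+ K x`. The list is jointly faithful on `K W` (`eq_zero_of_extHom_eq_zero`), hence `A` is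
commutative (`gauK_mul_comm`). Over a commutative ring simple modules are separated by their
annihilators, and the annihilator of any simple module contains that of one of the restricted
representations (`exists_ann_le_of_faithful`).

Everything is then read off the discriminant `(a - b)² + 4 c₀² X^d Y^d/(X^d - Y^d)²`, where `a =
k_i` and `b = k_j`. It is a square in `K` exactly when `(a - b)² = c₀²`, or `a = b` and `d` is even;
the hard direction is `eq_or_even_of_polynomial_sq`. If it is not a square, `ρ_{i,j}` restricts to a
simple module, determined by the sum and product of `a`, `b`, that is by the unordered pair of
values. If `a - b = c₀` the restriction is `ℒ_i ⊕ ℒ'_j`, and if `a = b` with `d` even it is `ℒ⁺ ⊕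
ℒ⁻`. One-dimensional modules are compared through their pairs of eigenvalues of `x` and `z`. All
multiplicities are thus 0 or 1 and depend only on the values of `k`.

To sum over `Irr(W)` one also needs that the list of representations is complete and without
repetition (`exists_equivalent_repOf`, `char_repOf_injOn`), and that multiplicities do not depend on
the chosen composition series or representation. -/

theorem nonempty_linearEquiv_congr (e : S₁ ≃ₗ[A] S₂) :
    Nonempty (S₁ ≃ₗ[A] L) ↔ Nonempty (S₂ ≃ₗ[A] L) :=
  ⟨fun ⟨f⟩ => ⟨e.symm.trans f⟩, fun ⟨f⟩ => ⟨e.trans f⟩⟩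

/-- The definition uses an arbitrarily chosen composition series. By Jordan–Hölder the factors of
any two series match up to isomorphism, so a convenient one may be used instead. -/
theorem compMult_eq_card (σ : CompositionSeries (Submodule A M)) (h0 : σ.head = ⊥)
    (h1 : σ.last = ⊤) :
    compMult A M L = Nat.card {i : Fin σ.length //
      Nonempty ((σ i.succ ⧸ (σ i.castSucc).comap (σ i.succ).subtype) ≃ₗ[A] L)} := by
  have h : ∃ σ : CompositionSeries (Submodule A M), σ.head = ⊥ ∧ σ.last = ⊤ := ⟨σ, h0, h1⟩
  rw [compMult, dif_pos h]
  obtain ⟨f, hf⟩ := CompositionSeries.jordan_holder h.choose σ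
    (h.choose_spec.1.trans h0.symm) (h.choose_spec.2.trans h1.symm)
  refine Nat.card_congr (f.subtypeEquiv fun i => ?_)
  exact nonempty_linearEquiv_congr ((hf i).linearEquiv)

open Classical in
theorem compMult_of_equiv_simple [IsSimpleModule A S] (e : M ≃ₗ[A] S) :
    compMult A M L = if Nonempty (S ≃ₗ[A] L) then 1 else 0 := by
  have hM : IsSimpleModule A M := IsSimpleModule.congr e
  let σ : CompositionSeries (Submodule A M) :=
    { length := 1
      toFun := ![⊥, ⊤]
      step := fun i => by
        fin_cases i
        exact bot_covBy_top }
  have e' : ((⊤ : Submodule A M) ⧸ (⊥ : Submodule A M).comap (⊤ : Submodule A M).subtype)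
      ≃ₗ[A] S :=
    ((Submodule.quotEquivOfEqBot _ (by simp)).trans Submodule.topEquiv).trans e
  have hiff : ∀ i : Fin 1, Nonempty ((σ i.succ ⧸
      (σ i.castSucc).comap (σ i.succ).subtype) ≃ₗ[A] L) ↔ Nonempty (S ≃ₗ[A] L) := by
    intro i
    fin_cases i
    exact nonempty_linearEquiv_congr e'
  rw [compMult_eq_card σ rfl rfl]
  rw [Nat.card_congr (Equiv.subtypeEquivRight hiff)]
  split_ifs with h <;> simp [h]

-- The flag `0 ⊂ N ⊂ M`, with `N` the kernel of the projection to `S₂`, has factors `S₁` and `S₂`.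
open Classical in
theorem compMult_of_equiv_prod [IsSimpleModule A S₁] [IsSimpleModule A S₂]
    (e : M ≃ₗ[A] S₁ × S₂) :
    compMult A M L = (if Nonempty (S₁ ≃ₗ[A] L) then 1 else 0) +
      (if Nonempty (S₂ ≃ₗ[A] L) then 1 else 0) := by
  let g : M →ₗ[A] S₂ := (LinearMap.snd A S₁ S₂).comp e.toLinearMap
  have hg : Function.Surjective g := Prod.snd_surjective.comp e.surjective
  let N : Submodule A M := LinearMap.ker g
  let e₂ : (M ⧸ N) ≃ₗ[A] S₂ := g.quotKerEquivOfSurjective hg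
  let f : N →ₗ[A] S₁ := ((LinearMap.fst A S₁ S₂).comp e.toLinearMap).comp N.subtype
  have hf : Function.Bijective f := by
    constructor
    · rintro ⟨a, ha⟩ ⟨b, hb⟩ hab
      apply Subtype.ext
      apply e.injective
      exact Prod.ext hab ((LinearMap.mem_ker.1 ha).trans (LinearMap.mem_ker.1 hb).symm)
    · intro s
      refine ⟨⟨e.symm (s, 0), ?_⟩, ?_⟩
      · simp [N, g]
      · simp [f]
  let e₁ : N ≃ₗ[A] S₁ := LinearEquiv.ofBijective f hf
  have hN : IsSimpleModule A N := IsSimpleModule.congr e₁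
  have hMN : IsSimpleModule A (M ⧸ N) := IsSimpleModule.congr e₂
  let σ : CompositionSeries (Submodule A M) :=
    { length := 2
      toFun := ![⊥, N, ⊤]
      step := fun i => by
        fin_cases i
        · exact (isSimpleModule_iff_isAtom.1 hN).bot_covBy
        · exact (isSimpleModule_iff_isCoatom.1 hMN).covBy_top }
  have e₁' : (N ⧸ (⊥ : Submodule A M).comap N.subtype) ≃ₗ[A] S₁ :=
    (Submodule.quotEquivOfEqBot _ (by
      rw [Submodule.comap_bot, Submodule.ker_subtype])).trans e₁
  have e₂' : ((⊤ : Submodule A M) ⧸ N.comap (⊤ : Submodule A M).subtype) ≃ₗ[A] S₂ :=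
    (Submodule.Quotient.equiv _ N Submodule.topEquiv (by
      ext y; simp)).trans e₂
  have hiff : ∀ i : Fin 2, Nonempty ((σ i.succ ⧸
      (σ i.castSucc).comap (σ i.succ).subtype) ≃ₗ[A] L) ↔
        ![Nonempty (S₁ ≃ₗ[A] L), Nonempty (S₂ ≃ₗ[A] L)] i := by
    intro i
    fin_cases i
    · exact nonempty_linearEquiv_congr e₁'
    · exact nonempty_linearEquiv_congr e₂'
  rw [compMult_eq_card σ rfl rfl]
  rw [Nat.card_congr (Equiv.subtypeEquivRight hiff)]
  change Nat.card {i : Fin 2 // _} = _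
  rw [Nat.card_eq_fintype_card, Fintype.card_subtype]
  rw [Finset.card_filter, Fin.sum_univ_two]
  simp only [Matrix.cons_val_zero, Matrix.cons_val_one]
  congr

end Multiplicity

/-! ### Simple modules over commutative algebras generated by two elements -/

section Simple

variable {A M N L : Type} [Ring A] [AddCommGroup M] [Module A M] [AddCommGroup L]
  [Module A L] [AddCommGroup N] [Module A N]

/-- Two simple modules over a commutative ring are isomorphic as soon as the annihilator of the
first one is contained in that of the second one. -/
theorem nonempty_linearEquiv_of_ann_le (hA : ∀ a b : A, a * b = b * a) [IsSimpleModule A M]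
    [IsSimpleModule A N] (h : ∀ a : A, (∀ m : M, a • m = 0) → ∀ n : N, a • n = 0) :
    Nonempty (M ≃ₗ[A] N) := by
  have := IsSimpleModule.nontrivial A M
  have := IsSimpleModule.nontrivial A N
  obtain ⟨m, hm⟩ := exists_ne (0 : M)
  obtain ⟨n, hn⟩ := exists_ne (0 : N)
  have hf := IsSimpleModule.toSpanSingleton_surjective A hm
  -- By commutativity an element killing the generator `m` kills all of `M`, hence also `N`; so `a •
  -- m ↦ a • n` is well defined.
  have hle : LinearMap.ker (LinearMap.toSpanSingleton A M m) ≤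
      LinearMap.ker (LinearMap.toSpanSingleton A N n) := by
    intro a ha
    rw [LinearMap.mem_ker, LinearMap.toSpanSingleton_apply] at ha ⊢
    refine h a (fun m' => ?_) n
    obtain ⟨b, rfl⟩ := hf m'
    rw [LinearMap.toSpanSingleton_apply, smul_smul, hA, ← smul_smul, ha, smul_zero]
  let g : M →ₗ[A] N := ((LinearMap.ker (LinearMap.toSpanSingleton A M m)).liftQ _ hle).comp
    (LinearMap.quotKerEquivOfSurjective _ hf).symm.toLinearMap
  have hg : g m = n := by
    have h1 : (LinearMap.quotKerEquivOfSurjective _ hf).symm m =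
        Submodule.Quotient.mk (1 : A) := by
      rw [LinearEquiv.symm_apply_eq]
      simp
    change Submodule.liftQ _ _ hle ((LinearMap.quotKerEquivOfSurjective _ hf).symm m) = n
    rw [h1]
    simp
  refine ⟨LinearEquiv.ofBijective g (LinearMap.bijective_of_ne_zero ?_)⟩
  rintro h0
  rw [h0] at hg
  exact hn hg.symm

/-- Any nonzero vector generates a simple module, and commutativity moves `a` past the multiplier.
So each element of the ring acts on `L` either as zero or injectively. -/
theorem smul_eq_zero_of_smul_ne (hA : ∀ a b : A, a * b = b * a) [IsSimpleModule A L] {a : A}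
    {l : L} (hl : l ≠ 0) (h : a • l = 0) (l' : L) : a • l' = 0 := by
  obtain ⟨b, rfl⟩ := IsSimpleModule.toSpanSingleton_surjective A hl l'
  rw [LinearMap.toSpanSingleton_apply, smul_smul, hA, ← smul_smul, h, smul_zero]

/-- Over a commutative ring, the annihilator of a simple module contains the annihilator of some
member of any finite faithful family of modules. -/
theorem exists_ann_le_of_faithful (hA : ∀ a b : A, a * b = b * a) [IsSimpleModule A L]
    {ι : Type} (s : Finset ι) (V : ι → Type) [∀ i, AddCommGroup (V i)] [∀ i, Module A (V i)]
    (hV : ∀ a : A, (∀ i ∈ s, ∀ v : V i, a • v = 0) → a = 0) :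
    ∃ i ∈ s, ∀ a : A, (∀ v : V i, a • v = 0) → ∀ l : L, a • l = 0 := by
  classical
  by_contra! hcon
  -- The annihilator of `L` is prime: if each `V i` is killed by some element not killing `L`, the
  -- product of these elements kills every `V i` and still acts injectively on `L`. Faithfulness
  -- makes that product zero.
  have key : ∀ u : Finset ι, u ⊆ s → ∃ a : A, (∀ i ∈ u, ∀ v : V i, a • v = 0) ∧
      ∀ l : L, a • l = 0 → l = 0 := by
    intro u
    induction u using Finset.induction_on with
    | empty => exact fun _ => ⟨1, by simp, by simp⟩
    | insert i u _ ih =>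
      intro hu
      obtain ⟨a, ha, hal⟩ := ih fun j hj => hu (Finset.mem_insert_of_mem hj)
      obtain ⟨b, hb, l, hbl⟩ := hcon i (hu (Finset.mem_insert_self i u))
      refine ⟨a * b, ?_, ?_⟩
      · intro j hj v
        rcases Finset.mem_insert.1 hj with rfl | hj
        · rw [← smul_smul, hb, smul_zero]
        · rw [hA, ← smul_smul, ha j hj, smul_zero]
      · intro l' hl'
        rw [← smul_smul] at hl'
        by_contra hne
        exact hbl (smul_eq_zero_of_smul_ne hA hne (hal _ hl') l)
  obtain ⟨a, ha, hal⟩ := key s le_rfl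
  have := IsSimpleModule.nontrivial A L
  obtain ⟨l, hl⟩ := exists_ne (0 : L)
  exact hl (hal l (by rw [hV a ha, zero_smul]))

end Simple

/-! ### Modules over an algebra generated by two elements, one scalar and one quadratic -/

section TwoGenerators

variable {K A : Type} [Field K] [Ring A] [Algebra K A] (x z : A)

/-- A one-dimensional module on which `x` and `z` act by the scalars `p` and `q`. -/
structure IsLine (M : Type) [AddCommGroup M] [Module A M] (p q : K) : Prop where
  smul_z : ∀ m : M, z • m = algebraMap K A q • m
  smul_x : ∀ m : M, x • m = algebraMap K A p • m
  simple : IsSimpleModule A M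

/-- A two-dimensional module with a basis `e`, `x e`, on which `z` acts by the scalar `q` and
`x` has trace `q` and determinant `n`. -/
structure IsPlane (M : Type) [AddCommGroup M] [Module A M] (q n : K) : Prop where
  smul_z : ∀ m : M, z • m = algebraMap K A q • m
  smul_x : ∀ m : M, x • x • m = algebraMap K A q • x • m - algebraMap K A n • m
  cyclic : ∃ e : M, (∀ m : M, ∃ a b : K, m = algebraMap K A a • e + algebraMap K A b • x • e) ∧
    ∀ a b : K, algebraMap K A a • e + algebraMap K A b • x • e = 0 → a = 0 ∧ b = 0

variable {x z} {M N L : Type} [AddCommGroup M] [Module A M] [AddCommGroup N] [Module A N]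
  [AddCommGroup L] [Module A L] {p q n p' q' n' : K}

theorem eq_of_algebraMap_smul_eq {m : M} (hm : m ≠ 0)
    (h : algebraMap K A p • m = algebraMap K A q • m) : p = q := by
  let _ : Module K M := Module.compHom M (algebraMap K A)
  exact smul_left_injective K hm h

theorem algebraMap_smul_comm (k : K) (a : A) (m : M) :
    a • algebraMap K A k • m = algebraMap K A k • a • m := by
  rw [smul_smul, smul_smul, Algebra.commutes]

/-- Once `z` is a scalar and `x²` reduces to `q x - n`, the algebra acts through `K + K x`. The
coefficients do not depend on `m`; applied to a product `M × N`, this gives common coefficients for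
two modules, which is how isomorphisms are detected below. -/
theorem exists_smul_eq (hgen : Algebra.adjoin K {x, z} = ⊤)
    (hz : ∀ m : M, z • m = algebraMap K A q • m)
    (hx : ∀ m : M, x • x • m = algebraMap K A q • x • m - algebraMap K A n • m) (a : A) :
    ∃ b c : K, ∀ m : M, a • m = algebraMap K A b • m + algebraMap K A c • x • m := by
  -- `M` has no `K`-structure of its own. This local one makes scalars acting through `algebraMap`
  -- visible to `module`, while `X` hides `x • _` behind an opaque map so that its values become
  -- atoms.
  let _ : Module K M := Module.compHom M (algebraMap K A)
  have hs : ∀ (k : K) (m : M), algebraMap K A k • m = k • m := fun _ _ => rfl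
  have hc : ∀ (k : K) (m : M), x • k • m = k • x • m := fun k m => algebraMap_smul_comm k x m
  obtain ⟨X, hX⟩ : ∃ X : M → M, ∀ m, x • m = X m := ⟨_, fun _ => rfl⟩
  simp only [hs] at hz hx ⊢
  have ha : a ∈ Algebra.adjoin K {x, z} := by rw [hgen]; trivial
  induction ha using Algebra.adjoin_induction with
  | mem y hy =>
    rcases hy with rfl | rfl
    · exact ⟨0, 1, fun m => by simp only [hX]; module⟩
    · exact ⟨q, 0, fun m => by rw [hz]; simp only [hX]; module⟩
  | algebraMap k => exact ⟨k, 0, fun m => by rw [hs]; simp only [hX]; module⟩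
  | add y y' _ _ h h' =>
    obtain ⟨b, c, h⟩ := h
    obtain ⟨b', c', h'⟩ := h'
    exact ⟨b + b', c + c', fun m => by rw [add_smul, h, h']; simp only [hX]; module⟩
  | mul y y' _ _ h h' =>
    obtain ⟨b, c, h⟩ := h
    obtain ⟨b', c', h'⟩ := h'
    -- The coefficients of `(b + c x)(b' + c' x)` after replacing `x²` by `q x - n`.
    refine ⟨b * b' - c * c' * n, b * c' + c * b' + c * c' * q, fun m => ?_⟩
    rw [mul_smul, h', h]
    simp only [smul_add, hc, hx]
    simp only [hX]
    module

theorem isLine_of_generator {v : M} (hv : v ≠ 0)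
    (hspan : ∀ m : M, ∃ k : K, m = algebraMap K A k • v)
    (hx : x • v = algebraMap K A p • v) (hz : z • v = algebraMap K A q • v) :
    IsLine x z M p q := by
  refine ⟨fun m => ?_, fun m => ?_, ?_⟩
  · obtain ⟨k, rfl⟩ := hspan m
    rw [algebraMap_smul_comm, hz, algebraMap_smul_comm]
  · obtain ⟨k, rfl⟩ := hspan m
    rw [algebraMap_smul_comm, hx, algebraMap_smul_comm]
  · refine isSimpleModule_iff_toSpanSingleton_surjective.2 ⟨⟨v, 0, hv⟩, fun m hm m' => ?_⟩
    obtain ⟨k, rfl⟩ := hspan m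
    obtain ⟨k', rfl⟩ := hspan m'
    have hk : k ≠ 0 := by rintro rfl; simp at hm
    refine ⟨algebraMap K A (k' / k), ?_⟩
    rw [LinearMap.toSpanSingleton_apply, smul_smul, ← map_mul, div_mul_cancel₀ _ hk]

/-- A common eigenvector of the two generators is an eigenvector of the whole algebra, so the
submodule it generates is just its `K`-line. -/
theorem isLine_span (hgen : Algebra.adjoin K {x, z} = ⊤) {v : M} (hv : v ≠ 0)
    (hx : x • v = algebraMap K A p • v) (hz : z • v = algebraMap K A q • v) :
    IsLine x z (Submodule.span A {v}) p q := by
  have hscal : ∀ a : A, ∃ k : K, a • v = algebraMap K A k • v := by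
    intro a
    have ha : a ∈ Algebra.adjoin K {x, z} := by rw [hgen]; trivial
    induction ha using Algebra.adjoin_induction with
    | mem y hy =>
      rcases hy with rfl | rfl
      · exact ⟨p, hx⟩
      · exact ⟨q, hz⟩
    | algebraMap k => exact ⟨k, rfl⟩
    | add y y' _ _ h h' =>
      obtain ⟨k, h⟩ := h
      obtain ⟨k', h'⟩ := h'
      exact ⟨k + k', by rw [add_smul, h, h', map_add, add_smul]⟩
    | mul y y' _ _ h h' =>
      obtain ⟨k, h⟩ := h
      obtain ⟨k', h'⟩ := h'
      exact ⟨k' * k, by rw [mul_smul, h', algebraMap_smul_comm, h, map_mul, mul_smul]⟩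
  refine isLine_of_generator (v := ⟨v, Submodule.mem_span_singleton_self v⟩)
    (fun h => hv (congrArg Subtype.val h)) ?_ (Subtype.ext hx) (Subtype.ext hz)
  rintro ⟨m, hm⟩
  obtain ⟨a, rfl⟩ := Submodule.mem_span_singleton.1 hm
  obtain ⟨k, hk⟩ := hscal a
  exact ⟨k, Subtype.ext hk⟩

/-- The scalar `p` is a root of `(T - p)(T - (q - p))`. Hence lines obey a quadratic relation of the
same shape as planes, and `exists_smul_eq` applies to both. -/
theorem IsLine.smul_x_smul_x (h : IsLine x z M p q) (m : M) :
    x • x • m = algebraMap K A q • x • m - algebraMap K A (p * (q - p)) • m := by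
  let _ : Module K M := Module.compHom M (algebraMap K A)
  have hs : ∀ (k : K) (m : M), algebraMap K A k • m = k • m := fun _ _ => rfl
  simp only [h.smul_x, hs]
  module

theorem IsLine.nonempty_linearEquiv_iff (hA : ∀ a b : A, a * b = b * a)
    (hgen : Algebra.adjoin K {x, z} = ⊤) (h : IsLine x z M p q) (h' : IsLine x z N p' q') :
    Nonempty (M ≃ₗ[A] N) ↔ p = p' ∧ q = q' := by
  have := h.simple
  have := h'.simple
  obtain ⟨m, hm⟩ := have := IsSimpleModule.nontrivial A M; exists_ne (0 : M)
  constructor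
  · rintro ⟨e⟩
    have hem : e m ≠ 0 := e.map_ne_zero_iff.2 hm
    constructor
    · apply eq_of_algebraMap_smul_eq (A := A) hem
      rw [← h'.smul_x, ← map_smul, ← map_smul, h.smul_x]
    · apply eq_of_algebraMap_smul_eq (A := A) hem
      rw [← h'.smul_z, ← map_smul, ← map_smul, h.smul_z]
  · rintro ⟨rfl, rfl⟩
    refine nonempty_linearEquiv_of_ann_le (M := M) (N := N) hA fun a ha k => ?_
    -- Working in `M × N` makes `a` act through the same `b + c x` on both factors; it kills `M`
    -- only if `b + c p = 0`, and then it kills `N`.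
    obtain ⟨b, c, hbc⟩ := exists_smul_eq (M := M × N) (q := q) (n := p * (q - p)) hgen
      (fun v => Prod.ext (h.smul_z v.1) (h'.smul_z v.2))
      (fun v => Prod.ext (h.smul_x_smul_x v.1) (h'.smul_x_smul_x v.2)) a
    have h1 : ∀ m : M, a • m = algebraMap K A (b + c * p) • m := fun m => by
      have := congrArg Prod.fst (hbc (m, 0))
      simp only [Prod.smul_fst, Prod.fst_add, h.smul_x] at this
      rw [this, map_add, map_mul, add_smul, mul_smul]
    have h2 : ∀ m : N, a • m = algebraMap K A (b + c * p) • m := fun m => by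
      have := congrArg Prod.snd (hbc (0, m))
      simp only [Prod.smul_snd, Prod.snd_add, h'.smul_x] at this
      rw [this, map_add, map_mul, add_smul, mul_smul]
    have h3 : b + c * p = 0 := by
      apply eq_of_algebraMap_smul_eq (A := A) hm
      rw [← h1, ha, map_zero, zero_smul]
    rw [h2, h3, map_zero, zero_smul]

theorem IsPlane.exists_ne_zero (h : IsPlane x z M q n) : ∃ m : M, m ≠ 0 := by
  obtain ⟨e, -, he⟩ := h.cyclic
  refine ⟨e, ?_⟩
  rintro rfl
  exact one_ne_zero (he 1 0 (by simp)).1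

/-- A proper nonzero submodule would be spanned by an eigenvector of `x`, whose eigenvalue would be
a root of `T² - q T + n`. Concretely, every nonzero vector generates `e`. -/
theorem IsPlane.isSimpleModule (h : IsPlane x z M q n) (hn : ∀ k : K, k ^ 2 - q * k + n ≠ 0) :
    IsSimpleModule A M := by
  let _ : Module K M := Module.compHom M (algebraMap K A)
  have hs : ∀ (k : K) (m : M), algebraMap K A k • m = k • m := fun _ _ => rfl
  have hc : ∀ (k : K) (m : M), x • k • m = k • x • m := fun k m => algebraMap_smul_comm k x m
  obtain ⟨X, hX⟩ : ∃ X : M → M, ∀ m, x • m = X m := ⟨_, fun _ => rfl⟩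
  obtain ⟨e, he, he'⟩ := h.cyclic
  have hx := h.smul_x
  simp only [hs] at he he' hx
  refine isSimpleModule_iff_toSpanSingleton_surjective.2 ⟨⟨e, 0, ?_⟩, fun m hm => ?_⟩
  · rintro rfl
    exact one_ne_zero (he' 1 0 (by simp)).1
  obtain ⟨a, b, rfl⟩ := he m
  -- The norm of `a + b x`: multiplying by the conjugate `a + b q - b x` gives this scalar. For `b ≠
  -- 0` it is `b²` times the value of the quadratic at `-a/b`.
  have hD : a ^ 2 + a * b * q + b ^ 2 * n ≠ 0 := by
    by_cases hb : b = 0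
    · subst hb
      have : a ≠ 0 := by rintro rfl; simp at hm
      simpa using this
    · intro h0
      apply hn (-a / b)
      field_simp
      linear_combination h0
  have key : e ∈ Submodule.span A {a • e + b • x • e} := by
    have h1 : (a + b * q) • (a • e + b • x • e) ∈ Submodule.span A {a • e + b • x • e} :=
      Submodule.smul_mem _ (algebraMap K A (a + b * q)) (Submodule.mem_span_singleton_self _)
    have h2 : b • x • (a • e + b • x • e) ∈ Submodule.span A {a • e + b • x • e} :=
      Submodule.smul_mem _ (algebraMap K A b)
        (Submodule.smul_mem _ _ (Submodule.mem_span_singleton_self _))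
    have h3 := Submodule.smul_mem _ (algebraMap K A (a ^ 2 + a * b * q + b ^ 2 * n)⁻¹)
      (Submodule.sub_mem _ h1 h2)
    rw [hs] at h3
    convert h3 using 1
    rw [eq_inv_smul_iff₀ hD]
    simp only [smul_add, hc, hx]
    simp only [hX]
    module
  obtain ⟨r, hr⟩ := Submodule.mem_span_singleton.1 key
  intro m'
  obtain ⟨a', b', rfl⟩ := he m'
  refine ⟨(algebraMap K A a' + algebraMap K A b' * x) * r, ?_⟩
  rw [LinearMap.toSpanSingleton_apply, mul_smul, hr, add_smul, mul_smul, hs, hs]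

/-- Both invariants are visible in the action: `q` is the scalar of `z`, and `n` is then read from
the relation for `x²`. Conversely, an element acting as `b + c x` kills the plane only if `b = c =
0`, because `e` and `x e` are independent. -/
theorem IsPlane.nonempty_linearEquiv_iff (hA : ∀ a b : A, a * b = b * a)
    (hgen : Algebra.adjoin K {x, z} = ⊤) (h : IsPlane x z M q n) (h' : IsPlane x z N q' n')
    [IsSimpleModule A M] [IsSimpleModule A N] :
    Nonempty (M ≃ₗ[A] N) ↔ q = q' ∧ n = n' := by
  constructor
  · rintro ⟨e⟩
    obtain ⟨m, hm⟩ := h.exists_ne_zero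
    have hem : e m ≠ 0 := e.map_ne_zero_iff.2 hm
    have hq : q = q' := by
      apply eq_of_algebraMap_smul_eq (A := A) hem
      rw [← h'.smul_z, ← map_smul, ← map_smul, h.smul_z]
    subst hq
    refine ⟨rfl, eq_of_algebraMap_smul_eq (A := A) hem ?_⟩
    have h1 := h'.smul_x (e m)
    have h2 := congrArg e (h.smul_x m)
    simp only [map_smul, map_sub] at h2
    rw [h1] at h2
    exact (sub_right_injective h2).symm
  · rintro ⟨rfl, rfl⟩
    refine nonempty_linearEquiv_of_ann_le (M := M) (N := N) hA fun a ha k => ?_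
    obtain ⟨b, c, hbc⟩ := exists_smul_eq (M := M × N) (q := q) (n := n) hgen
      (fun v => Prod.ext (h.smul_z v.1) (h'.smul_z v.2))
      (fun v => Prod.ext (h.smul_x v.1) (h'.smul_x v.2)) a
    obtain ⟨e, -, he⟩ := h.cyclic
    have h1 := congrArg Prod.fst (hbc (e, 0))
    simp only [Prod.smul_fst, Prod.fst_add, ha] at h1
    obtain ⟨rfl, rfl⟩ := he b c h1.symm
    have h2 := congrArg Prod.snd (hbc (0, k))
    simpa using h2

/-- On a line `x` is a scalar; on a plane it is not, since `e` and `x e` are independent. -/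
theorem IsLine.isEmpty_linearEquiv (h : IsLine x z M p q) (h' : IsPlane x z N q' n') :
    ¬ Nonempty (M ≃ₗ[A] N) := by
  rintro ⟨f⟩
  obtain ⟨e, -, he⟩ := h'.cyclic
  have h1 : x • e = algebraMap K A p • e := by
    have := congrArg f (h.smul_x (f.symm e))
    simpa only [map_smul, f.apply_symm_apply] using this
  have := (he (-p) 1 (by rw [h1]; simp)).2
  exact one_ne_zero this

/-- The vectors `(x - p₂) e` and `(x - p₁) e` are eigenvectors for `p₁` and `p₂`. Distinct
eigenvalues make their spans disjoint, and their difference `(p₁ - p₂) e` recovers the generator. -/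
theorem IsPlane.exists_isCompl (hgen : Algebra.adjoin K {x, z} = ⊤) (h : IsPlane x z M q n)
    {p₁ p₂ : K} (hne : p₁ ≠ p₂) (hq : p₁ + p₂ = q) (hn : p₁ * p₂ = n) :
    ∃ N₁ N₂ : Submodule A M, IsCompl N₁ N₂ ∧ IsLine x z N₁ p₁ q ∧ IsLine x z N₂ p₂ q := by
  let _ : Module K M := Module.compHom M (algebraMap K A)
  have hs : ∀ (k : K) (m : M), algebraMap K A k • m = k • m := fun _ _ => rfl
  have hc : ∀ (k : K) (m : M), x • k • m = k • x • m := fun k m => algebraMap_smul_comm k x m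
  obtain ⟨X, hX⟩ : ∃ X : M → M, ∀ m, x • m = X m := ⟨_, fun _ => rfl⟩
  obtain ⟨e, he, he'⟩ := h.cyclic
  have hx := h.smul_x
  simp only [hs] at he he' hx
  have hv : ∀ r : K, r • e + (1 : K) • x • e ≠ 0 := fun r h0 => one_ne_zero (he' r 1 h0).2
  have hl₁ := isLine_span (p := p₁) hgen (hv (-p₂)) (by
    rw [hs, smul_add, hc, hc, hx, ← hq, ← hn]; simp only [hX]; module) (h.smul_z _)
  have hl₂ := isLine_span (p := p₂) hgen (hv (-p₁)) (by
    rw [hs, smul_add, hc, hc, hx, ← hq, ← hn]; simp only [hX]; module) (h.smul_z _)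
  refine ⟨_, _, ⟨?_, ?_⟩, hl₁, hl₂⟩
  · rw [Submodule.disjoint_def]
    intro w hw₁ hw₂
    by_contra hw
    have h1 := congrArg Subtype.val (hl₁.smul_x ⟨w, hw₁⟩)
    have h2 := congrArg Subtype.val (hl₂.smul_x ⟨w, hw₂⟩)
    exact hne (eq_of_algebraMap_smul_eq (A := A) hw (h1.symm.trans h2))
  · rw [codisjoint_iff, eq_top_iff]
    set N := Submodule.span A {-p₂ • e + (1 : K) • x • e} ⊔
      Submodule.span A {-p₁ • e + (1 : K) • x • e} with hN
    have h1 : -p₂ • e + (1 : K) • x • e ∈ N :=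
      Submodule.mem_sup_left (Submodule.mem_span_singleton_self _)
    have h2 : -p₁ • e + (1 : K) • x • e ∈ N :=
      Submodule.mem_sup_right (Submodule.mem_span_singleton_self _)
    have h3 := Submodule.smul_mem _ (algebraMap K A (p₁ - p₂)⁻¹) (Submodule.sub_mem _ h1 h2)
    have h4 : e ∈ N := by
      rw [hs] at h3
      convert h3 using 1
      rw [eq_inv_smul_iff₀ (sub_ne_zero.2 hne)]
      simp only [hX]
      module
    rintro m -
    obtain ⟨a, b, rfl⟩ := he m
    exact Submodule.add_mem _ (Submodule.smul_mem _ (algebraMap K A a) h4)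
      (Submodule.smul_mem _ (algebraMap K A b) (Submodule.smul_mem _ _ h4))

theorem IsLine.of_ann_le (h : IsLine x z M p q) [IsSimpleModule A L]
    (hL : ∀ a : A, (∀ m : M, a • m = 0) → ∀ l : L, a • l = 0) : IsLine x z L p q := by
  refine ⟨fun l => ?_, fun l => ?_, inferInstance⟩
  · have := hL (z - algebraMap K A q) (fun m => by rw [sub_smul, h.smul_z, sub_self]) l
    rwa [sub_smul, sub_eq_zero] at this
  · have := hL (x - algebraMap K A p) (fun m => by rw [sub_smul, h.smul_x, sub_self]) l
    rwa [sub_smul, sub_eq_zero] at this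

/-- The product `(x - p₁)(x - p₂)` kills the plane, hence `L`. If `x - p₂` is not zero on `L`, its
image contains a nonzero vector killed by `x - p₁`, and then `x - p₁` is zero on `L`. -/
theorem IsPlane.isLine_of_ann_le (hA : ∀ a b : A, a * b = b * a) (h : IsPlane x z M q n)
    {p₁ p₂ : K} (hq : p₁ + p₂ = q) (hn : p₁ * p₂ = n) [IsSimpleModule A L]
    (hL : ∀ a : A, (∀ m : M, a • m = 0) → ∀ l : L, a • l = 0) :
    IsLine x z L p₁ q ∨ IsLine x z L p₂ q := by
  have hz : ∀ l : L, z • l = algebraMap K A q • l := fun l => by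
    have := hL (z - algebraMap K A q) (fun m => by rw [sub_smul, h.smul_z, sub_self]) l
    rwa [sub_smul, sub_eq_zero] at this
  have hxx : ∀ l : L, (x - algebraMap K A p₁) • (x - algebraMap K A p₂) • l = 0 := fun l => by
    rw [smul_smul]
    refine hL _ (fun m => ?_) l
    let _ : Module K M := Module.compHom M (algebraMap K A)
    have hs : ∀ (k : K) (m : M), algebraMap K A k • m = k • m := fun _ _ => rfl
    have hc : ∀ (k : K) (m : M), x • k • m = k • x • m := fun k m => algebraMap_smul_comm k x m
    obtain ⟨X, hX⟩ : ∃ X : M → M, ∀ m, x • m = X m := ⟨_, fun _ => rfl⟩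
    have hx := h.smul_x
    simp only [hs] at hx
    simp only [mul_smul, sub_smul, smul_sub, hx, hs, hc, ← hq, ← hn]
    simp only [hX]
    module
  by_cases h0 : ∀ l : L, (x - algebraMap K A p₂) • l = 0
  · exact Or.inr ⟨hz, fun l => by rw [← sub_eq_zero, ← sub_smul, h0], inferInstance⟩
  · push Not at h0
    obtain ⟨l, hl⟩ := h0
    exact Or.inl ⟨hz, fun l' => by
      rw [← sub_eq_zero, ← sub_smul, smul_eq_zero_of_smul_ne hA hl (hxx l)], inferInstance⟩

theorem IsPlane.nonempty_linearEquiv_of_ann_le (hA : ∀ a b : A, a * b = b * a)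
    (h : IsPlane x z M q n) (hn : ∀ k : K, k ^ 2 - q * k + n ≠ 0) [IsSimpleModule A L]
    (hL : ∀ a : A, (∀ m : M, a • m = 0) → ∀ l : L, a • l = 0) : Nonempty (L ≃ₗ[A] M) := by
  have := h.isSimpleModule hn
  obtain ⟨e⟩ := CalogeroMoser.nonempty_linearEquiv_of_ann_le hA hL
  exact ⟨e.symm⟩

/-! ### Multiplicities of lines and planes in modules of dimension at most two -/

variable {M' : Type} [AddCommGroup M'] [Module A M'] (hA : ∀ a b : A, a * b = b * a)
  (hgen : Algebra.adjoin K {x, z} = ⊤)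
include hA hgen

open Classical in
theorem compMult_line_line (e : M' ≃ₗ[A] M) (h : IsLine x z M p q) (h' : IsLine x z L p' q') :
    compMult A M' L = if p = p' ∧ q = q' then 1 else 0 := by
  have := h.simple
  rw [compMult_of_equiv_simple e]
  simp_rw [h.nonempty_linearEquiv_iff hA hgen h']

open Classical in
theorem compMult_plane_plane (e : M' ≃ₗ[A] M) (h : IsPlane x z M q n)
    (hn : ∀ k : K, k ^ 2 - q * k + n ≠ 0) (h' : IsPlane x z L q' n') [IsSimpleModule A L] :
    compMult A M' L = if q = q' ∧ n = n' then 1 else 0 := by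
  have := h.isSimpleModule hn
  rw [compMult_of_equiv_simple e]
  simp_rw [h.nonempty_linearEquiv_iff hA hgen h']

open Classical in
theorem compMult_split_line (e : M' ≃ₗ[A] M) (h : IsPlane x z M q n)
    {p₁ p₂ : K} (hne : p₁ ≠ p₂) (hq : p₁ + p₂ = q) (hn : p₁ * p₂ = n)
    (h' : IsLine x z L p' q') :
    compMult A M' L = (if p₁ = p' ∧ q = q' then 1 else 0) +
      (if p₂ = p' ∧ q = q' then 1 else 0) := by
  obtain ⟨N₁, N₂, hN, h₁, h₂⟩ := h.exists_isCompl hgen hne hq hn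
  have := h₁.simple
  have := h₂.simple
  rw [compMult_of_equiv_prod (e.trans (Submodule.prodEquivOfIsCompl _ _ hN).symm)]
  simp_rw [h₁.nonempty_linearEquiv_iff hA hgen h', h₂.nonempty_linearEquiv_iff hA hgen h']

omit hA hgen in
theorem compMult_line_plane (e : M' ≃ₗ[A] M) (h : IsLine x z M p q) (h' : IsPlane x z L q' n') :
    compMult A M' L = 0 := by
  have := h.simple
  rw [compMult_of_equiv_simple e, if_neg (h.isEmpty_linearEquiv h')]

omit hA hgen in
theorem compMult_plane_line (e : M' ≃ₗ[A] M) (h : IsPlane x z M q n)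
    (hn : ∀ k : K, k ^ 2 - q * k + n ≠ 0) (h' : IsLine x z L p' q') :
    compMult A M' L = 0 := by
  have := h.isSimpleModule hn
  rw [compMult_of_equiv_simple e, if_neg]
  rintro ⟨f⟩
  exact h'.isEmpty_linearEquiv h ⟨f.symm⟩

omit hA in
theorem compMult_split_plane (e : M' ≃ₗ[A] M) (h : IsPlane x z M q n)
    {p₁ p₂ : K} (hne : p₁ ≠ p₂) (hq : p₁ + p₂ = q) (hn : p₁ * p₂ = n)
    (h' : IsPlane x z L q' n') : compMult A M' L = 0 := by
  obtain ⟨N₁, N₂, hN, h₁, h₂⟩ := h.exists_isCompl hgen hne hq hn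
  have := h₁.simple
  have := h₂.simple
  rw [compMult_of_equiv_prod (e.trans (Submodule.prodEquivOfIsCompl _ _ hN).symm),
    if_neg (h₁.isEmpty_linearEquiv h'), if_neg (h₂.isEmpty_linearEquiv h')]

end TwoGenerators


/-! ### Rational functions in two variables -/

/-- The coordinate function `X`. -/
def ratX : RatFun 2 := algebraMap (MvPolynomial (Fin 2) ℂ) (RatFun 2) (MvPolynomial.X 0)

/-- The coordinate function `Y`. -/
def ratY : RatFun 2 := algebraMap (MvPolynomial (Fin 2) ℂ) (RatFun 2) (MvPolynomial.X 1)

theorem algebraMap_ratFun (n : ℕ) (a : ℂ) : algebraMap ℂ (RatFun n) a =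
    algebraMap (MvPolynomial (Fin n) ℂ) (RatFun n) (MvPolynomial.C a) := by
  rw [IsScalarTower.algebraMap_apply ℂ (MvPolynomial (Fin n) ℂ) (RatFun n)]
  rfl

theorem algebraMap_ratFun_ne_zero {n : ℕ} {p : MvPolynomial (Fin n) ℂ} (v : Fin n → ℂ)
    (h : MvPolynomial.eval v p ≠ 0) :
    algebraMap (MvPolynomial (Fin n) ℂ) (RatFun n) p ≠ 0 := by
  intro h0
  rw [(IsFractionRing.injective (MvPolynomial (Fin n) ℂ) (RatFun n)).eq_iff'
    (map_zero _)] at h0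
  simp [h0] at h

theorem ratX_ne_zero : ratX ≠ 0 := algebraMap_ratFun_ne_zero ![1, 0] (by simp)

theorem ratY_ne_zero : ratY ≠ 0 := algebraMap_ratFun_ne_zero ![0, 1] (by simp)

theorem ratX_sub_ne_zero (a : ℂ) : ratX - algebraMap ℂ _ a * ratY ≠ 0 := by
  have := algebraMap_ratFun_ne_zero (p := MvPolynomial.X 0 - MvPolynomial.C a * MvPolynomial.X 1)
    ![1, 0] (by simp)
  simpa [ratX, ratY, algebraMap_ratFun] using this

theorem ratX_pow_sub_ne_zero {d : ℕ} (hd : d ≠ 0) : ratX ^ d - ratY ^ d ≠ 0 := by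
  have := algebraMap_ratFun_ne_zero
    (p := (MvPolynomial.X 0 : MvPolynomial (Fin 2) ℂ) ^ d - MvPolynomial.X 1 ^ d)
    ![1, 0] (by simp [hd])
  simpa [ratX, ratY] using this

theorem ratX_pow_add_ne_zero {d : ℕ} (hd : d ≠ 0) : ratX ^ d + ratY ^ d ≠ 0 := by
  have := algebraMap_ratFun_ne_zero
    (p := (MvPolynomial.X 0 : MvPolynomial (Fin 2) ℂ) ^ d + MvPolynomial.X 1 ^ d)
    ![1, 0] (by simp [hd])
  simpa [ratX, ratY] using this

theorem algebraMap_ratFun_injective (n : ℕ) : Function.Injective (algebraMap ℂ (RatFun n)) :=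
  (algebraMap ℂ (RatFun n)).injective

open Polynomial in
/-- If `δ² (T^d - 1)² + 4 c² T^d` is a square in `ℂ[T]`, then `δ² = c²`, or `δ = 0` and `d` is
even. -/
theorem eq_or_even_of_polynomial_sq {d : ℕ} (hd : d ≠ 0) {c δ : ℂ} (hc : c ≠ 0) (g : ℂ[X])
    (h : g ^ 2 = C (δ ^ 2) * (X ^ d - 1) ^ 2 + C (4 * c ^ 2) * X ^ d) :
    δ ^ 2 = c ^ 2 ∨ δ = 0 ∧ Even d := by
  by_cases hδ : δ = 0
  · right
    refine ⟨hδ, ?_⟩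
    have hdeg := congrArg Polynomial.natDegree h
    rw [hδ, natDegree_pow] at hdeg
    simp only [ne_eq, OfNat.ofNat_ne_zero, not_false_eq_true, zero_pow, map_zero, zero_mul,
      zero_add] at hdeg
    rw [natDegree_C_mul_X_pow _ _ (by simpa using hc)] at hdeg
    exact ⟨g.natDegree, by omega⟩
  · left
    -- The right-hand side is `δ²(T - 1)² + 4c² T` evaluated at `T = X^d`. Taking a root `T = r^d`,
    -- the square `g²` vanishes at `r` to order two; as `r ≠ 0`, the derivative shows that `T` is a
    -- double root of this quadratic.
    obtain ⟨T, hT⟩ := IsAlgClosed.exists_root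
      (C (δ ^ 2) * X ^ 2 + C (4 * c ^ 2 - 2 * δ ^ 2) * X + C (δ ^ 2) : ℂ[X])
      (by rw [degree_quadratic (by simpa using hδ)]; simp)
    obtain ⟨r, rfl⟩ := IsAlgClosed.exists_pow_nat_eq T (Nat.pos_of_ne_zero hd)
    simp only [IsRoot.def, eval_add, eval_mul, eval_C, eval_pow, eval_X] at hT
    have hr : r ≠ 0 := by
      rintro rfl
      simp [hd, hδ] at hT
    have h0 : g.eval r = 0 := by
      have := congrArg (Polynomial.eval r) h
      simp only [eval_add, eval_mul, eval_C, eval_pow, eval_X, eval_sub, eval_one] at this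
      have h2 : eval r g ^ 2 = 0 := by rw [this]; linear_combination hT
      exact pow_eq_zero_iff two_ne_zero |>.1 h2
    have h1 := congrArg (fun p => Polynomial.eval r (derivative p)) h
    simp only [derivative_pow, derivative_add, derivative_mul, derivative_C, derivative_sub,
      derivative_X, derivative_one, eval_add, eval_mul, eval_C, eval_pow, eval_X, eval_sub,
      eval_one, h0, eval_zero] at h1
    have hd' : (d : ℂ) * r ^ (d - 1) ≠ 0 :=
      mul_ne_zero (Nat.cast_ne_zero.2 hd) (pow_ne_zero _ hr)
    have h2 : (d : ℂ) * r ^ (d - 1) * (2 * δ ^ 2 * (r ^ d - 1) + 4 * c ^ 2) = 0 := by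
      norm_num at h1
      linear_combination -h1
    have h3 := (mul_eq_zero.1 h2).resolve_left hd'
    -- The discriminant of the quadratic `f`, written as `f'(T)² - 4 δ² f(T)`, both terms of which
    -- vanish.
    have h4 : 16 * c ^ 2 * (c ^ 2 - δ ^ 2) = 0 := by
      linear_combination (2 * δ ^ 2 * r ^ d + (4 * c ^ 2 - 2 * δ ^ 2)) * h3 - 4 * δ ^ 2 * hT
    have h5 := (mul_eq_zero.1 h4).resolve_left (by simpa using hc)
    linear_combination -h5

/-- The polynomial ring is integrally closed, so a rational function with polynomial square is a
polynomial; specialising `Y = 1` leaves the one-variable case. -/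
theorem eq_or_even_of_ratFun_sq {d : ℕ} (hd : d ≠ 0) {c δ : ℂ} (hc : c ≠ 0) (g : RatFun 2)
    (h : g ^ 2 = algebraMap ℂ _ (δ ^ 2) * (ratX ^ d - ratY ^ d) ^ 2 +
      algebraMap ℂ _ (4 * c ^ 2) * (ratX ^ d * ratY ^ d)) :
    δ ^ 2 = c ^ 2 ∨ δ = 0 ∧ Even d := by
  let f : MvPolynomial (Fin 2) ℂ := MvPolynomial.C (δ ^ 2) *
    (MvPolynomial.X 0 ^ d - MvPolynomial.X 1 ^ d) ^ 2 +
      MvPolynomial.C (4 * c ^ 2) * (MvPolynomial.X 0 ^ d * MvPolynomial.X 1 ^ d)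
  have hf : g ^ 2 = algebraMap (MvPolynomial (Fin 2) ℂ) (RatFun 2) f := by
    rw [h, algebraMap_ratFun, algebraMap_ratFun]
    simp only [f, ratX, ratY, map_add, map_mul, map_sub, map_pow]
  obtain ⟨p, rfl⟩ := IsIntegrallyClosed.exists_algebraMap_eq_of_isIntegral_pow
    (R := MvPolynomial (Fin 2) ℂ) (K := RatFun 2) (x := g) two_pos
    (by rw [hf]; exact isIntegral_algebraMap)
  rw [← map_pow, (IsFractionRing.injective (MvPolynomial (Fin 2) ℂ) (RatFun 2)).eq_iff] at hf
  refine eq_or_even_of_polynomial_sq hd hc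
    (MvPolynomial.aeval ![(Polynomial.X : Polynomial ℂ), 1] p) ?_
  rw [← map_pow, hf]
  simp [f, Polynomial.algebraMap_eq]

/-- The quadratic polynomial with trace `a + b` and determinant `a b - c² X^d Y^d / (X^d - Y^d)²`
has a root in `ℂ(X, Y)` only if `(a - b)² = c²`, or `a = b` and `d` is even. -/
theorem quadratic_ne_zero {d : ℕ} (hd : d ≠ 0) {a b c : ℂ} (hc : c ≠ 0)
    (h1 : c ^ 2 ≠ (a - b) ^ 2) (h2 : a ≠ b ∨ Odd d) (g : RatFun 2) :
    g ^ 2 - algebraMap ℂ _ (a + b) * g + (algebraMap ℂ _ (a * b) - algebraMap ℂ _ (c ^ 2) *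
      (ratX ^ d * ratY ^ d) / (ratX ^ d - ratY ^ d) ^ 2) ≠ 0 := by
  intro h0
  have hΔ := ratX_pow_sub_ne_zero hd
  -- Completing the square: the square of this element is the discriminant of the quadratic times
  -- `(X^d - Y^d)²`.
  have := eq_or_even_of_ratFun_sq hd (δ := a - b) hc
    ((ratX ^ d - ratY ^ d) * (2 * g - algebraMap ℂ _ (a + b))) (by
      field_simp at h0
      simp only [map_add, map_mul, map_pow, map_sub, map_ofNat] at h0 ⊢
      linear_combination 4 * h0)
  rcases this with h | ⟨h, h'⟩
  · exact h1 h.symm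
  · rcases h2 with h2 | h2
    · exact h2 (sub_eq_zero.1 h)
    · exact (Nat.not_even_iff_odd.2 h2) h'

theorem sum_pow_of_pow_eq_one {d : ℕ} {ω : ℂ} (h : ω ^ d = 1) :
    ∑ m ∈ range d, ω ^ m = if ω = 1 then (d : ℂ) else 0 := by
  split_ifs with h1
  · simp [h1]
  · have := geom_sum_mul ω d
    rw [h, sub_self] at this
    exact (mul_eq_zero.1 this).resolve_right (sub_ne_zero.2 h1)

/-- `∑_m β^m X / (X - ζ^m Y) = d X^{d-l} Y^l / (X^d - Y^d)` when `β ζ^l = 1`. -/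
theorem sum_div_ratX_sub {d : ℕ} {ζ β : ℂ} (hζ : IsPrimitiveRoot ζ d) {l : ℕ} (hl : l < d)
    (hβ : β * ζ ^ l = 1) :
    ∑ m ∈ range d, algebraMap ℂ (RatFun 2) (β ^ m) *
      (ratX / (ratX - algebraMap ℂ _ (ζ ^ m) * ratY)) =
      d * (ratX ^ (d - l) * ratY ^ l / (ratX ^ d - ratY ^ d)) := by
  have hd : d ≠ 0 := by omega
  have hΔ := ratX_pow_sub_ne_zero hd
  -- Since `(ζ^m)^d = 1`, the form `X - ζ^m Y` divides `X^d - Y^d`; the quotient is a geometric sum.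
  have hterm : ∀ m : ℕ, ratX / (ratX - algebraMap ℂ _ (ζ ^ m) * ratY) =
      (∑ r ∈ range d, algebraMap ℂ _ (ζ ^ m) ^ r * (ratY ^ r * ratX ^ (d - r))) /
        (ratX ^ d - ratY ^ d) := by
    intro m
    rw [div_eq_div_iff (ratX_sub_ne_zero _) hΔ]
    have := (Commute.all (algebraMap ℂ _ (ζ ^ m) * ratY) ratX).geom_sum₂_mul d
    rw [mul_pow, ← map_pow, ← pow_mul, mul_comm m, pow_mul, hζ.pow_eq_one, one_pow, map_one,
      one_mul] at this
    have h2 : ∑ r ∈ range d, algebraMap ℂ _ (ζ ^ m) ^ r * (ratY ^ r * ratX ^ (d - r)) =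
        ratX * ∑ r ∈ range d, (algebraMap ℂ _ (ζ ^ m) * ratY) ^ r * ratX ^ (d - 1 - r) := by
      rw [mul_sum]
      refine sum_congr rfl fun r hr => ?_
      have : d - r = d - 1 - r + 1 := by have := mem_range.1 hr; omega
      rw [this, mul_pow, pow_succ]
      ring
    rw [h2]
    linear_combination ratX * this
  simp_rw [hterm, ← mul_div_assoc, ← sum_div]
  congr 1
  simp_rw [mul_sum]
  rw [sum_comm]
  -- Summing over `m` first, orthogonality of `d`-th roots of unity keeps only the term `r = l`.
  have hinner : ∀ r ∈ range d, ∑ m ∈ range d, algebraMap ℂ (RatFun 2) (β ^ m) *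
      (algebraMap ℂ _ (ζ ^ m) ^ r * (ratY ^ r * ratX ^ (d - r))) =
      if r = l then d * (ratX ^ (d - r) * ratY ^ r) else 0 := by
    intro r hr
    have hβd : (β * ζ ^ r) ^ d = 1 := by
      have h1 : ∀ r : ℕ, (ζ ^ r) ^ d = 1 := fun r => by
        rw [← pow_mul, mul_comm, pow_mul, hζ.pow_eq_one, one_pow]
      have h2 : (β * ζ ^ l) ^ d = 1 := by rw [hβ, one_pow]
      rw [mul_pow, h1] at h2 ⊢
      exact h2
    have hiff : β * ζ ^ r = 1 ↔ r = l := by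
      constructor
      · intro h
        have hb : β ≠ 0 := by rintro rfl; simp at hβ
        exact hζ.pow_inj (mem_range.1 hr) hl (mul_left_cancel₀ hb (h.trans hβ.symm))
      · rintro rfl
        exact hβ
    have : ∀ m : ℕ, algebraMap ℂ (RatFun 2) (β ^ m) *
        (algebraMap ℂ _ (ζ ^ m) ^ r * (ratY ^ r * ratX ^ (d - r))) =
        algebraMap ℂ _ ((β * ζ ^ r) ^ m) * (ratY ^ r * ratX ^ (d - r)) := by
      intro m
      simp only [map_pow, map_mul]
      ring
    simp_rw [this]
    rw [← sum_mul, ← map_sum, sum_pow_of_pow_eq_one hβd]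
    simp_rw [hiff]
    split_ifs
    · rw [map_natCast]; ring
    · simp
  rw [sum_congr rfl hinner, sum_ite_eq' (range d) l, if_pos (mem_range.2 hl)]


/-! ### Elements and reflections of `G(d,1,2)` -/

theorem toMat_mul {n : ℕ} {W : Subgroup (GL (Fin n) ℂ)} (g h : W) :
    toMat (g * h) = toMat g * toMat h := rfl

theorem toMat_one {n : ℕ} {W : Subgroup (GL (Fin n) ℂ)} : toMat (1 : W) = 1 := rfl

theorem toMat_pow {n : ℕ} {W : Subgroup (GL (Fin n) ℂ)} (g : W) (m : ℕ) :
    toMat (g ^ m) = toMat g ^ m := by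
  induction m with
  | zero => rfl
  | succ m ih => rw [pow_succ, pow_succ, toMat_mul, ih]

theorem toMat_injective {n : ℕ} {W : Subgroup (GL (Fin n) ℂ)} :
    Function.Injective (toMat : W → Matrix (Fin n) (Fin n) ℂ) :=
  fun _ _ h => Subtype.ext (Units.ext h)

theorem toMat_sElt (d : ℕ) : toMat (sElt d) = !![0, 1; 1, 0] := by
  ext p q
  fin_cases p <;> fin_cases q <;> simp [sElt, toMat, mono, monoMat]

theorem toMat_tElt {d : ℕ} (ζ : rootsOfUnity d ℂ) :
    toMat (tElt ζ) = !![((ζ : ℂˣ) : ℂ), 0; 0, 1] := by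
  ext p q
  fin_cases p <;> fin_cases q <;> simp [tElt, toMat, mono, monoMat]

theorem diag_pow (R : Type) [CommRing R] (a b : R) (m : ℕ) :
    !![a, 0; 0, b] ^ m = !![a ^ m, 0; 0, b ^ m] := by
  induction m with
  | zero => ext p q; fin_cases p <;> fin_cases q <;> simp
  | succ m ih =>
    rw [pow_succ, ih, pow_succ, pow_succ]
    ext p q
    fin_cases p <;> fin_cases q <;> simp

theorem sElt_mul_sElt (d : ℕ) : sElt d * sElt d = 1 := by
  apply toMat_injective
  rw [toMat_mul, toMat_sElt, toMat_one]
  ext p q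
  fin_cases p <;> fin_cases q <;> simp

theorem tElt_mul_tElt_inv {d : ℕ} (ζ : rootsOfUnity d ℂ) : tElt ζ * tElt ζ⁻¹ = 1 := by
  apply toMat_injective
  rw [toMat_mul, toMat_tElt, toMat_tElt, toMat_one]
  ext p q
  fin_cases p <;> fin_cases q <;> simp

theorem tElt_inv {d : ℕ} (ζ : rootsOfUnity d ℂ) : tElt ζ⁻¹ = (tElt ζ)⁻¹ :=
  (inv_eq_of_mul_eq_one_right (tElt_mul_tElt_inv ζ)).symm

theorem sElt_inv (d : ℕ) : (sElt d)⁻¹ = sElt d := inv_eq_of_mul_eq_one_right (sElt_mul_sElt d)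

/-- The diagonal matrix `diag(ζ^m, ζ^n)`. -/
def diagElt {d : ℕ} (ζ : rootsOfUnity d ℂ) (m n : ℕ) : Gd1 d 2 :=
  tElt ζ ^ m * (sElt d * tElt ζ ^ n * sElt d)

/-- The reflection with antidiagonal entries `ζ^m` and `ζ^(-m)`. -/
def reflElt {d : ℕ} (ζ : rootsOfUnity d ℂ) (m : ℕ) : Gd1 d 2 :=
  tElt ζ ^ m * sElt d * tElt ζ⁻¹ ^ m

/-- The reflection `diag(1, ζ^k)`. -/
def tElt' {d : ℕ} (ζ : rootsOfUnity d ℂ) (k : ℕ) : Gd1 d 2 := sElt d * tElt ζ ^ k * sElt d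

variable {d : ℕ} (ζ : rootsOfUnity d ℂ)

theorem toMat_tElt_pow (m : ℕ) :
    toMat (tElt ζ ^ m) = !![((ζ : ℂˣ) : ℂ) ^ m, 0; 0, 1] := by
  rw [toMat_pow, toMat_tElt, diag_pow, one_pow]

theorem toMat_tElt' (m : ℕ) :
    toMat (tElt' ζ m) = !![1, 0; 0, ((ζ : ℂˣ) : ℂ) ^ m] := by
  rw [tElt', toMat_mul, toMat_mul, toMat_tElt_pow, toMat_sElt]
  ext p q
  fin_cases p <;> fin_cases q <;> simp

theorem toMat_diagElt (m n : ℕ) :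
    toMat (diagElt ζ m n) = !![((ζ : ℂˣ) : ℂ) ^ m, 0; 0, ((ζ : ℂˣ) : ℂ) ^ n] := by
  rw [diagElt, toMat_mul, toMat_tElt_pow, ← tElt', toMat_tElt']
  ext p q
  fin_cases p <;> fin_cases q <;> simp

theorem toMat_diagElt_mul_sElt (m n : ℕ) :
    toMat (diagElt ζ m n * sElt d) = !![0, ((ζ : ℂˣ) : ℂ) ^ m; ((ζ : ℂˣ) : ℂ) ^ n, 0] := by
  rw [toMat_mul, toMat_diagElt, toMat_sElt]
  ext p q
  fin_cases p <;> fin_cases q <;> simp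

theorem toMat_reflElt (m : ℕ) :
    toMat (reflElt ζ m) = !![0, ((ζ : ℂˣ) : ℂ) ^ m; (((ζ : ℂˣ) : ℂ) ^ m)⁻¹, 0] := by
  rw [reflElt, toMat_mul, toMat_mul, toMat_tElt_pow, toMat_tElt_pow, toMat_sElt]
  ext p q
  fin_cases p <;> fin_cases q <;> simp

variable {ζ}

theorem isPrimitiveRoot_val (hζ : IsPrimitiveRoot ζ d) : IsPrimitiveRoot ((ζ : ℂˣ) : ℂ) d :=
  IsPrimitiveRoot.coe_units_iff.2 (IsPrimitiveRoot.coe_submonoidClass_iff.2 hζ)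

theorem exists_eq_diagElt [NeZero d] (hζ : IsPrimitiveRoot ζ d) (g : Gd1 d 2) :
    ∃ m < d, ∃ n < d, g = diagElt ζ m n ∨ g = diagElt ζ m n * sElt d := by
  obtain ⟨g, π, a, ha, rfl⟩ := g
  have hz := isPrimitiveRoot_val hζ
  have ha' : ∀ i, ((a i : ℂˣ) : ℂ) ^ d = 1 := fun i => by
    have := congrArg Units.val (ha i)
    simpa using this
  obtain ⟨m, hm, hm'⟩ := hz.eq_pow_of_pow_eq_one (ha' 0)
  obtain ⟨n, hn, hn'⟩ := hz.eq_pow_of_pow_eq_one (ha' 1)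
  refine ⟨m, hm, n, hn, ?_⟩
  have hπ : π = 1 ∨ π = Equiv.swap 0 1 := by
    revert π; decide
  rcases hπ with rfl | rfl
  · left
    apply toMat_injective
    rw [toMat_diagElt]
    ext p q
    fin_cases p <;> fin_cases q <;> simp [toMat, mono, monoMat, hm', hn']
  · right
    apply toMat_injective
    rw [toMat_diagElt_mul_sElt]
    ext p q
    fin_cases p <;> fin_cases q <;> simp [toMat, mono, monoMat, hm', hn']

/-- The enumeration of the elements of `G(d,1,2)`. -/
def eltOf (ζ : rootsOfUnity d ℂ) : (Fin d × Fin d) ⊕ (Fin d × Fin d) → Gd1 d 2 :=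
  Sum.elim (fun p => diagElt ζ p.1 p.2) (fun p => diagElt ζ p.1 p.2 * sElt d)

theorem eltOf_bijective [NeZero d] (hζ : IsPrimitiveRoot ζ d) :
    Function.Bijective (eltOf ζ) := by
  have hz := isPrimitiveRoot_val hζ
  have hz0 : ((ζ : ℂˣ) : ℂ) ≠ 0 := Units.ne_zero _
  constructor
  · rintro (⟨m, n⟩ | ⟨m, n⟩) (⟨m', n'⟩ | ⟨m', n'⟩) h
    all_goals
      have h := congrArg toMat h
      simp only [eltOf, Sum.elim_inl, Sum.elim_inr, toMat_diagElt,
        toMat_diagElt_mul_sElt] at h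
      have h00 := congrFun (congrFun h 0) 0
      have h01 := congrFun (congrFun h 0) 1
      have h10 := congrFun (congrFun h 1) 0
      have h11 := congrFun (congrFun h 1) 1
      simp [hz0] at h00 h01 h10 h11
    · rw [Fin.ext (hz.pow_inj m.2 m'.2 h00), Fin.ext (hz.pow_inj n.2 n'.2 h11)]
    · rw [Fin.ext (hz.pow_inj m.2 m'.2 h01), Fin.ext (hz.pow_inj n.2 n'.2 h10)]
  · intro g
    obtain ⟨m, hm, n, hn, rfl | rfl⟩ := exists_eq_diagElt hζ g
    · exact ⟨Sum.inl (⟨m, hm⟩, ⟨n, hn⟩), rfl⟩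
    · exact ⟨Sum.inr (⟨m, hm⟩, ⟨n, hn⟩), rfl⟩

/-- For a nonzero singular `M` the adjugate is nonzero too, and `M * adj M = 0` bounds the sum of
the two ranks by 2. -/
theorem rank_eq_one_iff (M : Matrix (Fin 2) (Fin 2) ℂ) : M.rank = 1 ↔ M ≠ 0 ∧ M.det = 0 := by
  have hpos : ∀ N : Matrix (Fin 2) (Fin 2) ℂ, N ≠ 0 → 1 ≤ N.rank := by
    intro N hN
    by_contra! h
    have h0 : N.rank = 0 := by omega
    rw [Matrix.rank, Submodule.finrank_eq_zero, LinearMap.range_eq_bot] at h0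
    exact hN ((Matrix.ext_iff_mulVec).2 fun v => by
      rw [Matrix.zero_mulVec]; exact LinearMap.congr_fun h0 v)
  constructor
  · intro h
    refine ⟨by rintro rfl; simp at h, ?_⟩
    by_contra h'
    rw [Matrix.rank_of_det_ne_zero h'] at h
    simp at h
  · rintro ⟨h, h'⟩
    have h1 := Matrix.rank_add_rank_le_card_of_mul_eq_zero (A := M) (B := M.adjugate)
      (by rw [Matrix.mul_adjugate, h', zero_smul])
    have h2 : M.adjugate ≠ 0 := by
      intro h0
      apply h
      rw [Matrix.adjugate_fin_two] at h0
      have h00 := congrFun (congrFun h0 0) 0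
      have h01 := congrFun (congrFun h0 0) 1
      have h10 := congrFun (congrFun h0 1) 0
      have h11 := congrFun (congrFun h0 1) 1
      ext p q
      fin_cases p <;> fin_cases q <;> simp_all
    have h3 := hpos _ h
    have h4 := hpos _ h2
    simp at h1
    omega

theorem reflElt_mem (m : ℕ) : reflElt ζ m ∈ Ref (Gd1 d 2) := by
  rw [Ref, Set.mem_ofPred_eq, rank_eq_one_iff, toMat_reflElt]
  constructor
  · intro h
    have := congrFun (congrFun h 0) 0
    simp at this
  · simp [Matrix.det_fin_two]

theorem tElt_pow_mem (hζ : IsPrimitiveRoot ζ d) {k : ℕ} (hk : k ∈ Ico 1 d) :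
    tElt ζ ^ k ∈ Ref (Gd1 d 2) := by
  rw [mem_Ico] at hk
  have := (isPrimitiveRoot_val hζ).pow_ne_one_of_pos_of_lt (by omega) hk.2
  rw [Ref, Set.mem_ofPred_eq, rank_eq_one_iff, toMat_tElt_pow]
  constructor
  · intro h
    have := congrFun (congrFun h 0) 0
    simp at this
    exact absurd (sub_eq_zero.1 this) ‹_›
  · simp [Matrix.det_fin_two]

theorem tElt'_mem (hζ : IsPrimitiveRoot ζ d) {k : ℕ} (hk : k ∈ Ico 1 d) :
    tElt' ζ k ∈ Ref (Gd1 d 2) := by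
  rw [mem_Ico] at hk
  have := (isPrimitiveRoot_val hζ).pow_ne_one_of_pos_of_lt (by omega) hk.2
  rw [Ref, Set.mem_ofPred_eq, rank_eq_one_iff, toMat_tElt']
  constructor
  · intro h
    have := congrFun (congrFun h 1) 1
    simp at this
    exact absurd (sub_eq_zero.1 this) ‹_›
  · simp [Matrix.det_fin_two]

/-- The condition `det (g - 1) = 0` reads `(ζ^m - 1)(ζ^n - 1) = 0` for diagonal `g` and `ζ^m ζ^n =
1` for antidiagonal `g`; the only other exclusion is `g = 1`. -/
theorem mem_Ref_iff [NeZero d] (hζ : IsPrimitiveRoot ζ d) (g : Gd1 d 2) :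
    g ∈ Ref (Gd1 d 2) ↔ (∃ m ∈ range d, reflElt ζ m = g) ∨
      (∃ k ∈ Ico 1 d, tElt ζ ^ k = g) ∨ ∃ k ∈ Ico 1 d, tElt' ζ k = g := by
  constructor
  · intro hg
    rw [Ref, Set.mem_ofPred_eq, rank_eq_one_iff] at hg
    obtain ⟨m, hm, n, hn, rfl | rfl⟩ := exists_eq_diagElt hζ g
    · right
      rw [toMat_diagElt, Matrix.det_fin_two] at hg
      obtain ⟨h1, h2⟩ := hg
      have hz := isPrimitiveRoot_val hζ
      simp only [Matrix.sub_apply, Matrix.of_apply, Matrix.cons_val', Matrix.cons_val_zero,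
        Matrix.cons_val_one, Matrix.one_apply, Matrix.cons_val_fin_one, if_true] at h2
      norm_num at h2
      have h3 : ∀ r < d, ((ζ : ℂˣ) : ℂ) ^ r - 1 = 0 → r = 0 := fun r hr h =>
        hz.pow_inj hr (by omega) ((sub_eq_zero.1 h).trans (pow_zero _).symm)
      have hmn : ¬ (m = 0 ∧ n = 0) := by
        rintro ⟨rfl, rfl⟩
        apply h1
        ext p q
        fin_cases p <;> fin_cases q <;> simp
      rcases h2 with h2 | h2
      · have := h3 m hm h2
        subst this
        refine Or.inr ⟨n, mem_Ico.2 ⟨by omega, hn⟩, ?_⟩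
        rw [diagElt, tElt', pow_zero, one_mul]
      · have := h3 n hn h2
        subst this
        refine Or.inl ⟨m, mem_Ico.2 ⟨by omega, hm⟩, ?_⟩
        rw [diagElt, pow_zero, mul_one, sElt_mul_sElt, mul_one]
    · left
      refine ⟨m, mem_range.2 hm, ?_⟩
      apply toMat_injective
      rw [toMat_diagElt_mul_sElt, Matrix.det_fin_two] at hg
      have h2 := hg.2
      simp at h2
      rw [toMat_reflElt, toMat_diagElt_mul_sElt,
        eq_inv_of_mul_eq_one_right (by linear_combination -h2 :
          ((ζ : ℂˣ) : ℂ) ^ m * ((ζ : ℂˣ) : ℂ) ^ n = 1)]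
  · rintro (⟨m, -, rfl⟩ | ⟨k, hk, rfl⟩ | ⟨k, hk, rfl⟩)
    · exact reflElt_mem m
    · exact tElt_pow_mem hζ hk
    · exact tElt'_mem hζ hk

theorem finsum_mem_Ref [NeZero d] (hζ : IsPrimitiveRoot ζ d) {M : Type} [AddCommMonoid M]
    (f : Gd1 d 2 → M) :
    ∑ᶠ g ∈ Ref (Gd1 d 2), f g = ∑ m ∈ range d, f (reflElt ζ m) +
      (∑ k ∈ Ico 1 d, f (tElt ζ ^ k) + ∑ k ∈ Ico 1 d, f (tElt' ζ k)) := by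
  classical
  have hz := isPrimitiveRoot_val hζ
  have hset : Ref (Gd1 d 2) = ↑((range d).image (reflElt ζ) ∪
      ((Ico 1 d).image (tElt ζ ^ ·) ∪ (Ico 1 d).image (tElt' ζ))) := by
    ext g
    simp only [mem_Ref_iff hζ, mem_coe, mem_union, mem_image]
  have h1 : Disjoint ((range d).image (reflElt ζ))
      ((Ico 1 d).image (tElt ζ ^ ·) ∪ (Ico 1 d).image (tElt' ζ)) := by
    rw [disjoint_left]
    intro g hg hg'
    simp only [mem_union, mem_image] at hg hg'
    obtain ⟨m, -, rfl⟩ := hg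
    rcases hg' with ⟨k, -, hk⟩ | ⟨k, -, hk⟩
    · have := congrFun (congrFun (congrArg toMat hk) 1) 1
      simp [toMat_tElt_pow, toMat_reflElt] at this
    · have := congrFun (congrFun (congrArg toMat hk) 0) 0
      simp [toMat_tElt', toMat_reflElt] at this
  have h2 : Disjoint ((Ico 1 d).image (tElt ζ ^ ·)) ((Ico 1 d).image (tElt' ζ)) := by
    rw [disjoint_left]
    intro g hg hg'
    simp only [mem_image] at hg hg'
    obtain ⟨m, hm, rfl⟩ := hg
    obtain ⟨k, -, hk⟩ := hg'
    have := congrFun (congrFun (congrArg toMat hk) 0) 0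
    simp [toMat_tElt_pow, toMat_tElt'] at this
    rw [mem_Ico] at hm
    exact hz.pow_ne_one_of_pos_of_lt (by omega) hm.2 this.symm
  rw [hset, finsum_mem_coe_finset, sum_union h1, sum_union h2, sum_image, sum_image, sum_image]
  · intro k hk k' hk' h
    have := congrFun (congrFun (congrArg toMat h) 1) 1
    simp [toMat_tElt'] at this
    exact hz.pow_inj (mem_Ico.1 hk).2 (mem_Ico.1 hk').2 this
  · intro k hk k' hk' h
    have := congrFun (congrFun (congrArg toMat h) 0) 0
    simp [toMat_tElt_pow] at this
    exact hz.pow_inj (mem_Ico.1 hk).2 (mem_Ico.1 hk').2 this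
  · intro k hk k' hk' h
    have := congrFun (congrFun (congrArg toMat h) 0) 1
    simp [toMat_reflElt] at this
    exact hz.pow_inj (mem_range.1 hk) (mem_range.1 hk') this

/-! ### The operators `𝒟_y` -/

variable {c : Gd1 d 2 → ℂ} {α : Gd1 d 2 → Module.Dual ℂ (Fin 2 → ℂ)}

theorem apply_eq_single (a : Module.Dual ℂ (Fin 2 → ℂ)) (y : Fin 2 → ℂ) :
    a y = y 0 * a (Pi.single 0 1) + y 1 * a (Pi.single 1 1) := by
  have : y = y 0 • Pi.single 0 1 + y 1 • Pi.single 1 1 := by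
    ext i; fin_cases i <;> simp
  conv_lhs => rw [this]
  simp

theorem formFun_two (a : Module.Dual ℂ (Fin 2 → ℂ)) : formFun a =
    algebraMap ℂ _ (a (Pi.single 0 1)) * ratX + algebraMap ℂ _ (a (Pi.single 1 1)) * ratY := by
  simp [formFun, ratX, ratY, algebraMap_ratFun, Fin.sum_univ_two]

/-- If `w` spans the fixed space of the reflection `g`, then the root `α_g` is proportional to
`w₁ X - w₀ Y`. -/
theorem rootChoice_ratio (hα : IsRootChoice (Gd1 d 2) α) {g : Gd1 d 2}
    (hg : g ∈ Ref (Gd1 d 2)) (w : Fin 2 → ℂ) (hw : (toMat g).mulVec w = w) :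
    w 0 * α g (Pi.single 0 1) + w 1 * α g (Pi.single 1 1) = 0 ∧
      (α g (Pi.single 0 1) ≠ 0 ∨ α g (Pi.single 1 1) ≠ 0) := by
  have h := hα g hg
  constructor
  · rw [← apply_eq_single]
    have : w ∈ LinearMap.ker (α g) := by
      rw [← h, LinearMap.mem_ker, Matrix.toLin'_apply, Matrix.sub_mulVec, hw, Matrix.one_mulVec,
        sub_self]
    exact this
  · by_contra! h0
    have h1 : LinearMap.ker (α g) = ⊤ := by
      rw [eq_top_iff]
      intro y _
      rw [LinearMap.mem_ker, apply_eq_single, h0.1, h0.2, mul_zero, mul_zero, add_zero]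
    rw [h1, LinearMap.ker_eq_top] at h
    have h2 : toMat g - 1 = 0 := (LinearEquiv.map_eq_zero_iff _).1 h
    rw [Ref, Set.mem_ofPred_eq, h2, Matrix.rank_zero] at hg
    exact zero_ne_one hg

/-- The vector `(ζ^m, 1)` is fixed, so the root is a nonzero multiple of `X - ζ^m Y`. The multiple
cancels in `𝒟_y`, which is why the choice of roots is immaterial. -/
theorem rootChoice_reflElt (hα : IsRootChoice (Gd1 d 2) α) (m : ℕ) :
    α (reflElt ζ m) (Pi.single 0 1) ≠ 0 ∧ α (reflElt ζ m) (Pi.single 1 1) =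
      -((ζ : ℂˣ) : ℂ) ^ m * α (reflElt ζ m) (Pi.single 0 1) := by
  obtain ⟨h1, h2⟩ := rootChoice_ratio hα (reflElt_mem (ζ := ζ) m) ![((ζ : ℂˣ) : ℂ) ^ m, 1] (by
    rw [toMat_reflElt]
    ext p
    fin_cases p <;> simp [Matrix.mulVec, dotProduct])
  simp only [Matrix.cons_val_zero, Matrix.cons_val_one] at h1
  have h3 : α (reflElt ζ m) (Pi.single 1 1) =
      -((ζ : ℂˣ) : ℂ) ^ m * α (reflElt ζ m) (Pi.single 0 1) := by linear_combination h1
  refine ⟨fun h0 => ?_, h3⟩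
  rw [h0, mul_zero] at h3
  rcases h2 with h2 | h2
  · exact h2 h0
  · exact h2 h3

theorem rootChoice_tElt (hζ : IsPrimitiveRoot ζ d) (hα : IsRootChoice (Gd1 d 2) α) {k : ℕ}
    (hk : k ∈ Ico 1 d) :
    α (tElt ζ ^ k) (Pi.single 0 1) ≠ 0 ∧ α (tElt ζ ^ k) (Pi.single 1 1) = 0 := by
  obtain ⟨h1, h2⟩ := rootChoice_ratio hα (tElt_pow_mem hζ hk) ![0, 1] (by
    rw [toMat_tElt_pow]
    ext p
    fin_cases p <;> simp [Matrix.mulVec, dotProduct])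
  simp at h1
  exact ⟨h2.resolve_right (not_not.2 h1), h1⟩

theorem rootChoice_tElt' (hζ : IsPrimitiveRoot ζ d) (hα : IsRootChoice (Gd1 d 2) α) {k : ℕ}
    (hk : k ∈ Ico 1 d) :
    α (tElt' ζ k) (Pi.single 1 1) ≠ 0 ∧ α (tElt' ζ k) (Pi.single 0 1) = 0 := by
  obtain ⟨h1, h2⟩ := rootChoice_ratio hα (tElt'_mem hζ hk) ![1, 0] (by
    rw [toMat_tElt']
    ext p
    fin_cases p <;> simp [Matrix.mulVec, dotProduct])
  simp at h1
  exact ⟨h2.resolve_left (not_not.2 h1), h1⟩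

theorem det_reflElt (m : ℕ) : (toMat (reflElt ζ m)).det = -1 := by
  simp [toMat_reflElt, Matrix.det_fin_two]

theorem parameter_reflElt (hc : IsParameter (Gd1 d 2) c) (m : ℕ) :
    c (reflElt ζ m) = c (sElt d) := by
  have hs : sElt d ∈ Ref (Gd1 d 2) := by
    have := reflElt_mem (ζ := ζ) 0
    simpa [reflElt] using this
  rw [reflElt, tElt_inv, inv_pow]
  exact hc _ hs _

theorem parameter_tElt' (hζ : IsPrimitiveRoot ζ d) (hc : IsParameter (Gd1 d 2) c) {k : ℕ}
    (hk : k ∈ Ico 1 d) : c (tElt' ζ k) = c (tElt ζ ^ k) := by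
  have := hc _ (tElt_pow_mem hζ hk) (sElt d)
  rwa [sElt_inv] at this

theorem gaudinElt_eq [NeZero d] (hζ : IsPrimitiveRoot ζ d) (y : Fin 2 → ℂ) :
    gaudinElt (Gd1 d 2) c α y =
      algebraMap ℂ (RatFun 2) (y 0) • gaudinElt (Gd1 d 2) c α (Pi.single 0 1) +
      algebraMap ℂ (RatFun 2) (y 1) • gaudinElt (Gd1 d 2) c α (Pi.single 1 1) := by
  have h : ∀ g : Gd1 d 2, MonoidAlgebra.single g (algebraMap ℂ (RatFun 2)
      (c g * (toMat g).det * α g y) / formFun (α g)) =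
      algebraMap ℂ (RatFun 2) (y 0) • MonoidAlgebra.single g (algebraMap ℂ (RatFun 2)
        (c g * (toMat g).det * α g (Pi.single 0 1)) / formFun (α g)) +
      algebraMap ℂ (RatFun 2) (y 1) • MonoidAlgebra.single g (algebraMap ℂ (RatFun 2)
        (c g * (toMat g).det * α g (Pi.single 1 1)) / formFun (α g)) := by
    intro g
    rw [apply_eq_single, MonoidAlgebra.smul_single, MonoidAlgebra.smul_single,
      ← MonoidAlgebra.single_add]
    congr 1
    simp only [map_mul, map_add, smul_eq_mul]
    ring
  simp only [gaudinElt, finsum_mem_Ref hζ]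
  simp_rw [h, sum_add_distrib, smul_add, smul_sum]
  abel

/-- The roots of the `t^k` are multiples of `X`, so the factor `X` clears their denominators; the
roots of the `diag(1, ζ^k)` vanish on `(1,0)`, so these reflections do not contribute. The sign
comes from `det = -1`. -/
theorem ratX_smul_gaudinElt [NeZero d] (hζ : IsPrimitiveRoot ζ d) (hc : IsParameter (Gd1 d 2) c)
    (hα : IsRootChoice (Gd1 d 2) α) :
    ratX • gaudinElt (Gd1 d 2) c α (Pi.single 0 1) =
      ∑ m ∈ range d, MonoidAlgebra.single (reflElt ζ m) (-algebraMap ℂ (RatFun 2) (c (sElt d)) *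
        (ratX / (ratX - algebraMap ℂ _ (((ζ : ℂˣ) : ℂ) ^ m) * ratY))) +
      ∑ k ∈ Ico 1 d, MonoidAlgebra.single (tElt ζ ^ k)
        (algebraMap ℂ (RatFun 2) (c (tElt ζ ^ k) * ((ζ : ℂˣ) : ℂ) ^ k)) := by
  have hX := ratX_ne_zero
  rw [gaudinElt, finsum_mem_Ref hζ, smul_add, smul_add]
  have h3 : ratX • ∑ k ∈ Ico 1 d, MonoidAlgebra.single (tElt' ζ k) (algebraMap ℂ (RatFun 2)
      (c (tElt' ζ k) * (toMat (tElt' ζ k)).det * α (tElt' ζ k) (Pi.single 0 1)) /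
        formFun (α (tElt' ζ k))) = 0 := by
    rw [smul_sum]
    refine sum_eq_zero fun k hk => ?_
    rw [(rootChoice_tElt' hζ hα hk).2]
    simp
  rw [h3, add_zero, smul_sum, smul_sum]
  congr 1
  · refine sum_congr rfl fun m _ => ?_
    obtain ⟨h1, h2⟩ := rootChoice_reflElt (ζ := ζ) hα m
    rw [MonoidAlgebra.smul_single, det_reflElt, formFun_two, h2, parameter_reflElt hc]
    congr 1
    have h4 : algebraMap ℂ (RatFun 2) (α (reflElt ζ m) (Pi.single 0 1)) ≠ 0 := by simpa using h1
    have h5 := ratX_sub_ne_zero (((ζ : ℂˣ) : ℂ) ^ m)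
    have h6 : algebraMap ℂ (RatFun 2) (α (reflElt ζ m) (Pi.single 0 1)) * ratX +
        algebraMap ℂ (RatFun 2) (-((ζ : ℂˣ) : ℂ) ^ m * α (reflElt ζ m) (Pi.single 0 1)) * ratY =
        algebraMap ℂ (RatFun 2) (α (reflElt ζ m) (Pi.single 0 1)) *
          (ratX - algebraMap ℂ _ (((ζ : ℂˣ) : ℂ) ^ m) * ratY) := by
      rw [map_mul, map_neg]; ring
    rw [h6, smul_eq_mul]
    simp only [map_mul, map_neg, map_one]
    field_simp
  · refine sum_congr rfl fun k hk => ?_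
    obtain ⟨h1, h2⟩ := rootChoice_tElt hζ hα hk
    have h4 : algebraMap ℂ (RatFun 2) (α (tElt ζ ^ k) (Pi.single 0 1)) ≠ 0 := by simpa using h1
    rw [MonoidAlgebra.smul_single, formFun_two, h2, toMat_tElt_pow, Matrix.det_fin_two_of]
    congr 1
    rw [smul_eq_mul]
    simp only [map_mul, map_zero, zero_mul, add_zero, mul_one, mul_zero, sub_zero]
    field_simp

/-- The coefficient `c₀ ζ^m Y/(X - ζ^m Y)` is written as `c₀ (X/(X - ζ^m Y) - 1)` so that adding `X
𝒟_{(1,0)}` visibly cancels the denominators. -/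
theorem ratY_smul_gaudinElt [NeZero d] (hζ : IsPrimitiveRoot ζ d) (hc : IsParameter (Gd1 d 2) c)
    (hα : IsRootChoice (Gd1 d 2) α) :
    ratY • gaudinElt (Gd1 d 2) c α (Pi.single 1 1) =
      ∑ m ∈ range d, MonoidAlgebra.single (reflElt ζ m) (algebraMap ℂ (RatFun 2) (c (sElt d)) *
        (ratX / (ratX - algebraMap ℂ _ (((ζ : ℂˣ) : ℂ) ^ m) * ratY) - 1)) +
      ∑ k ∈ Ico 1 d, MonoidAlgebra.single (tElt' ζ k)
        (algebraMap ℂ (RatFun 2) (c (tElt ζ ^ k) * ((ζ : ℂˣ) : ℂ) ^ k)) := by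
  have hY := ratY_ne_zero
  rw [gaudinElt, finsum_mem_Ref hζ, smul_add, smul_add]
  have h3 : ratY • ∑ k ∈ Ico 1 d, MonoidAlgebra.single (tElt ζ ^ k) (algebraMap ℂ (RatFun 2)
      (c (tElt ζ ^ k) * (toMat (tElt ζ ^ k)).det * α (tElt ζ ^ k) (Pi.single 1 1)) /
        formFun (α (tElt ζ ^ k))) = 0 := by
    rw [smul_sum]
    refine sum_eq_zero fun k hk => ?_
    rw [(rootChoice_tElt hζ hα hk).2]
    simp
  rw [h3, zero_add, smul_sum, smul_sum]
  congr 1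
  · refine sum_congr rfl fun m _ => ?_
    obtain ⟨h1, h2⟩ := rootChoice_reflElt (ζ := ζ) hα m
    rw [MonoidAlgebra.smul_single, det_reflElt, formFun_two, h2, parameter_reflElt hc]
    congr 1
    have h4 : algebraMap ℂ (RatFun 2) (α (reflElt ζ m) (Pi.single 0 1)) ≠ 0 := by simpa using h1
    have h5 := ratX_sub_ne_zero (((ζ : ℂˣ) : ℂ) ^ m)
    have h6 : algebraMap ℂ (RatFun 2) (α (reflElt ζ m) (Pi.single 0 1)) * ratX +
        algebraMap ℂ (RatFun 2) (-((ζ : ℂˣ) : ℂ) ^ m * α (reflElt ζ m) (Pi.single 0 1)) * ratY =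
        algebraMap ℂ (RatFun 2) (α (reflElt ζ m) (Pi.single 0 1)) *
          (ratX - algebraMap ℂ _ (((ζ : ℂˣ) : ℂ) ^ m) * ratY) := by
      rw [map_mul, map_neg]; ring
    rw [h6, smul_eq_mul]
    generalize hD : ratX - algebraMap ℂ _ (((ζ : ℂˣ) : ℂ) ^ m) * ratY = D at h5 ⊢
    simp only [map_mul, map_neg, map_one]
    field_simp
    rw [← hD]
    ring
  · refine sum_congr rfl fun k hk => ?_
    obtain ⟨h1, h2⟩ := rootChoice_tElt' hζ hα hk
    have h4 : algebraMap ℂ (RatFun 2) (α (tElt' ζ k) (Pi.single 1 1)) ≠ 0 := by simpa using h1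
    rw [MonoidAlgebra.smul_single, formFun_two, h2, toMat_tElt', Matrix.det_fin_two_of,
      parameter_tElt' hζ hc hk]
    congr 1
    rw [smul_eq_mul]
    simp only [map_mul, map_zero, zero_mul, zero_add, one_mul, mul_zero, sub_zero]
    field_simp


/-! ### Generators of the Gaudin algebra and their action -/

section Action

variable {n : ℕ} {W : Subgroup (GL (Fin n) ℂ)} {c : W → ℂ}
  {α : W → Module.Dual ℂ (Fin n → ℂ)} {m : ℕ}

/-- The extension to `ℂ(V) W` of a matrix representation of `W`. -/
def extHom (r : MatRep W m) :
    MonoidAlgebra (RatFun n) W →ₐ[RatFun n] Matrix (Fin m) (Fin m) (RatFun n) :=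
  MonoidAlgebra.lift (RatFun n) _ W ((algebraMap ℂ (RatFun n)).mapMatrix.toMonoidHom.comp r)

theorem extHom_single (r : MatRep W m) (g : W) (a : RatFun n) :
    extHom r (MonoidAlgebra.single g a) = a • (r g).map (algebraMap ℂ (RatFun n)) :=
  MonoidAlgebra.lift_single _ _ _

theorem asAlgebraHom_over_apply (r : MatRep W m) (a : MonoidAlgebra (RatFun n) W)
    (v : Fin m → RatFun n) :
    (r.over (RatFun n)).asAlgebraHom a v = (extHom r a).mulVec v := by
  induction a using MonoidAlgebra.induction_linear with
  | zero => simp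
  | add f g hf hg => rw [map_add, map_add, LinearMap.add_apply, hf, hg, Matrix.add_mulVec]
  | single g a =>
    rw [Representation.asAlgebraHom_single, extHom_single, Matrix.smul_mulVec]
    rfl

theorem gauK_smul_def (r : MatRep W m) (a : GauK W c α) (v : extMod r) :
    a • v = show extMod r from (extHom r (GauK.incl W c α a)).mulVec (show Fin m → RatFun n from v) :=
  asAlgebraHom_over_apply r _ _

theorem gauK_algebraMap_smul (r : MatRep W m) (a : RatFun n) (v : extMod r) :
    algebraMap (RatFun n) (GauK W c α) a • v = show extMod r from
      a • (show Fin m → RatFun n from v) := by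
  rw [gauK_smul_def, AlgHom.commutes, AlgHom.commutes]
  rw [Algebra.algebraMap_eq_smul_one, Matrix.smul_mulVec, Matrix.one_mulVec]

theorem GauK.incl_injective : Function.Injective (GauK.incl W c α) := Subtype.val_injective

/-- An isomorphism of complex representations induces an isomorphism of the modules over the
Gaudin algebra. -/
def extModEquiv {m' : ℕ} {r : MatRep W m} {r' : MatRep W m'}
    (P : Matrix (Fin m') (Fin m) ℂ) (Q : Matrix (Fin m) (Fin m') ℂ) (hPQ : P * Q = 1)
    (hQP : Q * P = 1) (h : ∀ g, P * r g = r' g * P) : extMod r ≃ₗ[GauK W c α] extMod r' where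
  toFun v := show extMod r' from
    (P.map (algebraMap ℂ (RatFun n))).mulVec (show Fin m → RatFun n from v)
  invFun v := show extMod r from
    (Q.map (algebraMap ℂ (RatFun n))).mulVec (show Fin m' → RatFun n from v)
  map_add' v w := Matrix.mulVec_add _ _ _
  map_smul' a v := by
    rw [RingHom.id_apply, gauK_smul_def, gauK_smul_def]
    change Matrix.mulVec _ (Matrix.mulVec _ _) = Matrix.mulVec _ (Matrix.mulVec _ _)
    rw [Matrix.mulVec_mulVec, Matrix.mulVec_mulVec]
    congr 1
    induction GauK.incl W c α a using MonoidAlgebra.induction_linear with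
    | zero => rw [map_zero, map_zero, Matrix.mul_zero, Matrix.zero_mul]
    | add f g hf hg => rw [map_add, map_add, Matrix.mul_add, Matrix.add_mul, hf, hg]
    | single g a =>
      rw [extHom_single, extHom_single, Matrix.mul_smul, Matrix.smul_mul, ← Matrix.map_mul, h,
        Matrix.map_mul]
  left_inv v := by
    change Matrix.mulVec _ (Matrix.mulVec _ _) = _
    rw [Matrix.mulVec_mulVec, ← Matrix.map_mul, hQP,
      Matrix.map_one _ (map_zero _) (map_one _), Matrix.one_mulVec]
  right_inv v := by
    change Matrix.mulVec _ (Matrix.mulVec _ _) = _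
    rw [Matrix.mulVec_mulVec, ← Matrix.map_mul, hPQ,
      Matrix.map_one _ (map_zero _) (map_one _), Matrix.one_mulVec]

theorem gaudinElt_mem_gaudinK (y : Fin n → ℂ) : gaudinElt W c α y ∈ gaudinK W c α :=
  Algebra.subset_adjoin (Algebra.subset_adjoin ⟨y, rfl⟩)

end Action

/-! ### The generators `x` and `z` and their matrices in the irreducible representations -/

section Generators

variable {d : ℕ} (c : Gd1 d 2 → ℂ) (α : Gd1 d 2 → Module.Dual ℂ (Fin 2 → ℂ))

/-- The element `(X / d) 𝒟_{(1,0)}` of the Gaudin algebra. -/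
def genX : GauK (Gd1 d 2) c α :=
  ⟨(d : RatFun 2)⁻¹ • ratX • gaudinElt (Gd1 d 2) c α (Pi.single 0 1),
    Subalgebra.smul_mem _ (Subalgebra.smul_mem _ (gaudinElt_mem_gaudinK _) _) _⟩

/-- The element `(X 𝒟_{(1,0)} + Y 𝒟_{(0,1)}) / d` of the Gaudin algebra. -/
def genZ : GauK (Gd1 d 2) c α :=
  ⟨(d : RatFun 2)⁻¹ • (ratX • gaudinElt (Gd1 d 2) c α (Pi.single 0 1) +
      ratY • gaudinElt (Gd1 d 2) c α (Pi.single 1 1)),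
    Subalgebra.smul_mem _ (Subalgebra.add_mem _
      (Subalgebra.smul_mem _ (gaudinElt_mem_gaudinK _) _)
      (Subalgebra.smul_mem _ (gaudinElt_mem_gaudinK _) _)) _⟩

theorem incl_genX : GauK.incl (Gd1 d 2) c α (genX c α) =
    (d : RatFun 2)⁻¹ • ratX • gaudinElt (Gd1 d 2) c α (Pi.single 0 1) := rfl

theorem incl_genZ : GauK.incl (Gd1 d 2) c α (genZ c α) =
    (d : RatFun 2)⁻¹ • (ratX • gaudinElt (Gd1 d 2) c α (Pi.single 0 1) +
      ratY • gaudinElt (Gd1 d 2) c α (Pi.single 1 1)) := rfl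

variable {c α} [NeZero d] {ζ : rootsOfUnity d ℂ} (hζ : IsPrimitiveRoot ζ d)
include hζ

/-- Dividing by `X` and `Y` recovers `𝒟_{(1,0)}` and `𝒟_{(0,1)}`, and every `𝒟_y` is a linear
combination of these. -/
theorem adjoin_genX_genZ : Algebra.adjoin (RatFun 2) {genX c α, genZ c α} = ⊤ := by
  have hd : (d : RatFun 2) ≠ 0 := Nat.cast_ne_zero.2 (NeZero.ne d)
  set B := (Algebra.adjoin (RatFun 2) {genX c α, genZ c α}).map (GauK.incl (Gd1 d 2) c α)
  have hx : GauK.incl (Gd1 d 2) c α (genX c α) ∈ B :=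
    ⟨_, Algebra.subset_adjoin (by simp), rfl⟩
  have hz : GauK.incl (Gd1 d 2) c α (genZ c α) ∈ B :=
    ⟨_, Algebra.subset_adjoin (by simp), rfl⟩
  have h0 : gaudinElt (Gd1 d 2) c α (Pi.single 0 1) ∈ B := by
    have : gaudinElt (Gd1 d 2) c α (Pi.single 0 1) =
        (ratX⁻¹ * d) • GauK.incl (Gd1 d 2) c α (genX c α) := by
      rw [incl_genX, smul_smul, smul_smul,
        show ratX⁻¹ * (d : RatFun 2) * (d : RatFun 2)⁻¹ * ratX = 1 by
          have := ratX_ne_zero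
          field_simp, one_smul]
    rw [this]
    exact B.smul_mem hx _
  have h1 : gaudinElt (Gd1 d 2) c α (Pi.single 1 1) ∈ B := by
    have : gaudinElt (Gd1 d 2) c α (Pi.single 1 1) = (ratY⁻¹ * d) •
        (GauK.incl (Gd1 d 2) c α (genZ c α) - GauK.incl (Gd1 d 2) c α (genX c α)) := by
      rw [incl_genX, incl_genZ, smul_add, add_sub_cancel_left, smul_smul, smul_smul,
        show ratY⁻¹ * (d : RatFun 2) * (d : RatFun 2)⁻¹ * ratY = 1 by
          have := ratY_ne_zero
          field_simp, one_smul]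
    rw [this]
    exact B.smul_mem (B.sub_mem hz hx) _
  have hle : gaudinK (Gd1 d 2) c α ≤ B := by
    refine Algebra.adjoin_le ?_
    have : gaudin (Gd1 d 2) c α ≤ B.restrictScalars (MvPolynomial (Fin 2) ℂ) := by
      refine Algebra.adjoin_le ?_
      rintro _ ⟨y, rfl⟩
      change _ ∈ B
      rw [gaudinElt_eq hζ]
      exact B.add_mem (B.smul_mem h0 _) (B.smul_mem h1 _)
    exact this
  rw [eq_top_iff]
  intro a _
  obtain ⟨b, hb, hab⟩ := hle a.2
  have : b = a := GauK.incl_injective hab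
  rwa [← this]

variable (hc : IsParameter (Gd1 d 2) c) (hα : IsRootChoice (Gd1 d 2) α)
include hc hα

theorem extHom_genX {m : ℕ} (r : MatRep (Gd1 d 2) m) :
    extHom r (GauK.incl (Gd1 d 2) c α (genX c α)) = (d : RatFun 2)⁻¹ •
      (∑ l ∈ range d, (-algebraMap ℂ (RatFun 2) (c (sElt d)) *
        (ratX / (ratX - algebraMap ℂ _ (((ζ : ℂˣ) : ℂ) ^ l) * ratY))) •
          (r (reflElt ζ l)).map (algebraMap ℂ (RatFun 2)) +
      ∑ k ∈ Ico 1 d, (algebraMap ℂ (RatFun 2) (c (tElt ζ ^ k) * ((ζ : ℂˣ) : ℂ) ^ k)) •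
          (r (tElt ζ ^ k)).map (algebraMap ℂ (RatFun 2))) := by
  rw [incl_genX, map_smul, ratX_smul_gaudinElt hζ hc hα, map_add, map_sum, map_sum]
  simp_rw [extHom_single]

/-- In `X 𝒟_{(1,0)} + Y 𝒟_{(0,1)}` the numerator at a reflection is its root itself, so only the
constants `c_s det(s)` remain. -/
theorem extHom_genZ {m : ℕ} (r : MatRep (Gd1 d 2) m) :
    extHom r (GauK.incl (Gd1 d 2) c α (genZ c α)) = (d : RatFun 2)⁻¹ •
      (∑ l ∈ range d, (-algebraMap ℂ (RatFun 2) (c (sElt d))) •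
          (r (reflElt ζ l)).map (algebraMap ℂ (RatFun 2)) +
      (∑ k ∈ Ico 1 d, (algebraMap ℂ (RatFun 2) (c (tElt ζ ^ k) * ((ζ : ℂˣ) : ℂ) ^ k)) •
          (r (tElt ζ ^ k)).map (algebraMap ℂ (RatFun 2)) +
      ∑ k ∈ Ico 1 d, (algebraMap ℂ (RatFun 2) (c (tElt ζ ^ k) * ((ζ : ℂˣ) : ℂ) ^ k)) •
          (r (tElt' ζ k)).map (algebraMap ℂ (RatFun 2)))) := by
  have h : ∀ (l : ℕ) (x : RatFun 2), MonoidAlgebra.single (reflElt ζ l)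
      (-algebraMap ℂ (RatFun 2) (c (sElt d)) * x) + MonoidAlgebra.single (reflElt ζ l)
        (algebraMap ℂ (RatFun 2) (c (sElt d)) * (x - 1)) =
      MonoidAlgebra.single (reflElt ζ l) (-algebraMap ℂ (RatFun 2) (c (sElt d))) := by
    intro l x
    rw [← MonoidAlgebra.single_add]
    congr 1
    ring
  rw [incl_genZ, map_smul, ratX_smul_gaudinElt hζ hc hα, ratY_smul_gaudinElt hζ hc hα,
    add_add_add_comm, ← sum_add_distrib]
  simp_rw [h]
  rw [map_add, map_add, map_sum, map_sum, map_sum]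
  simp_rw [extHom_single]

omit hζ hc hα in
-- The factor `ζ^k = det(t^k)` shifts the eigenvalue `ζ^{i-1}` of `t` to `ζ^i`, the exponent
-- occurring in `k♯_i`. The natural subtraction `i - 1` is what requires `1 ≤ i`.
theorem sum_parameter (c : Gd1 d 2 → ℂ) {i : ℕ} (hi : 1 ≤ i) :
    ∑ k ∈ Ico 1 d, c (tElt ζ ^ k) * ((ζ : ℂˣ) : ℂ) ^ k * (((ζ : ℂˣ) : ℂ) ^ (i - 1)) ^ k =
      d * kSharp ζ c i := by
  have hd : (d : ℂ) ≠ 0 := Nat.cast_ne_zero.2 (NeZero.ne d)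
  rw [kSharp, kParam, ← mul_assoc, mul_one_div_cancel hd, one_mul]
  refine sum_congr rfl fun k _ => ?_
  have : (k : ℤ) * (1 - (1 - (i : ℤ))) = ((k + (i - 1) * k : ℕ) : ℤ) := by
    push_cast [Nat.cast_sub hi]
    ring
  rw [this, zpow_natCast, pow_add, pow_mul]
  ring

/-- The eigenvalue `k - ε c₀ X^d / (X^d - Y^d)` of `genX`. -/
def lineVal (d : ℕ) (c₀ ε k : ℂ) : RatFun 2 :=
  algebraMap ℂ _ k - algebraMap ℂ _ (ε * c₀) * (ratX ^ d / (ratX ^ d - ratY ^ d))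

/-- The sign `ε` of `s` treats `η_i` and `η'_i` together. The diagonal reflections contribute `k♯_i`
once to `x` and twice to `z`. The others all act by `ε`, and `∑_m X/(X - ζ^m Y) = d X^d/(X^d - Y^d)`
is the partial fraction formula with `β = 1`, `l = 0`. -/
theorem isLine_extMod (r : MatRep (Gd1 d 2) 1) {ε : ℂ} {i : ℕ} (hi : 1 ≤ i)
    (hε : ε * ε = 1) (hs : r (sElt d) = ε • 1) (ht : r (tElt ζ) = !![((ζ : ℂˣ) : ℂ) ^ (i - 1)]) :
    IsLine (genX c α) (genZ c α) (extMod r) (lineVal d (c (sElt d)) ε (kSharp ζ c i))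
      (algebraMap ℂ _ (2 * kSharp ζ c i - ε * c (sElt d))) := by
  have hd : (d : RatFun 2) ≠ 0 := Nat.cast_ne_zero.2 (NeZero.ne d)
  have hz := isPrimitiveRoot_val hζ
  have hdiag : ∀ k, r (tElt ζ ^ k) = (((ζ : ℂˣ) : ℂ) ^ (i - 1)) ^ k • 1 := by
    intro k
    have h1 : !![((ζ : ℂˣ) : ℂ) ^ (i - 1)] = ((ζ : ℂˣ) : ℂ) ^ (i - 1) •
        (1 : Matrix (Fin 1) (Fin 1) ℂ) := by
      ext p q; fin_cases p; fin_cases q; simp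
    rw [map_pow, ht, h1, smul_pow, one_pow]
  have hdiag' : ∀ k, r (tElt' ζ k) = (((ζ : ℂˣ) : ℂ) ^ (i - 1)) ^ k • 1 := by
    intro k
    rw [tElt', map_mul, map_mul, hdiag, hs]
    simp only [smul_mul_smul_comm, mul_one]
    rw [mul_comm ε, mul_assoc, hε, mul_one]
  have hrefl : ∀ l, r (reflElt ζ l) = ε • 1 := by
    intro l
    have h1 : r (tElt ζ ^ l) * r (tElt ζ⁻¹ ^ l) = 1 := by
      rw [← map_mul, tElt_inv, inv_pow, mul_inv_cancel, map_one]
    rw [reflElt, map_mul, map_mul, hs, mul_smul_comm, mul_one, smul_mul_assoc, h1]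
  have hmap : ∀ a : ℂ, (a • (1 : Matrix (Fin 1) (Fin 1) ℂ)).map (algebraMap ℂ (RatFun 2)) =
      algebraMap ℂ (RatFun 2) a • 1 := by
    intro a
    ext p q; fin_cases p; fin_cases q; simp
  have hk := sum_parameter (ζ := ζ) c hi
  have hX : extHom r (GauK.incl (Gd1 d 2) c α (genX c α)) =
      lineVal d (c (sElt d)) ε (kSharp ζ c i) • 1 := by
    rw [extHom_genX hζ hc hα]
    simp_rw [hdiag, hrefl, hmap, smul_smul, ← map_mul]
    rw [← sum_smul, ← sum_smul, ← add_smul, ← map_sum, hk, smul_smul]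
    congr 1
    have hsum := sum_div_ratX_sub (d := d) (β := 1) (l := 0) hz (NeZero.pos d) (by simp)
    simp only [one_pow, map_one, one_mul, tsub_zero, pow_zero, mul_one] at hsum
    have : ∀ l, -algebraMap ℂ (RatFun 2) (c (sElt d)) *
        (ratX / (ratX - algebraMap ℂ _ (((ζ : ℂˣ) : ℂ) ^ l) * ratY)) * algebraMap ℂ _ ε =
        -algebraMap ℂ (RatFun 2) (ε * c (sElt d)) *
        (ratX / (ratX - algebraMap ℂ _ (((ζ : ℂˣ) : ℂ) ^ l) * ratY)) := by
      intro l; rw [map_mul]; ring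
    simp_rw [this]
    rw [← mul_sum, hsum, lineVal, map_mul _ (d : ℂ), map_natCast]
    generalize ratX ^ d / (ratX ^ d - ratY ^ d) = u
    field_simp
    ring
  have hZ : extHom r (GauK.incl (Gd1 d 2) c α (genZ c α)) =
      algebraMap ℂ (RatFun 2) (2 * kSharp ζ c i - ε * c (sElt d)) • 1 := by
    rw [extHom_genZ hζ hc hα]
    simp_rw [hdiag, hdiag', hrefl, hmap, smul_smul, ← map_mul]
    rw [← sum_smul, ← sum_smul, ← add_smul, ← add_smul, ← map_sum, hk, smul_smul]
    congr 1
    rw [sum_const, card_range, nsmul_eq_mul, map_mul _ (d : ℂ), map_natCast]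
    field_simp
    simp only [map_mul, map_sub, map_ofNat]
    ring
  refine isLine_of_generator (v := show extMod r from fun _ => 1) ?_ ?_ ?_ ?_
  · intro h
    exact one_ne_zero (congrFun h 0)
  · intro v
    refine ⟨(show Fin 1 → RatFun 2 from v) 0, ?_⟩
    rw [gauK_algebraMap_smul]
    funext p
    rw [Subsingleton.elim p 0]
    simp
  · rw [gauK_smul_def, hX, gauK_algebraMap_smul, Matrix.smul_mulVec, Matrix.one_mulVec]
  · rw [gauK_smul_def, hZ, gauK_algebraMap_smul, Matrix.smul_mulVec, Matrix.one_mulVec]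

theorem isLine_etaRep {i : ℕ} (hi : 1 ≤ i) :
    IsLine (genX c α) (genZ c α) (extMod (etaRep d i))
      (lineVal d (c (sElt d)) 1 (kSharp ζ c i))
      (algebraMap ℂ _ (2 * kSharp ζ c i - 1 * c (sElt d))) :=
  isLine_extMod hζ hc hα _ hi (by norm_num) (by rw [etaRep_s, one_smul]) (etaRep_t ζ i)

theorem isLine_etaRep' {i : ℕ} (hi : 1 ≤ i) :
    IsLine (genX c α) (genZ c α) (extMod (etaRep' d i))
      (lineVal d (c (sElt d)) (-1) (kSharp ζ c i))
      (algebraMap ℂ _ (2 * kSharp ζ c i - (-1) * c (sElt d))) :=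
  isLine_extMod hζ hc hα _ hi (by norm_num) (by rw [etaRep'_s, neg_smul, one_smul])
    (etaRep'_t ζ i)

/-- The determinant of `genX` on a two-dimensional representation. -/
def planeDet (d : ℕ) (c₀ a b : ℂ) : RatFun 2 :=
  algebraMap ℂ _ (a * b) - algebraMap ℂ _ (c₀ ^ 2) *
    (ratX ^ d * ratY ^ d) / (ratX ^ d - ratY ^ d) ^ 2

omit [NeZero d] hζ hc hα in
theorem rhoRep_reflElt {i j : ℕ} (l : ℕ) : rhoRep d i j (reflElt ζ l) =
    !![0, (((ζ : ℂˣ) : ℂ) ^ (i - 1) * (((ζ : ℂˣ) : ℂ) ^ (j - 1))⁻¹) ^ l;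
      (((ζ : ℂˣ) : ℂ) ^ (j - 1) * (((ζ : ℂˣ) : ℂ) ^ (i - 1))⁻¹) ^ l, 0] := by
  rw [reflElt, map_mul, map_mul, map_pow, map_pow, rhoRep_t, rhoRep_t, rhoRep_s, diag_pow,
    diag_pow]
  ext p q
  fin_cases p <;> fin_cases q <;> simp [mul_pow]

omit [NeZero d] hζ hc hα in
theorem rhoRep_tElt' {i j : ℕ} (k : ℕ) : rhoRep d i j (tElt' ζ k) =
    !![(((ζ : ℂˣ) : ℂ) ^ (j - 1)) ^ k, 0; 0, (((ζ : ℂˣ) : ℂ) ^ (i - 1)) ^ k] := by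
  rw [tElt', map_mul, map_mul, map_pow, rhoRep_t, rhoRep_s, diag_pow]
  ext p q
  fin_cases p <;> fin_cases q <;> simp

/-- Powers of `t` give the diagonal, the remaining reflections the antidiagonal. The two
off-diagonal sums are the partial fraction formula with `l = j - i` and, since `l` must lie between
`0` and `d - 1`, with `l = d - (j - i)` in place of `i - j`. -/
theorem extHom_rhoRep_genX {i j : ℕ} (hi : 1 ≤ i) (hij : i < j) (hj : j ≤ d) :
    extHom (rhoRep d i j) (GauK.incl (Gd1 d 2) c α (genX c α)) =
      !![algebraMap ℂ _ (kSharp ζ c i), -algebraMap ℂ _ (c (sElt d)) *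
          (ratX ^ (d - (j - i)) * ratY ^ (j - i) / (ratX ^ d - ratY ^ d));
        -algebraMap ℂ _ (c (sElt d)) *
          (ratX ^ (j - i) * ratY ^ (d - (j - i)) / (ratX ^ d - ratY ^ d)),
        algebraMap ℂ _ (kSharp ζ c j)] := by
  have hd : (d : RatFun 2) ≠ 0 := Nat.cast_ne_zero.2 (NeZero.ne d)
  have hz := isPrimitiveRoot_val hζ
  have hz0 : ((ζ : ℂˣ) : ℂ) ≠ 0 := Units.ne_zero _
  have hki := sum_parameter (ζ := ζ) c hi
  have hkj := sum_parameter (ζ := ζ) c (hi.trans hij.le)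
  have h01 := sum_div_ratX_sub (d := d) hz
    (β := ((ζ : ℂˣ) : ℂ) ^ (i - 1) * (((ζ : ℂˣ) : ℂ) ^ (j - 1))⁻¹) (l := j - i) (by omega) (by
      rw [mul_right_comm, ← pow_add, show i - 1 + (j - i) = j - 1 by omega,
        mul_inv_cancel₀ (pow_ne_zero _ hz0)])
  have h10 := sum_div_ratX_sub (d := d) hz
    (β := ((ζ : ℂˣ) : ℂ) ^ (j - 1) * (((ζ : ℂˣ) : ℂ) ^ (i - 1))⁻¹) (l := d - (j - i))
    (by omega) (by
      rw [mul_right_comm, ← pow_add, show j - 1 + (d - (j - i)) = d + (i - 1) by omega, pow_add,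
        hz.pow_eq_one, one_mul, mul_inv_cancel₀ (pow_ne_zero _ hz0)])
  rw [show d - (d - (j - i)) = j - i by omega] at h10
  rw [extHom_genX hζ hc hα]
  simp_rw [map_pow (rhoRep d i j), rhoRep_t, diag_pow, rhoRep_reflElt]
  ext p q
  simp only [Matrix.smul_apply, Matrix.add_apply, Matrix.sum_apply, Matrix.map_apply, smul_eq_mul]
  fin_cases p <;> fin_cases q
  · simp only [Fin.zero_eta, Matrix.of_apply, Matrix.cons_val', Matrix.cons_val_zero,
      Matrix.cons_val_fin_one, map_zero, mul_zero, sum_const_zero, zero_add]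
    simp_rw [← map_mul]
    rw [← map_sum, hki, map_mul, map_natCast, inv_mul_cancel_left₀ hd]
  · simp only [Fin.zero_eta, Fin.mk_one, Matrix.of_apply, Matrix.cons_val', Matrix.cons_val_zero,
      Matrix.cons_val_one, Matrix.cons_val_fin_one, map_zero, mul_zero, sum_const_zero, add_zero]
    simp_rw [mul_assoc, mul_comm (ratX / _)]
    rw [← mul_sum, h01, mul_left_comm, inv_mul_cancel_left₀ hd]
  · simp only [Fin.zero_eta, Fin.mk_one, Matrix.of_apply, Matrix.cons_val', Matrix.cons_val_zero,
      Matrix.cons_val_one, Matrix.cons_val_fin_one, map_zero, mul_zero, sum_const_zero, add_zero]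
    simp_rw [mul_assoc, mul_comm (ratX / _)]
    rw [← mul_sum, h10, mul_left_comm, inv_mul_cancel_left₀ hd]
  · simp only [Fin.mk_one, Matrix.of_apply, Matrix.cons_val',
      Matrix.cons_val_one, Matrix.cons_val_fin_one, map_zero, mul_zero, sum_const_zero, zero_add]
    simp_rw [← map_mul]
    rw [← map_sum, hkj, map_mul, map_natCast, inv_mul_cancel_left₀ hd]

/-- The antidiagonal entries are sums of powers of a nontrivial `d`-th root of unity, as `ζ^{i-1} ≠
ζ^{j-1}`, hence zero. On both diagonal entries the two families of diagonal reflections contribute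
`k♯_i` and `k♯_j`, one each. -/
theorem extHom_rhoRep_genZ {i j : ℕ} (hi : 1 ≤ i) (hij : i < j) (hj : j ≤ d) :
    extHom (rhoRep d i j) (GauK.incl (Gd1 d 2) c α (genZ c α)) =
      algebraMap ℂ (RatFun 2) (kSharp ζ c i + kSharp ζ c j) • 1 := by
  have hd : (d : RatFun 2) ≠ 0 := Nat.cast_ne_zero.2 (NeZero.ne d)
  have hz := isPrimitiveRoot_val hζ
  have hz0 : ((ζ : ℂˣ) : ℂ) ≠ 0 := Units.ne_zero _
  have hki := sum_parameter (ζ := ζ) c hi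
  have hkj := sum_parameter (ζ := ζ) c (hi.trans hij.le)
  have hne : ((ζ : ℂˣ) : ℂ) ^ (i - 1) ≠ ((ζ : ℂˣ) : ℂ) ^ (j - 1) := fun h => by
    have := hz.pow_inj (by omega) (by omega) h
    omega
  have hroot : ∀ a b : ℕ, a ≤ d → b ≤ d → ((ζ : ℂˣ) : ℂ) ^ a ≠ ((ζ : ℂˣ) : ℂ) ^ b →
      ∑ l ∈ range d, (((ζ : ℂˣ) : ℂ) ^ a * (((ζ : ℂˣ) : ℂ) ^ b)⁻¹) ^ l = 0 := by
    intro a b _ _ hab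
    rw [sum_pow_of_pow_eq_one, if_neg]
    · rw [← div_eq_mul_inv, div_eq_one_iff_eq (pow_ne_zero _ hz0)]
      exact hab
    · rw [mul_pow, inv_pow, ← pow_mul, ← pow_mul, mul_comm a, mul_comm b, pow_mul, pow_mul,
        hz.pow_eq_one]
      simp
  rw [extHom_genZ hζ hc hα]
  simp_rw [map_pow (rhoRep d i j), rhoRep_t, diag_pow, rhoRep_reflElt, rhoRep_tElt']
  ext p q
  simp only [Matrix.smul_apply, Matrix.add_apply, Matrix.sum_apply, Matrix.map_apply, smul_eq_mul]
  fin_cases p <;> fin_cases q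
  · simp only [Fin.zero_eta, Matrix.of_apply, Matrix.cons_val', Matrix.cons_val_zero,
      Matrix.cons_val_fin_one, map_zero, mul_zero, sum_const_zero, zero_add, Matrix.one_apply_eq,
      mul_one]
    simp_rw [← map_mul]
    rw [← map_sum, ← map_sum, hki, hkj, ← map_add, ← mul_add, map_mul, map_natCast,
      inv_mul_cancel_left₀ hd]
  · simp only [Fin.zero_eta, Fin.mk_one, Matrix.of_apply, Matrix.cons_val', Matrix.cons_val_zero,
      Matrix.cons_val_one, Matrix.cons_val_fin_one, map_zero, mul_zero, sum_const_zero, add_zero]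
    rw [← mul_sum, ← map_sum, hroot _ _ (by omega) (by omega) hne]
    simp
  · simp only [Fin.zero_eta, Fin.mk_one, Matrix.of_apply, Matrix.cons_val', Matrix.cons_val_zero,
      Matrix.cons_val_one, Matrix.cons_val_fin_one, map_zero, mul_zero, sum_const_zero, add_zero]
    rw [← mul_sum, ← map_sum, hroot _ _ (by omega) (by omega) hne.symm]
    simp
  · simp only [Fin.mk_one, Matrix.of_apply, Matrix.cons_val',
      Matrix.cons_val_one, Matrix.cons_val_fin_one, map_zero, mul_zero, sum_const_zero, zero_add,
      Matrix.one_apply_eq, mul_one]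
    simp_rw [← map_mul]
    rw [← map_sum, ← map_sum, hki, hkj, ← map_add, ← mul_add, map_mul, map_natCast,
      inv_mul_cancel_left₀ hd, add_comm]

/-- The relation is Cayley–Hamilton for the matrix of `x`, whose trace happens to be the scalar of
`z`. The vector `(1,0)` is cyclic because the lower left entry is nonzero, which is where `c₀ ≠ 0`
enters. -/
theorem isPlane_rhoRep (hne : c (sElt d) ≠ 0) {i j : ℕ} (hi : 1 ≤ i) (hij : i < j) (hj : j ≤ d) :
    IsPlane (genX c α) (genZ c α) (extMod (rhoRep d i j))
      (algebraMap ℂ _ (kSharp ζ c i + kSharp ζ c j))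
      (planeDet d (c (sElt d)) (kSharp ζ c i) (kSharp ζ c j)) := by
  have hX := extHom_rhoRep_genX hζ hc hα hi hij hj
  have hZ := extHom_rhoRep_genZ hζ hc hα hi hij hj
  set M := extHom (rhoRep d i j) (GauK.incl (Gd1 d 2) c α (genX c α)) with hM
  have hΔ := ratX_pow_sub_ne_zero (NeZero.ne d)
  have hdet : M * M = algebraMap ℂ (RatFun 2) (kSharp ζ c i + kSharp ζ c j) • M -
      planeDet d (c (sElt d)) (kSharp ζ c i) (kSharp ζ c j) • 1 := by
    have huv : (ratX ^ (d - (j - i)) * ratY ^ (j - i) / (ratX ^ d - ratY ^ d)) *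
        (ratX ^ (j - i) * ratY ^ (d - (j - i)) / (ratX ^ d - ratY ^ d)) =
        (ratX ^ d * ratY ^ d) / (ratX ^ d - ratY ^ d) ^ 2 := by
      have h1 : ratX ^ d = ratX ^ (d - (j - i)) * ratX ^ (j - i) := by
        rw [← pow_add]; congr 1; omega
      have h2 : ratY ^ d = ratY ^ (d - (j - i)) * ratY ^ (j - i) := by
        rw [← pow_add]; congr 1; omega
      rw [div_mul_div_comm, ← pow_two]
      congr 1
      rw [h1, h2]
      ring
    rw [hX]
    unfold planeDet
    rw [mul_div_assoc (algebraMap ℂ (RatFun 2) _), ← huv]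
    generalize ratX ^ (d - (j - i)) * ratY ^ (j - i) / (ratX ^ d - ratY ^ d) = u
    generalize ratX ^ (j - i) * ratY ^ (d - (j - i)) / (ratX ^ d - ratY ^ d) = v
    simp only [map_add, map_mul, map_pow]
    generalize algebraMap ℂ (RatFun 2) (kSharp ζ c i) = a
    generalize algebraMap ℂ (RatFun 2) (kSharp ζ c j) = b
    ext p q
    fin_cases p <;> fin_cases q <;> simp <;> ring
  have hXv : ∀ v : extMod (rhoRep d i j), genX c α • v = show extMod (rhoRep d i j) from
      M.mulVec (show Fin 2 → RatFun 2 from v) := fun v => gauK_smul_def _ _ _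
  have hlin : ∀ (a b : RatFun 2) (v : extMod (rhoRep d i j)),
      algebraMap (RatFun 2) (GauK (Gd1 d 2) c α) a • v +
        algebraMap (RatFun 2) (GauK (Gd1 d 2) c α) b • genX c α • v =
      show extMod (rhoRep d i j) from a • (show Fin 2 → RatFun 2 from v) +
        b • M.mulVec (show Fin 2 → RatFun 2 from v) := fun a b v =>
    congrArg₂ _ (gauK_algebraMap_smul _ a v)
      ((gauK_algebraMap_smul _ b _).trans (congrArg (b • ·) (hXv v)))
  refine ⟨fun v => ?_, fun v => ?_, show extMod (rhoRep d i j) from ![1, 0], fun v => ?_,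
    fun a b h => ?_⟩
  · rw [gauK_smul_def, hZ, gauK_algebraMap_smul, Matrix.smul_mulVec, Matrix.one_mulVec]
  · rw [sub_eq_neg_add, ← neg_smul, ← map_neg, hlin]
    refine ((hXv _).trans (congrArg M.mulVec (hXv v))).trans ?_
    change M.mulVec (M.mulVec (show Fin 2 → RatFun 2 from v)) = _
    rw [Matrix.mulVec_mulVec, hdet, Matrix.sub_mulVec, Matrix.smul_mulVec, Matrix.smul_mulVec,
      Matrix.one_mulVec, neg_smul, ← sub_eq_neg_add]
  all_goals
    have hv : algebraMap ℂ (RatFun 2) (c (sElt d)) *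
        (ratX ^ (j - i) * ratY ^ (d - (j - i)) / (ratX ^ d - ratY ^ d)) ≠ 0 :=
      mul_ne_zero (by simpa using hne) (div_ne_zero (mul_ne_zero (pow_ne_zero _ ratX_ne_zero)
        (pow_ne_zero _ ratY_ne_zero)) hΔ)
    generalize hw : algebraMap ℂ (RatFun 2) (c (sElt d)) *
        (ratX ^ (j - i) * ratY ^ (d - (j - i)) / (ratX ^ d - ratY ^ d)) = w at hv
    have hM1 : M.mulVec ![1, 0] = ![algebraMap ℂ _ (kSharp ζ c i), -w] := by
      rw [hX, ← hw]
      ext p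
      fin_cases p <;> simp [Matrix.mulVec, dotProduct]
  · refine ⟨(show Fin 2 → RatFun 2 from v) 0 +
      (show Fin 2 → RatFun 2 from v) 1 / w * algebraMap ℂ _ (kSharp ζ c i),
      -(show Fin 2 → RatFun 2 from v) 1 / w, ?_⟩
    rw [hlin]
    change v = _ • (![1, 0] : Fin 2 → RatFun 2) + _ • M.mulVec ![1, 0]
    rw [hM1]
    have key : ∀ u : Fin 2 → RatFun 2, u = (u 0 + u 1 / w * algebraMap ℂ _ (kSharp ζ c i)) •
        ![1, 0] + (-u 1 / w) • ![algebraMap ℂ _ (kSharp ζ c i), -w] := by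
      intro u
      ext p
      fin_cases p
      · simp
        ring
      · simp
        field_simp
    exact key v
  · rw [hlin] at h
    change a • (![1, 0] : Fin 2 → RatFun 2) + b • M.mulVec ![1, 0] = 0 at h
    rw [hM1] at h
    have h0 := congrFun h 0
    have h1 := congrFun h 1
    simp [hv] at h0 h1
    subst h1
    simpa using h0

end Generators


/-! ### Faithfulness and commutativity -/

/-- Every element acts as a polynomial in the single operator `x`. -/
theorem smul_comm_of_quadratic {K A M : Type} [Field K] [Ring A] [Algebra K A] {x z : A}
    [AddCommGroup M] [Module A M] {q n : K} (hgen : Algebra.adjoin K {x, z} = ⊤)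
    (hz : ∀ m : M, z • m = algebraMap K A q • m)
    (hx : ∀ m : M, x • x • m = algebraMap K A q • x • m - algebraMap K A n • m) (a b : A)
    (m : M) : a • b • m = b • a • m := by
  obtain ⟨a₁, a₂, ha⟩ := exists_smul_eq hgen hz hx a
  obtain ⟨b₁, b₂, hb⟩ := exists_smul_eq hgen hz hx b
  rw [hb m, ha m, hb, ha]
  let _ : Module K M := Module.compHom M (algebraMap K A)
  have hs : ∀ (k : K) (m : M), algebraMap K A k • m = k • m := fun _ _ => rfl
  have hc : ∀ (k : K) (m : M), x • k • m = k • x • m := fun k m => algebraMap_smul_comm k x m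
  obtain ⟨X, hX⟩ : ∃ X : M → M, ∀ m, x • m = X m := ⟨_, fun _ => rfl⟩
  simp only [hs, smul_add, hc]
  simp only [hX]
  module

/-- Injectivity of the Fourier transform on `(ℤ/d)²`, by the Vandermonde argument in each variable
in turn. -/
theorem eq_zero_of_forall_sum_root_pow {K : Type} [Field K] {d : ℕ} {ω : K}
    (hω : IsPrimitiveRoot ω d) (h : Fin d → Fin d → K)
    (hh : ∀ p < d, ∀ q < d, ∑ m, ∑ n, h m n * ((ω ^ (m : ℕ)) ^ p * (ω ^ (n : ℕ)) ^ q) = 0) :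
    h = 0 := by
  have hinj : Function.Injective fun p : Fin d => ω ^ (p : ℕ) := fun p q hpq =>
    Fin.ext (hω.pow_inj p.2 q.2 hpq)
  have h1 : ∀ q : Fin d, (fun m => ∑ n, h m n * (ω ^ (n : ℕ)) ^ (q : ℕ)) = 0 := by
    intro q
    refine Matrix.eq_zero_of_forall_index_sum_mul_pow_eq_zero hinj fun p => ?_
    rw [← hh p p.2 q q.2]
    refine sum_congr rfl fun m _ => ?_
    rw [sum_mul]
    refine sum_congr rfl fun n _ => ?_
    rw [← pow_mul ω m, mul_comm (m : ℕ), pow_mul]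
    ring
  funext m
  refine Matrix.eq_zero_of_forall_index_sum_mul_pow_eq_zero hinj fun q => ?_
  have h2 := congrFun (h1 q) m
  simp only [Pi.zero_apply] at h2
  rw [← h2]
  refine sum_congr rfl fun n _ => ?_
  rw [← pow_mul, ← pow_mul, mul_comm (q : ℕ)]

section Faithful

variable {d : ℕ} (ζ : rootsOfUnity d ℂ)

theorem etaRep_diagElt (i m n : ℕ) : etaRep d i (diagElt ζ m n) 0 0 =
    (((ζ : ℂˣ) : ℂ) ^ m) ^ (i - 1) * (((ζ : ℂˣ) : ℂ) ^ n) ^ (i - 1) := by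
  simp [etaRep, entryProd, rowEntry, toMat_diagElt, Fin.prod_univ_two, mul_pow]

theorem etaRep_diagElt_mul_sElt (i m n : ℕ) : etaRep d i (diagElt ζ m n * sElt d) 0 0 =
    (((ζ : ℂˣ) : ℂ) ^ m) ^ (i - 1) * (((ζ : ℂˣ) : ℂ) ^ n) ^ (i - 1) := by
  rw [map_mul, etaRep_s, mul_one, etaRep_diagElt]

theorem etaRep'_diagElt (i m n : ℕ) : etaRep' d i (diagElt ζ m n) 0 0 =
    (((ζ : ℂˣ) : ℂ) ^ m) ^ (i - 1) * (((ζ : ℂˣ) : ℂ) ^ n) ^ (i - 1) := by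
  have hz0 : ((ζ : ℂˣ) : ℂ) ≠ 0 := Units.ne_zero _
  simp [etaRep', entryProd, rowEntry, toMat_diagElt, Fin.prod_univ_two, mul_pow,
    Matrix.det_fin_two]
  field_simp

theorem etaRep'_diagElt_mul_sElt (i m n : ℕ) : etaRep' d i (diagElt ζ m n * sElt d) 0 0 =
    -((((ζ : ℂˣ) : ℂ) ^ m) ^ (i - 1) * (((ζ : ℂˣ) : ℂ) ^ n) ^ (i - 1)) := by
  rw [map_mul, etaRep'_s, mul_neg, mul_one, Matrix.neg_apply, etaRep'_diagElt]

theorem rhoRep_diagElt (i j m n : ℕ) : rhoRep d i j (diagElt ζ m n) =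
    !![(((ζ : ℂˣ) : ℂ) ^ m) ^ (i - 1) * (((ζ : ℂˣ) : ℂ) ^ n) ^ (j - 1), 0;
      0, (((ζ : ℂˣ) : ℂ) ^ m) ^ (j - 1) * (((ζ : ℂˣ) : ℂ) ^ n) ^ (i - 1)] := by
  rw [diagElt, ← tElt', map_mul, map_pow, rhoRep_t, rhoRep_tElt', diag_pow]
  ext p q
  fin_cases p <;> fin_cases q <;> simp [← pow_mul, mul_comm]

theorem rhoRep_diagElt_mul_sElt (i j m n : ℕ) : rhoRep d i j (diagElt ζ m n * sElt d) =
    !![0, (((ζ : ℂˣ) : ℂ) ^ m) ^ (i - 1) * (((ζ : ℂˣ) : ℂ) ^ n) ^ (j - 1);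
      (((ζ : ℂˣ) : ℂ) ^ m) ^ (j - 1) * (((ζ : ℂˣ) : ℂ) ^ n) ^ (i - 1), 0] := by
  rw [map_mul, rhoRep_diagElt, rhoRep_s]
  ext p q
  fin_cases p <;> fin_cases q <;> simp

variable {ζ} [NeZero d] (hζ : IsPrimitiveRoot ζ d)
include hζ

theorem extHom_apply_eq_sum {m : ℕ} (r : MatRep (Gd1 d 2) m)
    (a : MonoidAlgebra (RatFun 2) (Gd1 d 2)) (p q : Fin m) :
    extHom r a p q =
      ∑ k : Fin d, ∑ l : Fin d, a.coeff (diagElt ζ k l) *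
        algebraMap ℂ (RatFun 2) (r (diagElt ζ k l) p q) +
      ∑ k : Fin d, ∑ l : Fin d, a.coeff (diagElt ζ k l * sElt d) *
        algebraMap ℂ (RatFun 2) (r (diagElt ζ k l * sElt d) p q) := by
  have hb := eltOf_bijective hζ
  have : Fintype (Gd1 d 2) := Fintype.ofBijective _ hb
  have h1 : extHom r a =
      ∑ g : Gd1 d 2, a.coeff g • (r g).map (algebraMap ℂ (RatFun 2)) := by
    rw [extHom, MonoidAlgebra.lift_apply, Finsupp.sum_fintype]
    · rfl
    · exact fun g => zero_smul _ _
  rw [h1, ← hb.sum_comp, Fintype.sum_sum_type, Fintype.sum_prod_type, Fintype.sum_prod_type]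
  simp only [Matrix.add_apply, Matrix.sum_apply, Matrix.smul_apply, Matrix.map_apply, smul_eq_mul]
  rfl

/-- The matrix coefficients yield every character `(m, n) ↦ ζ^{mp + nq}` of the diagonal subgroup,
separately on it and on its coset by `s`: from the first row of `ρ_{p+1,q+1}` if `p < q`, the second
row of `ρ_{q+1,p+1}` if `q < p`, and from the half sum and half difference of `η_{p+1}` and
`η'_{p+1}` if `p = q`. Fourier inversion then kills each coefficient of `a`. -/
theorem eq_zero_of_extHom_eq_zero (a : MonoidAlgebra (RatFun 2) (Gd1 d 2))
    (h1 : ∀ i ∈ Icc 1 d, extHom (etaRep d i) a = 0)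
    (h2 : ∀ i ∈ Icc 1 d, extHom (etaRep' d i) a = 0)
    (h3 : ∀ i ∈ Icc 1 d, ∀ j ∈ Icc 1 d, i < j → extHom (rhoRep d i j) a = 0) : a = 0 := by
  have hω : IsPrimitiveRoot (algebraMap ℂ (RatFun 2) ((ζ : ℂˣ) : ℂ)) d :=
    (isPrimitiveRoot_val hζ).map_of_injective (algebraMap_ratFun_injective 2)
  set ω := algebraMap ℂ (RatFun 2) ((ζ : ℂˣ) : ℂ)
  have hsum : ∀ p < d, ∀ q < d,
      (∑ m : Fin d, ∑ n : Fin d, a.coeff (diagElt ζ m n) *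
        ((ω ^ (m : ℕ)) ^ p * (ω ^ (n : ℕ)) ^ q) = 0) ∧
      ∑ m : Fin d, ∑ n : Fin d, a.coeff (diagElt ζ m n * sElt d) *
        ((ω ^ (m : ℕ)) ^ p * (ω ^ (n : ℕ)) ^ q) = 0 := by
    intro p hp q hq
    have hp' : p + 1 ∈ Icc 1 d := mem_Icc.2 (by omega)
    have hq' : q + 1 ∈ Icc 1 d := mem_Icc.2 (by omega)
    rcases lt_trichotomy p q with hpq | rfl | hpq
    · have h := h3 _ hp' _ hq' (by omega)
      have h00 := congrFun (congrFun h 0) 0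
      have h01 := congrFun (congrFun h 0) 1
      rw [extHom_apply_eq_sum hζ] at h00 h01
      simp only [rhoRep_diagElt, rhoRep_diagElt_mul_sElt] at h00 h01
      simp at h00 h01
      exact ⟨h00, h01⟩
    · have h := congrFun (congrFun (h1 _ hp') 0) 0
      have h' := congrFun (congrFun (h2 _ hp') 0) 0
      rw [extHom_apply_eq_sum hζ] at h h'
      simp only [etaRep_diagElt, etaRep_diagElt_mul_sElt, etaRep'_diagElt,
        etaRep'_diagElt_mul_sElt, map_neg, mul_neg, sum_neg_distrib] at h h'
      simp only [map_mul, map_pow, add_tsub_cancel_right, Matrix.zero_apply] at h h'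
      constructor
      · linear_combination (1 / 2 : RatFun 2) * h + (1 / 2 : RatFun 2) * h'
      · linear_combination (1 / 2 : RatFun 2) * h - (1 / 2 : RatFun 2) * h'
    · have h := h3 _ hq' _ hp' (by omega)
      have h00 := congrFun (congrFun h 1) 1
      have h01 := congrFun (congrFun h 1) 0
      rw [extHom_apply_eq_sum hζ] at h00 h01
      simp only [rhoRep_diagElt, rhoRep_diagElt_mul_sElt] at h00 h01
      simp at h00 h01
      exact ⟨h00, h01⟩
  have hf := eq_zero_of_forall_sum_root_pow hω (fun m n => a.coeff (diagElt ζ m n))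
    fun p hp q hq => (hsum p hp q hq).1
  have hg := eq_zero_of_forall_sum_root_pow hω (fun m n => a.coeff (diagElt ζ m n * sElt d))
    fun p hp q hq => (hsum p hp q hq).2
  rw [← MonoidAlgebra.coeff_eq_zero]
  ext g
  obtain ⟨m, hm, n, hn, rfl | rfl⟩ := exists_eq_diagElt hζ g
  · exact congrFun (congrFun hf ⟨m, hm⟩) ⟨n, hn⟩
  · exact congrFun (congrFun hg ⟨m, hm⟩) ⟨n, hn⟩

end Faithful

/-- The list `η_i`, `η'_i`, `ρ_{i,j}` of representations of `G(d,1,2)`. -/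
def repOf (d : ℕ) : ℕ ⊕ ℕ ⊕ ℕ × ℕ → Σ m, MatRep (Gd1 d 2) m
  | .inl i => ⟨1, etaRep d i⟩
  | .inr (.inl i) => ⟨1, etaRep' d i⟩
  | .inr (.inr p) => ⟨2, rhoRep d p.1 p.2⟩

/-- The pairs `1 ≤ i < j ≤ d`. -/
def pairs (d : ℕ) : Finset (ℕ × ℕ) := {p ∈ Icc 1 d ×ˢ Icc 1 d | p.1 < p.2}

/-- The labels of the irreducible representations of `G(d,1,2)`. -/
def labels (d : ℕ) : Finset (ℕ ⊕ ℕ ⊕ ℕ × ℕ) :=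
  (Icc 1 d).disjSum ((Icc 1 d).disjSum (pairs d))

theorem mem_pairs {d : ℕ} {p : ℕ × ℕ} : p ∈ pairs d ↔ 1 ≤ p.1 ∧ p.1 < p.2 ∧ p.2 ≤ d := by
  rw [pairs, mem_filter, mem_product, mem_Icc, mem_Icc]
  omega

theorem forall_mem_labels {d : ℕ} {P : ℕ ⊕ ℕ ⊕ ℕ × ℕ → Prop} : (∀ x ∈ labels d, P x) ↔
    (∀ i ∈ Icc 1 d, P (.inl i)) ∧ (∀ i ∈ Icc 1 d, P (.inr (.inl i))) ∧
      ∀ p ∈ pairs d, P (.inr (.inr p)) := by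
  simp [labels]

section Gaudin

variable {d : ℕ} [NeZero d] {ζ : rootsOfUnity d ℂ} {c : Gd1 d 2 → ℂ}
  {α : Gd1 d 2 → Module.Dual ℂ (Fin 2 → ℂ)}

omit [NeZero d] in
theorem extHom_eq_zero_of_smul {m : ℕ} {r : MatRep (Gd1 d 2) m} {a : GauK (Gd1 d 2) c α}
    (h : ∀ v : extMod r, a • v = 0) : extHom r (GauK.incl (Gd1 d 2) c α a) = 0 := by
  refine Matrix.ext_iff_mulVec.2 fun v => ?_
  rw [Matrix.zero_mulVec]
  exact (gauK_smul_def r a v).symm.trans (h v)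

theorem gauK_faithful (hζ : IsPrimitiveRoot ζ d) (a : GauK (Gd1 d 2) c α)
    (h : ∀ i ∈ labels d, ∀ v : extMod (repOf d i).2, a • v = 0) : a = 0 := by
  obtain ⟨h1, h2, h3⟩ := forall_mem_labels.1 h
  apply GauK.incl_injective
  rw [map_zero]
  refine eq_zero_of_extHom_eq_zero hζ _ (fun i hi => extHom_eq_zero_of_smul (h1 i hi))
    (fun i hi => extHom_eq_zero_of_smul (h2 i hi)) fun i hi j hj hij =>
      extHom_eq_zero_of_smul (h3 (i, j) ?_)
  rw [pairs, mem_filter, mem_product]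
  exact ⟨⟨hi, hj⟩, hij⟩

variable (hζ : IsPrimitiveRoot ζ d) (hc : IsParameter (Gd1 d 2) c)
  (hα : IsRootChoice (Gd1 d 2) α) (hne : c (sElt d) ≠ 0)
include hζ hc hα hne

/-- A commutator acts by zero on every listed representation, and these are jointly faithful. -/
theorem gauK_mul_comm (a b : GauK (Gd1 d 2) c α) : a * b = b * a := by
  rw [← sub_eq_zero]
  have hgen := adjoin_genX_genZ (c := c) (α := α) hζ
  refine gauK_faithful hζ _ (forall_mem_labels.2 ⟨fun i hi v => ?_, fun i hi v => ?_,
    fun p hp v => ?_⟩)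
  · have h := isLine_etaRep hζ hc hα (mem_Icc.1 hi).1
    rw [sub_smul, mul_smul, mul_smul, sub_eq_zero]
    exact smul_comm_of_quadratic hgen h.smul_z h.smul_x_smul_x a b v
  · have h := isLine_etaRep' hζ hc hα (mem_Icc.1 hi).1
    rw [sub_smul, mul_smul, mul_smul, sub_eq_zero]
    exact smul_comm_of_quadratic hgen h.smul_z h.smul_x_smul_x a b v
  · obtain ⟨h1, h2, h3⟩ := mem_pairs.1 hp
    have h := isPlane_rhoRep hζ hc hα hne h1 h2 h3
    rw [sub_smul, mul_smul, mul_smul, sub_eq_zero]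
    exact smul_comm_of_quadratic hgen h.smul_z h.smul_x a b v

end Gaudin

/-! ### Comparison of eigenvalues -/

/-- The eigenvalue `k + ε c₀ (XY)^{d/2} / (X^d - Y^d)` of `genX`. -/
def halfVal (d : ℕ) (c₀ ε k : ℂ) : RatFun 2 :=
  algebraMap ℂ _ k + algebraMap ℂ _ (ε * c₀) *
    (ratX ^ (d / 2) * ratY ^ (d / 2) / (ratX ^ d - ratY ^ d))

section Eigenvalues

variable {d : ℕ} {c₀ a b a' b' ε ε' : ℂ}

/-- Eliminating `a - a'` between the two equalities leaves `(ε - ε') c₀ (X^d + Y^d) = 0`. -/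
theorem lineVal_eq_iff (hd : d ≠ 0) (hc₀ : c₀ ≠ 0) :
    (lineVal d c₀ ε a = lineVal d c₀ ε' a' ∧
      algebraMap ℂ (RatFun 2) (2 * a - ε * c₀) = algebraMap ℂ _ (2 * a' - ε' * c₀)) ↔
    ε = ε' ∧ a = a' := by
  constructor
  · rintro ⟨h1, h2⟩
    have hΔ := ratX_pow_sub_ne_zero hd
    have hS := ratX_pow_add_ne_zero hd
    have h3 := algebraMap_ratFun_injective 2 h2
    have h4 : algebraMap ℂ (RatFun 2) ((ε - ε') * c₀) * (ratX ^ d + ratY ^ d) = 0 := by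
      unfold lineVal at h1
      field_simp at h1
      simp only [map_mul, map_sub, map_ofNat] at h1 h2 ⊢
      linear_combination -2 * h1 + (ratX ^ d - ratY ^ d) * h2
    have h5 := (mul_eq_zero.1 h4).resolve_right hS
    rw [map_eq_zero, mul_eq_zero, sub_eq_zero] at h5
    have h6 := h5.resolve_right hc₀
    subst h6
    exact ⟨rfl, by linear_combination h3 / 2⟩
  · rintro ⟨rfl, rfl⟩
    exact ⟨rfl, rfl⟩

theorem ratX_pow_half_mul (hd : Even d) :
    (ratX ^ (d / 2) * ratY ^ (d / 2)) ^ 2 = ratX ^ d * ratY ^ d := by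
  rw [mul_pow, ← pow_mul, ← pow_mul, Nat.div_mul_cancel hd.two_dvd]

/-- Equality would give `ε (X^d + Y^d) + 2 ε' (XY)^{d/2} = 0`; multiplying by the conjugate
expression yields `(X^d - Y^d)² = 0`. -/
theorem lineVal_ne_halfVal (hd : d ≠ 0) (hd2 : Even d) (hc₀ : c₀ ≠ 0) (hε : ε ^ 2 = 1)
    (hε' : ε' ^ 2 = 1) : ¬ (lineVal d c₀ ε a = halfVal d c₀ ε' b ∧
      algebraMap ℂ (RatFun 2) (2 * a - ε * c₀) = algebraMap ℂ _ (b + b)) := by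
  rintro ⟨h1, h2⟩
  have hΔ := ratX_pow_sub_ne_zero hd
  have hR := ratX_pow_half_mul hd2
  have hc₀' : algebraMap ℂ (RatFun 2) c₀ ≠ 0 := by simpa using hc₀
  unfold lineVal halfVal at h1
  generalize ratX ^ (d / 2) * ratY ^ (d / 2) = R at h1 hR
  have e1 : (algebraMap ℂ (RatFun 2) ε) ^ 2 = 1 := by rw [← map_pow, hε, map_one]
  have e2 : (algebraMap ℂ (RatFun 2) ε') ^ 2 = 1 := by rw [← map_pow, hε', map_one]
  field_simp at h1
  simp only [map_mul, map_sub, map_add, map_ofNat] at h1 h2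
  have h3 : algebraMap ℂ (RatFun 2) c₀ * (algebraMap ℂ _ ε * (ratX ^ d + ratY ^ d) +
      2 * algebraMap ℂ _ ε' * R) = 0 := by
    linear_combination -2 * h1 + (ratX ^ d - ratY ^ d) * h2
  have h4 := (mul_eq_zero.1 h3).resolve_left hc₀'
  apply pow_ne_zero 2 hΔ
  linear_combination (algebraMap ℂ _ ε * (ratX ^ d + ratY ^ d) - 2 * algebraMap ℂ _ ε' * R) * h4 -
    (ratX ^ d + ratY ^ d) ^ 2 * e1 + 4 * R ^ 2 * e2 + 4 * hR

theorem halfVal_eq_iff (hd : d ≠ 0) (hc₀ : c₀ ≠ 0) :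
    (halfVal d c₀ ε a = halfVal d c₀ ε' a' ∧
      algebraMap ℂ (RatFun 2) (a + a) = algebraMap ℂ _ (a' + a')) ↔ ε = ε' ∧ a = a' := by
  constructor
  · rintro ⟨h1, h2⟩
    have hΔ := ratX_pow_sub_ne_zero hd
    have h3 := algebraMap_ratFun_injective 2 h2
    have h4 : a = a' := by linear_combination h3 / 2
    subst h4
    refine ⟨?_, rfl⟩
    unfold halfVal at h1
    have h5 := mul_right_cancel₀ (div_ne_zero (mul_ne_zero (pow_ne_zero _ ratX_ne_zero)
      (pow_ne_zero _ ratY_ne_zero)) hΔ) (add_left_cancel h1)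
    exact mul_right_cancel₀ hc₀ (algebraMap_ratFun_injective 2 h5)
  · rintro ⟨rfl, rfl⟩
    exact ⟨rfl, rfl⟩

/-- The `c₀` terms agree, so what is compared is the sum and the product, that is the unordered
pair. -/
theorem planeDet_eq_iff :
    (algebraMap ℂ (RatFun 2) (a + b) = algebraMap ℂ _ (a' + b') ∧
      planeDet d c₀ a b = planeDet d c₀ a' b') ↔ (a = a' ∧ b = b') ∨ (a = b' ∧ b = a') := by
  constructor
  · rintro ⟨h1, h2⟩
    have h1 := algebraMap_ratFun_injective 2 h1
    have h2 := algebraMap_ratFun_injective 2 (sub_left_injective h2)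
    have h3 : (a - a') * (a - b') = 0 := by linear_combination a * h1 - h2
    rcases mul_eq_zero.1 h3 with h | h
    · left
      have h := sub_eq_zero.1 h
      exact ⟨h, by linear_combination h1 - h⟩
    · right
      have h := sub_eq_zero.1 h
      exact ⟨h, by linear_combination h1 - h⟩
  · rintro (⟨rfl, rfl⟩ | ⟨rfl, rfl⟩)
    · exact ⟨rfl, rfl⟩
    · exact ⟨by rw [add_comm], by rw [planeDet, planeDet, mul_comm a]⟩

theorem lineVal_add :
    lineVal d c₀ 1 a + lineVal d c₀ (-1) b = algebraMap ℂ _ (a + b) := by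
  simp only [lineVal, map_add, map_mul, map_neg, map_one]
  ring

/-- For `a - b = c₀` the discriminant is `c₀² ((X^d + Y^d)/(X^d - Y^d))²`, and the two roots are the
eigenvalues of `x` on `ℒ_i` and `ℒ'_j`. -/
theorem lineVal_mul (hd : d ≠ 0) (h : a - b = c₀) :
    lineVal d c₀ 1 a * lineVal d c₀ (-1) b = planeDet d c₀ a b := by
  have hΔ := ratX_pow_sub_ne_zero hd
  have h' : algebraMap ℂ (RatFun 2) a = algebraMap ℂ _ b + algebraMap ℂ _ c₀ := by
    rw [← map_add, ← h]; congr 1; ring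
  simp only [lineVal, planeDet, map_mul, map_neg, map_one, map_pow, h']
  field_simp
  ring

theorem lineVal_ne (hd : d ≠ 0) (hc₀ : c₀ ≠ 0) (h : a - b = c₀) :
    lineVal d c₀ 1 a ≠ lineVal d c₀ (-1) b := by
  intro h0
  have h1 := (lineVal_eq_iff hd hc₀).1 ⟨h0, by congr 1; linear_combination 2 * h⟩
  norm_num at h1

theorem halfVal_add : halfVal d c₀ 1 a + halfVal d c₀ (-1) a = algebraMap ℂ _ (a + a) := by
  simp only [halfVal, map_add, map_mul, map_neg, map_one]
  ring

theorem halfVal_mul (hd2 : Even d) :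
    halfVal d c₀ 1 a * halfVal d c₀ (-1) a = planeDet d c₀ a a := by
  have hR := ratX_pow_half_mul hd2
  rw [planeDet, ← hR]
  unfold halfVal
  generalize ratX ^ d - ratY ^ d = D
  simp only [map_mul, map_neg, map_one, map_pow]
  ring

theorem halfVal_ne (hd : d ≠ 0) (hc₀ : c₀ ≠ 0) : halfVal d c₀ 1 a ≠ halfVal d c₀ (-1) a := by
  intro h0
  have h1 := (halfVal_eq_iff hd hc₀).1 ⟨h0, rfl⟩
  norm_num at h1

end Eigenvalues


/-! ### Simple modules over the Gaudin algebra and their multiplicities -/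

section Simples

variable {d : ℕ} [NeZero d] {ζ : rootsOfUnity d ℂ} {c : Gd1 d 2 → ℂ}
  {α : Gd1 d 2 → Module.Dual ℂ (Fin 2 → ℂ)}

/-- The three ways in which the discriminant is a square, and the case in which it is not. -/
theorem pair_cases (d : ℕ) (c₀ a b : ℂ) : a - b = c₀ ∨ b - a = c₀ ∨ (a = b ∧ Even d) ∨
    (c₀ ^ 2 ≠ (a - b) ^ 2 ∧ (a ≠ b ∨ Odd d)) := by
  by_cases h1 : c₀ ^ 2 = (a - b) ^ 2
  · rcases sq_eq_sq_iff_eq_or_eq_neg.1 h1 with h | h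
    · exact Or.inl h.symm
    · exact Or.inr (Or.inl (by rw [h]; ring))
  · by_cases h2 : a = b
    · rcases Nat.even_or_odd d with h3 | h3
      · exact Or.inr (Or.inr (Or.inl ⟨h2, h3⟩))
      · exact Or.inr (Or.inr (Or.inr ⟨h1, Or.inr h3⟩))
    · exact Or.inr (Or.inr (Or.inr ⟨h1, Or.inl h2⟩))

variable (hζ : IsPrimitiveRoot ζ d) (hc : IsParameter (Gd1 d 2) c)
  (hα : IsRootChoice (Gd1 d 2) α) (hne : c (sElt d) ≠ 0)
include hζ hc hα hne

theorem isLine_pmSub {i j : ℕ} (hi : 1 ≤ i) (hij : i < j) (hj : j ≤ d) (hd : Even d)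
    (hk : kSharp ζ c i = kSharp ζ c j) {ε : ℤ} (hε : ε = 1 ∨ ε = -1) :
    IsLine (genX c α) (genZ c α) (pmSub c α i j ε)
      (halfVal d (c (sElt d)) ε (kSharp ζ c i))
      (algebraMap ℂ _ (kSharp ζ c i + kSharp ζ c j)) := by
  have hpl := isPlane_rhoRep hζ hc hα hne hi hij hj
  have hX := extHom_rhoRep_genX hζ hc hα hi hij hj
  rw [← hk] at hX
  have hd2 : 2 * (d / 2) = d := Nat.two_mul_div_two_of_even hd
  -- The exponent `d/2 - (j - i)` may be negative, hence integer powers. These identities let the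
  -- matrix entries, of exponents `d - (j - i)` and `j - i`, meet the vector at exponent `d/2`.
  have hN1 : ((d - (j - i) : ℕ) : ℤ) = ((d / 2 : ℕ) : ℤ) + ((d : ℤ) / 2 - ((j : ℤ) - i)) := by
    omega
  have hN2 : ((j - i : ℕ) : ℤ) + ((d : ℤ) / 2 - ((j : ℤ) - i)) = ((d / 2 : ℕ) : ℤ) := by omega
  have hε2 : ((ε : ℤ) : RatFun 2) * (ε : RatFun 2) = 1 := by
    rcases hε with rfl | rfl <;> norm_num
  have key : ∀ Z : RatFun 2, Z ≠ 0 →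
      Z ^ (d - (j - i)) = Z ^ (d / 2) * Z ^ ((d : ℤ) / 2 - ((j : ℤ) - i)) ∧
      Z ^ (j - i) * Z ^ ((d : ℤ) / 2 - ((j : ℤ) - i)) = Z ^ (d / 2) := by
    intro Z hZ
    constructor
    · rw [← zpow_natCast Z (d - _), hN1, zpow_add₀ hZ, zpow_natCast]
    · rw [← zpow_natCast Z (j - i), ← zpow_add₀ hZ, hN2, zpow_natCast]
  obtain ⟨hX1, hX2⟩ := key ratX ratX_ne_zero
  obtain ⟨hY1, hY2⟩ := key ratY ratY_ne_zero
  refine isLine_span (adjoin_genX_genZ hζ) ?_ ?_ (hpl.smul_z _)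
  · intro h0
    exact zpow_ne_zero _ ratX_ne_zero (congrFun h0 0)
  · change _ • (show extMod (rhoRep d i j) from ![ratX ^ ((d : ℤ) / 2 - ((j : ℤ) - i)),
      -(ε : RatFun 2) * ratY ^ ((d : ℤ) / 2 - ((j : ℤ) - i))]) = _ •
      (show extMod (rhoRep d i j) from ![ratX ^ ((d : ℤ) / 2 - ((j : ℤ) - i)),
      -(ε : RatFun 2) * ratY ^ ((d : ℤ) / 2 - ((j : ℤ) - i))])
    refine (gauK_smul_def _ _ _).trans (Eq.trans ?_ (gauK_algebraMap_smul _ _ _).symm)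
    rw [hX]
    unfold halfVal
    rw [hX1, hY1, map_mul, map_intCast]
    generalize ratX ^ ((d : ℤ) / 2 - ((j : ℤ) - i)) = x at *
    generalize ratY ^ ((d : ℤ) / 2 - ((j : ℤ) - i)) = y at *
    generalize ratX ^ d - ratY ^ d = D
    have : ∀ κ c₀ : RatFun 2, (!![κ, -c₀ * (ratX ^ (d / 2) * x * ratY ^ (j - i) / D);
        -c₀ * (ratX ^ (j - i) * (ratY ^ (d / 2) * y) / D), κ]).mulVec ![x, -(ε : RatFun 2) * y] =
        (κ + (ε : RatFun 2) * c₀ * (ratX ^ (d / 2) * ratY ^ (d / 2) / D)) •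
          ![x, -(ε : RatFun 2) * y] := by
      intro κ c₀
      ext p
      fin_cases p
      · simp [Matrix.mulVec, dotProduct]
        linear_combination (ε : RatFun 2) * c₀ * ratX ^ (d / 2) * x / D * hY2
      · simp [Matrix.mulVec, dotProduct]
        linear_combination -c₀ * ratY ^ (d / 2) * y / D * hX2 +
          c₀ * ratY ^ (d / 2) * y / D * ratX ^ (d / 2) * hε2
    exact this _ _

/-- Some listed representation has annihilator contained in that of `L`. If it is a line, `L`
inherits its eigenvalues; if it is a plane with split quadratic, `L` takes one of the two roots;
otherwise the plane is simple and isomorphic to `L`. -/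
theorem simple_cases (L : Type) [AddCommGroup L] [Module (GauK (Gd1 d 2) c α) L]
    [IsSimpleModule (GauK (Gd1 d 2) c α) L] :
    (∃ i ∈ Icc 1 d, IsLine (genX c α) (genZ c α) L (lineVal d (c (sElt d)) 1 (kSharp ζ c i))
      (algebraMap ℂ _ (2 * kSharp ζ c i - 1 * c (sElt d)))) ∨
    (∃ i ∈ Icc 1 d, IsLine (genX c α) (genZ c α) L (lineVal d (c (sElt d)) (-1) (kSharp ζ c i))
      (algebraMap ℂ _ (2 * kSharp ζ c i - (-1) * c (sElt d)))) ∨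
    (∃ i ∈ Icc 1 d, ∃ j ∈ Icc 1 d, i < j ∧
      c (sElt d) ^ 2 ≠ (kSharp ζ c i - kSharp ζ c j) ^ 2 ∧
      (kSharp ζ c i ≠ kSharp ζ c j ∨ Odd d) ∧
      Nonempty (L ≃ₗ[GauK (Gd1 d 2) c α] extMod (rhoRep d i j))) ∨
    (∃ i ∈ Icc 1 d, ∃ j ∈ Icc 1 d, i < j ∧ kSharp ζ c i = kSharp ζ c j ∧ Even d ∧
      ∃ ε : ℤ, (ε = 1 ∨ ε = -1) ∧ IsLine (genX c α) (genZ c α) L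
        (halfVal d (c (sElt d)) ε (kSharp ζ c i))
        (algebraMap ℂ _ (kSharp ζ c i + kSharp ζ c j))) := by
  have hA := gauK_mul_comm (α := α) hζ hc hα hne
  obtain ⟨x, hx, hann⟩ := exists_ann_le_of_faithful hA (L := L) (labels d)
    (fun x => extMod (repOf d x).2) (gauK_faithful hζ)
  revert x
  refine forall_mem_labels.2 ⟨fun i hi hann => ?_, fun i hi hann => ?_, fun p hp hann => ?_⟩
  · exact Or.inl ⟨i, hi, (isLine_etaRep hζ hc hα (mem_Icc.1 hi).1).of_ann_le hann⟩
  · exact Or.inr (Or.inl ⟨i, hi, (isLine_etaRep' hζ hc hα (mem_Icc.1 hi).1).of_ann_le hann⟩)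
  · obtain ⟨i, j⟩ := p
    obtain ⟨h1, h2, h3⟩ := mem_pairs.1 hp
    have hi : i ∈ Icc 1 d := mem_Icc.2 ⟨h1, by simp at h2 h3; omega⟩
    have hj : j ∈ Icc 1 d := mem_Icc.2 ⟨by simp at h1 h2; omega, h3⟩
    have hpl := isPlane_rhoRep hζ hc hα hne h1 h2 h3
    have hd := NeZero.ne d
    rcases pair_cases d (c (sElt d)) (kSharp ζ c i) (kSharp ζ c j) with h | h | ⟨h, h'⟩ | ⟨h, h'⟩
    · rcases hpl.isLine_of_ann_le hA lineVal_add (lineVal_mul hd h) hann with hl | hl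
      · left
        refine ⟨i, hi, ?_⟩
        rw [show (2 * kSharp ζ c i - 1 * c (sElt d)) = kSharp ζ c i + kSharp ζ c j by
          linear_combination h]
        exact hl
      · right; left
        refine ⟨j, hj, ?_⟩
        rw [show (2 * kSharp ζ c j - (-1) * c (sElt d)) = kSharp ζ c i + kSharp ζ c j by
          linear_combination -h]
        exact hl
    -- The previous case with `i` and `j` exchanged, since trace and determinant are symmetric in
    -- the two parameters.
    · rcases hpl.isLine_of_ann_le hA (p₁ := lineVal d (c (sElt d)) 1 (kSharp ζ c j))
        (p₂ := lineVal d (c (sElt d)) (-1) (kSharp ζ c i)) (by rw [lineVal_add, add_comm])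
        (by rw [lineVal_mul hd h, planeDet, planeDet, mul_comm (kSharp ζ c j)]) hann with hl | hl
      · left
        refine ⟨j, hj, ?_⟩
        rw [show (2 * kSharp ζ c j - 1 * c (sElt d)) = kSharp ζ c i + kSharp ζ c j by
          linear_combination h]
        exact hl
      · right; left
        refine ⟨i, hi, ?_⟩
        rw [show (2 * kSharp ζ c i - (-1) * c (sElt d)) = kSharp ζ c i + kSharp ζ c j by
          linear_combination -h]
        exact hl
    · right; right; right
      refine ⟨i, hi, j, hj, h2, h, h', ?_⟩
      rcases hpl.isLine_of_ann_le hA (p₁ := halfVal d (c (sElt d)) 1 (kSharp ζ c i))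
        (p₂ := halfVal d (c (sElt d)) (-1) (kSharp ζ c i)) (by rw [halfVal_add, h])
        (by rw [halfVal_mul h', h]) hann with hl | hl
      · exact ⟨1, Or.inl rfl, by simpa using hl⟩
      · exact ⟨-1, Or.inr rfl, by simpa using hl⟩
    · right; right; left
      exact ⟨i, hi, j, hj, h2, h, h', hpl.nonempty_linearEquiv_of_ann_le hA
        (quadratic_ne_zero hd hne h h') hann⟩

end Simples

open Classical in
/-- The multiplicities of the module with eigenvalue `k₀ - ε c₀ X^d / (X^d - Y^d)`. -/
def multLine (k : ℕ → ℂ) (c₀ ε k₀ : ℂ) : ℕ ⊕ ℕ ⊕ ℕ × ℕ → ℕ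
  | .inl i => if 1 = ε ∧ k i = k₀ then 1 else 0
  | .inr (.inl i) => if -1 = ε ∧ k i = k₀ then 1 else 0
  | .inr (.inr p) => if (k p.1 = k₀ ∧ k p.1 - k p.2 = ε * c₀) ∨
      (k p.2 = k₀ ∧ k p.2 - k p.1 = ε * c₀) then 1 else 0

open Classical in
/-- The multiplicities of a two-dimensional simple module or, when `a = b` and `d` is even, of the
two modules in which it splits. -/
def multPlane (k : ℕ → ℂ) (a b : ℂ) : ℕ ⊕ ℕ ⊕ ℕ × ℕ → ℕ
  | .inl _ => 0
  | .inr (.inl _) => 0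
  | .inr (.inr p) => if (k p.1 = a ∧ k p.2 = b) ∨ (k p.1 = b ∧ k p.2 = a) then 1 else 0

theorem ite_eq_ite_of_iff {p q : Prop} {_ : Decidable p} {_ : Decidable q} (h : p ↔ q) :
    (if p then 1 else 0 : ℕ) = if q then 1 else 0 := if_congr h rfl rfl

/-! ### Multiplicities of each kind of simple module in the listed representations -/

section Multiplicities

variable {d : ℕ} [NeZero d] {ζ : rootsOfUnity d ℂ} {c : Gd1 d 2 → ℂ}
  {α : Gd1 d 2 → Module.Dual ℂ (Fin 2 → ℂ)}
variable (hζ : IsPrimitiveRoot ζ d) (hc : IsParameter (Gd1 d 2) c)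
  (hα : IsRootChoice (Gd1 d 2) α) (hne : c (sElt d) ≠ 0)
variable {M L : Type} [AddCommGroup M] [Module (GauK (Gd1 d 2) c α) M] [AddCommGroup L]
  [Module (GauK (Gd1 d 2) c α) L]
include hζ hc hα hne

/-- The plane is the sum of a line of sign `1` at `a` and one of sign `-1` at `b`, so only one
summand can match `L`. Since `c₀ ≠ 0`, the sign also selects one branch of the disjunction.
Parameters `a`, `b` replace the indices so that both orders of the pair are covered. -/
theorem compMult_rhoRep_line_line {ε k₀ : ℂ} (hε : ε = 1 ∨ ε = -1)
    (hL : IsLine (genX c α) (genZ c α) L (lineVal d (c (sElt d)) ε k₀)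
      (algebraMap ℂ _ (2 * k₀ - ε * c (sElt d)))) {a b : ℂ} (hab : a - b = c (sElt d))
    {r : MatRep (Gd1 d 2) 2} (e : M ≃ₗ[GauK (Gd1 d 2) c α] extMod r)
    (hpl : IsPlane (genX c α) (genZ c α) (extMod r) (algebraMap ℂ _ (a + b))
      (planeDet d (c (sElt d)) a b)) [Decidable ((a = k₀ ∧ a - b = ε * c (sElt d)) ∨
      (b = k₀ ∧ b - a = ε * c (sElt d)))] :
    compMult (GauK (Gd1 d 2) c α) M L = if (a = k₀ ∧ a - b = ε * c (sElt d)) ∨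
      (b = k₀ ∧ b - a = ε * c (sElt d)) then 1 else 0 := by
  have hd := NeZero.ne d
  have hA := gauK_mul_comm (α := α) hζ hc hα hne
  have hgen := adjoin_genX_genZ (c := c) (α := α) hζ
  have h2 : (2 : ℂ) ≠ 0 := two_ne_zero
  rw [compMult_split_line hA hgen e hpl (lineVal_ne hd hne hab) lineVal_add (lineVal_mul hd hab)
    hL]
  have e1 : algebraMap ℂ (RatFun 2) (a + b) = algebraMap ℂ _ (2 * a - 1 * c (sElt d)) := by
    congr 1; linear_combination -hab
  have e2 : algebraMap ℂ (RatFun 2) (a + b) = algebraMap ℂ _ (2 * b - (-1) * c (sElt d)) := by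
    congr 1; linear_combination hab
  conv_lhs =>
    congr
    · simp only [e1, lineVal_eq_iff hd hne]
    · simp only [e2, lineVal_eq_iff hd hne]
  rcases hε with rfl | rfl
  · have h3 : ¬ b - a = 1 * c (sElt d) := fun h => hne (by linear_combination (hab + h) / -2)
    have h4 : ¬ ((-1 : ℂ) = 1 ∧ b = k₀) := fun h => by norm_num at h
    rw [if_neg h4, add_zero]
    exact if_congr ⟨fun h => Or.inl ⟨h.2, by rw [one_mul, hab]⟩,
      fun h => ⟨rfl, h.elim And.left fun h => absurd h.2 h3⟩⟩ rfl rfl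
  · have h3 : ¬ a - b = (-1) * c (sElt d) := fun h => hne (by linear_combination (h - hab) / 2)
    have h4 : ¬ ((1 : ℂ) = -1 ∧ a = k₀) := fun h => by norm_num at h
    rw [if_neg h4, zero_add]
    exact if_congr ⟨fun h => Or.inr ⟨h.2, by linear_combination -hab⟩,
      fun h => ⟨rfl, h.elim (fun h => absurd h.2 h3) And.left⟩⟩ rfl rfl

/-- The multiplicities of the one-dimensional modules `ℒ_i` (for `ε = 1`) and `ℒ'_i` (for
`ε = -1`). -/
theorem compMult_eq_multLine {ε k₀ : ℂ} (hε : ε = 1 ∨ ε = -1)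
    (hL : IsLine (genX c α) (genZ c α) L (lineVal d (c (sElt d)) ε k₀)
      (algebraMap ℂ _ (2 * k₀ - ε * c (sElt d)))) :
    ∀ x ∈ labels d, ∀ (M : Type) [AddCommGroup M] [Module (GauK (Gd1 d 2) c α) M],
      (M ≃ₗ[GauK (Gd1 d 2) c α] extMod (repOf d x).2) →
      compMult (GauK (Gd1 d 2) c α) M L = multLine (kSharp ζ c) (c (sElt d)) ε k₀ x := by
  have hd := NeZero.ne d
  have hA := gauK_mul_comm (α := α) hζ hc hα hne
  have hgen := adjoin_genX_genZ (c := c) (α := α) hζ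
  refine forall_mem_labels.2 ⟨fun i hi M _ _ e => ?_, fun i hi M _ _ e => ?_,
    fun p hp M _ _ e => ?_⟩
  · rw [compMult_line_line hA hgen e (isLine_etaRep hζ hc hα (mem_Icc.1 hi).1) hL]
    exact ite_eq_ite_of_iff (lineVal_eq_iff hd hne)
  · rw [compMult_line_line hA hgen e (isLine_etaRep' hζ hc hα (mem_Icc.1 hi).1) hL]
    exact ite_eq_ite_of_iff (lineVal_eq_iff hd hne)
  · obtain ⟨h1, h2, h3⟩ := mem_pairs.1 hp
    have hpl := isPlane_rhoRep hζ hc hα hne h1 h2 h3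
    rw [multLine]
    rcases pair_cases d (c (sElt d)) (kSharp ζ c p.1) (kSharp ζ c p.2) with h | h | ⟨h, h'⟩ | ⟨h, h'⟩
    · exact compMult_rhoRep_line_line hζ hc hα hne hε hL h e hpl
    · rw [add_comm, planeDet, mul_comm (kSharp ζ c p.1)] at hpl
      classical
      rw [compMult_rhoRep_line_line hζ hc hα hne hε hL h e hpl]
      exact ite_eq_ite_of_iff or_comm
    · rw [← h] at hpl
      rw [compMult_split_line hA hgen e hpl (halfVal_ne hd hne) halfVal_add (halfVal_mul h') hL]
      have hε2 : ε ^ 2 = 1 := by rcases hε with rfl | rfl <;> norm_num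
      rw [if_neg, if_neg, if_neg]
      · rw [← h]
        rintro (h | h)
        all_goals
          have h5 := h.2
          rw [sub_self] at h5
          rcases mul_eq_zero.1 h5.symm with h6 | h6
          · rw [h6] at hε2; norm_num at hε2
          · exact hne h6
      · exact fun h => lineVal_ne_halfVal hd h' hne hε2 (by norm_num) ⟨h.1.symm, h.2.symm⟩
      · exact fun h => lineVal_ne_halfVal hd h' hne hε2 (by norm_num) ⟨h.1.symm, h.2.symm⟩
    · rw [compMult_plane_line e hpl (quadratic_ne_zero hd hne h h') hL, if_neg]
      have hε2 : ε ^ 2 = 1 := by rcases hε with rfl | rfl <;> norm_num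
      rintro (h5 | h5)
      · exact h (by rw [h5.2, mul_pow, hε2, one_mul])
      · exact h (by rw [← neg_sub, neg_sq, h5.2, mul_pow, hε2, one_mul])

/-- The multiplicities of the two-dimensional simple modules. -/
theorem compMult_eq_multPlane {a b : ℂ} (hab : c (sElt d) ^ 2 ≠ (a - b) ^ 2)
    (hab' : a ≠ b ∨ Odd d) [IsSimpleModule (GauK (Gd1 d 2) c α) L]
    (hL : IsPlane (genX c α) (genZ c α) L (algebraMap ℂ _ (a + b))
      (planeDet d (c (sElt d)) a b)) :
    ∀ x ∈ labels d, ∀ (M : Type) [AddCommGroup M] [Module (GauK (Gd1 d 2) c α) M],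
      (M ≃ₗ[GauK (Gd1 d 2) c α] extMod (repOf d x).2) →
      compMult (GauK (Gd1 d 2) c α) M L = multPlane (kSharp ζ c) a b x := by
  have hd := NeZero.ne d
  have hA := gauK_mul_comm (α := α) hζ hc hα hne
  have hgen := adjoin_genX_genZ (c := c) (α := α) hζ
  have hsq : (b - a) ^ 2 = (a - b) ^ 2 := by ring
  refine forall_mem_labels.2 ⟨fun i hi M _ _ e => ?_, fun i hi M _ _ e => ?_,
    fun p hp M _ _ e => ?_⟩
  · exact compMult_line_plane e (isLine_etaRep hζ hc hα (mem_Icc.1 hi).1) hL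
  · exact compMult_line_plane e (isLine_etaRep' hζ hc hα (mem_Icc.1 hi).1) hL
  · obtain ⟨h1, h2, h3⟩ := mem_pairs.1 hp
    have hpl := isPlane_rhoRep hζ hc hα hne h1 h2 h3
    rw [multPlane]
    rcases pair_cases d (c (sElt d)) (kSharp ζ c p.1) (kSharp ζ c p.2) with h | h | ⟨h, h'⟩ | ⟨h, h'⟩
    · rw [compMult_split_plane hgen e hpl (lineVal_ne hd hne h) lineVal_add (lineVal_mul hd h) hL,
        if_neg]
      rintro (⟨h4, h5⟩ | ⟨h4, h5⟩) <;> rw [h4, h5] at h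
      · exact hab (by rw [h])
      · exact hab (by rw [← hsq, h])
    · rw [add_comm, planeDet, mul_comm (kSharp ζ c p.1)] at hpl
      rw [compMult_split_plane hgen e hpl (lineVal_ne hd hne h) lineVal_add (lineVal_mul hd h) hL,
        if_neg]
      rintro (⟨h4, h5⟩ | ⟨h4, h5⟩) <;> rw [h4, h5] at h
      · exact hab (by rw [← hsq, h])
      · exact hab (by rw [h])
    · rw [if_neg]
      · rw [← h] at hpl
        exact compMult_split_plane hgen e hpl (halfVal_ne hd hne) halfVal_add (halfVal_mul h') hL
      · rintro (⟨h4, h5⟩ | ⟨h4, h5⟩) <;> rw [h4, h5] at h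
        · exact hab'.elim (fun h6 => h6 h) fun h6 => Nat.not_even_iff_odd.2 h6 h'
        · exact hab'.elim (fun h6 => h6 h.symm) fun h6 => Nat.not_even_iff_odd.2 h6 h'
    · rw [compMult_plane_plane hA hgen e hpl (quadratic_ne_zero hd hne h h') hL]
      exact (ite_eq_ite_of_iff planeDet_eq_iff)

/-- The multiplicities of the modules `ℒ⁺_{i,j}` and `ℒ⁻_{i,j}`. -/
theorem compMult_eq_multPlane_of_even (hd2 : Even d) {ε a : ℂ} (hε : ε = 1 ∨ ε = -1)
    (hL : IsLine (genX c α) (genZ c α) L (halfVal d (c (sElt d)) ε a)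
      (algebraMap ℂ _ (a + a))) :
    ∀ x ∈ labels d, ∀ (M : Type) [AddCommGroup M] [Module (GauK (Gd1 d 2) c α) M],
      (M ≃ₗ[GauK (Gd1 d 2) c α] extMod (repOf d x).2) →
      compMult (GauK (Gd1 d 2) c α) M L = multPlane (kSharp ζ c) a a x := by
  have hd := NeZero.ne d
  have hA := gauK_mul_comm (α := α) hζ hc hα hne
  have hgen := adjoin_genX_genZ (c := c) (α := α) hζ
  have hε2 : ε ^ 2 = 1 := by rcases hε with rfl | rfl <;> norm_num
  refine forall_mem_labels.2 ⟨fun i hi M _ _ e => ?_, fun i hi M _ _ e => ?_,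
    fun p hp M _ _ e => ?_⟩
  · rw [compMult_line_line hA hgen e (isLine_etaRep hζ hc hα (mem_Icc.1 hi).1) hL]
    exact if_neg (lineVal_ne_halfVal hd hd2 hne (by norm_num) hε2)
  · rw [compMult_line_line hA hgen e (isLine_etaRep' hζ hc hα (mem_Icc.1 hi).1) hL]
    exact if_neg (lineVal_ne_halfVal hd hd2 hne (by norm_num) hε2)
  · obtain ⟨h1, h2, h3⟩ := mem_pairs.1 hp
    have hpl := isPlane_rhoRep hζ hc hα hne h1 h2 h3
    have key : ∀ {b b' : ℂ}, b - b' = c (sElt d) → IsPlane (genX c α) (genZ c α)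
        (extMod (repOf d (.inr (.inr p))).2) (algebraMap ℂ _ (b + b'))
        (planeDet d (c (sElt d)) b b') → compMult (GauK (Gd1 d 2) c α) M L = 0 := by
      intro b b' h hpl
      have e1 : algebraMap ℂ (RatFun 2) (b + b') = algebraMap ℂ _ (2 * b - 1 * c (sElt d)) := by
        congr 1; linear_combination -h
      have e2 : algebraMap ℂ (RatFun 2) (b + b') =
          algebraMap ℂ _ (2 * b' - (-1) * c (sElt d)) := by
        congr 1; linear_combination h
      rw [compMult_split_line hA hgen e hpl (lineVal_ne hd hne h) lineVal_add (lineVal_mul hd h) hL,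
        if_neg, if_neg]
      · rw [e2]
        exact lineVal_ne_halfVal hd hd2 hne (by norm_num) hε2
      · rw [e1]
        exact lineVal_ne_halfVal hd hd2 hne (by norm_num) hε2
    rw [multPlane]
    rcases pair_cases d (c (sElt d)) (kSharp ζ c p.1) (kSharp ζ c p.2) with h | h | ⟨h, -⟩ | ⟨h, h'⟩
    · rw [key h hpl, if_neg]
      rintro (⟨h4, h5⟩ | ⟨h4, h5⟩) <;> rw [h4, h5, sub_self] at h <;> exact hne h.symm
    · rw [add_comm, planeDet, mul_comm (kSharp ζ c p.1)] at hpl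
      rw [key h hpl, if_neg]
      rintro (⟨h4, h5⟩ | ⟨h4, h5⟩) <;> rw [h4, h5, sub_self] at h <;> exact hne h.symm
    · rw [← h] at hpl
      rw [compMult_split_line hA hgen e hpl (halfVal_ne hd hne) halfVal_add (halfVal_mul hd2) hL]
      simp only [halfVal_eq_iff hd hne, ← h]
      rcases hε with rfl | rfl
      · have h4 : ¬ (-1 : ℂ) = 1 := by norm_num
        simp [h4]
      · have h4 : ¬ (1 : ℂ) = -1 := by norm_num
        simp [h4]
    · rw [compMult_plane_line e hpl (quadratic_ne_zero hd hne h h') hL, if_neg]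
      have h6 : kSharp ζ c p.1 ≠ kSharp ζ c p.2 :=
        h'.resolve_right fun h7 => Nat.not_even_iff_odd.2 h7 hd2
      rintro (⟨h4, h5⟩ | ⟨h4, h5⟩) <;> exact h6 (h4.trans h5.symm)

end Multiplicities


/-! ### The irreducible representations of `G(d,1,2)` -/

section MatRep

variable {G : Type} [Group G] {m m' : ℕ} {r : MatRep G m} {r' : MatRep G m'}

theorem over_apply (r : MatRep G m) (g : G) (v : Fin m → ℂ) :
    r.over ℂ g v = (r g).mulVec v := rfl

/-- Irreducibility in terms of invariant subspaces. -/
theorem isIrreducible_of_forall_submodule [NeZero m]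
    (h : ∀ p : Submodule ℂ (Fin m → ℂ), (∀ g, ∀ v ∈ p, (r g).mulVec v ∈ p) → p ≠ ⊥ → p = ⊤) :
    (r.over ℂ).IsIrreducible where
  exists_pair_ne := ⟨⊥, ⊤, fun h => bot_ne_top (congrArg Subrepresentation.toSubmodule h)⟩
  eq_bot_or_eq_top p := by
    by_cases hp : p.toSubmodule = ⊥
    · exact Or.inl (Subrepresentation.ext hp)
    · exact Or.inr (Subrepresentation.ext
        (h p.toSubmodule (fun g v hv => p.apply_mem_toSubmodule g hv) hp))

theorem isIrreducible_one (r : MatRep G 1) : (r.over ℂ).IsIrreducible := by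
  refine isIrreducible_of_forall_submodule fun p _ hp => ?_
  obtain ⟨v, hv, hv0⟩ := p.exists_mem_ne_zero_of_ne_bot hp
  have hv1 : v 0 ≠ 0 := fun h => hv0 (by ext i; fin_cases i; exact h)
  refine eq_top_iff.2 fun w _ => ?_
  have : w = (w 0 / v 0) • v := by
    ext i; fin_cases i
    simp [hv1]
  rw [this]
  exact p.smul_mem _ hv

/-- Schur's lemma for matrix representations. -/
theorem exists_inverse_of_intertwining (hr : (r.over ℂ).IsIrreducible)
    (hr' : (r'.over ℂ).IsIrreducible) (P : Matrix (Fin m') (Fin m) ℂ) (hP : P ≠ 0)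
    (h : ∀ g, P * r g = r' g * P) :
    ∃ Q : Matrix (Fin m) (Fin m') ℂ, P * Q = 1 ∧ Q * P = 1 := by
  let f : Representation.IntertwiningMap (r.over ℂ) (r'.over ℂ) :=
    LinearMap.intertwiningMap_of_isIntertwiningMap _ _ P.mulVecLin fun g v => by
      rw [over_apply, over_apply, Matrix.mulVecLin_apply, Matrix.mulVecLin_apply,
        Matrix.mulVec_mulVec, Matrix.mulVec_mulVec, h]
  have hf : Function.Bijective P.mulVecLin := by
    rcases Representation.IsIrreducible.bijective_or_eq_zero f with hf | hf
    · exact hf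
    · refine absurd ?_ hP
      refine Matrix.ext_iff_mulVec.2 fun v => ?_
      rw [Matrix.zero_mulVec]
      exact DFunLike.congr_fun hf v
  let e := LinearEquiv.ofBijective _ hf
  refine ⟨LinearMap.toMatrix' (e.symm : (Fin m' → ℂ) →ₗ[ℂ] (Fin m → ℂ)), ?_, ?_⟩
  · refine Matrix.ext_iff_mulVec.2 fun v => ?_
    rw [← Matrix.mulVec_mulVec, LinearMap.toMatrix'_mulVec, Matrix.one_mulVec]
    exact e.apply_symm_apply v
  · refine Matrix.ext_iff_mulVec.2 fun v => ?_
    rw [← Matrix.mulVec_mulVec, LinearMap.toMatrix'_mulVec, Matrix.one_mulVec]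
    exact e.symm_apply_apply v

/-- Equivalence of matrix representations. -/
def MatRep.Equivalent (r : MatRep G m) (r' : MatRep G m') : Prop :=
  ∃ (P : Matrix (Fin m') (Fin m) ℂ) (Q : Matrix (Fin m) (Fin m') ℂ),
    P * Q = 1 ∧ Q * P = 1 ∧ ∀ g, P * r g = r' g * P

theorem MatRep.Equivalent.symm (h : r.Equivalent r') : r'.Equivalent r := by
  obtain ⟨P, Q, h1, h2, h3⟩ := h
  refine ⟨Q, P, h2, h1, fun g => ?_⟩
  calc Q * r' g = Q * r' g * (P * Q) := by rw [h1, Matrix.mul_one]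
    _ = Q * (r' g * P) * Q := by simp only [Matrix.mul_assoc]
    _ = Q * P * r g * Q := by rw [← h3]; simp only [Matrix.mul_assoc]
    _ = r g * Q := by rw [h2, Matrix.one_mul]

theorem MatRep.Equivalent.char_eq (h : r.Equivalent r') : r.char = r'.char := by
  obtain ⟨P, Q, h1, h2, h3⟩ := h
  funext g
  calc (r g).trace = (Q * P * r g).trace := by rw [h2, Matrix.one_mul]
    _ = (Q * (r' g * P)).trace := by rw [← h3, Matrix.mul_assoc]
    _ = (r' g * P * Q).trace := Matrix.trace_mul_comm _ _
    _ = (r' g).trace := by rw [Matrix.mul_assoc, h1, Matrix.mul_one]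

theorem MatRep.Equivalent.nonempty_linearEquiv {n : ℕ} {W : Subgroup (GL (Fin n) ℂ)}
    {r : MatRep W m} {r' : MatRep W m'} (h : r.Equivalent r') (c : W → ℂ)
    (α : W → Module.Dual ℂ (Fin n → ℂ)) :
    Nonempty (extMod r ≃ₗ[GauK W c α] extMod r') := by
  obtain ⟨P, Q, h1, h2, h3⟩ := h
  exact ⟨extModEquiv P Q h1 h2 h3⟩

end MatRep

/-! ### Irreducibility, completeness and irredundancy of the list of representations -/

section Irreducible

theorem mulVec_fin_two (a b a' b' x y : ℂ) :
    !![a, b; a', b'].mulVec ![x, y] = ![a * x + b * y, a' * x + b' * y] := by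
  ext p
  fin_cases p <;> simp [Matrix.mulVec, dotProduct, Fin.sum_univ_two]

variable {d : ℕ} [NeZero d] {ζ : rootsOfUnity d ℂ} (hζ : IsPrimitiveRoot ζ d)
include hζ

omit [NeZero d] in
-- The two eigenvalues of `t` differ, so a combination of `t` and `1` projects onto the first axis,
-- and `s` exchanges the axes.
theorem isIrreducible_rhoRep {i j : ℕ} (hi : 1 ≤ i) (hij : i < j) (hj : j ≤ d) :
    ((rhoRep d i j).over ℂ).IsIrreducible := by
  have hz := isPrimitiveRoot_val hζ
  have hne : ((ζ : ℂˣ) : ℂ) ^ (i - 1) - ((ζ : ℂˣ) : ℂ) ^ (j - 1) ≠ 0 := by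
    intro h
    have := hz.pow_inj (by omega) (by omega) (sub_eq_zero.1 h)
    omega
  refine isIrreducible_of_forall_submodule fun p hp h0 => ?_
  have hs : ∀ a b : ℂ, ![a, b] ∈ p → ![b, a] ∈ p := by
    intro a b hab
    have := hp (sElt d) _ hab
    rw [rhoRep_s, mulVec_fin_two] at this
    simpa using this
  have ht : ∀ a b : ℂ, ![a, b] ∈ p → ![a, 0] ∈ p := by
    intro a b hab
    have h1 := hp (tElt ζ) _ hab
    rw [rhoRep_t, mulVec_fin_two] at h1
    have h2 := p.smul_mem ((((ζ : ℂˣ) : ℂ) ^ (i - 1) - ((ζ : ℂˣ) : ℂ) ^ (j - 1))⁻¹)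
      (p.sub_mem h1 (p.smul_mem (((ζ : ℂˣ) : ℂ) ^ (j - 1)) hab))
    convert h2 using 1
    ext q
    fin_cases q
    · simp
      field_simp
    · simp
  have key : ∀ a b : ℂ, a ≠ 0 → ![a, b] ∈ p → p = ⊤ := by
    intro a b ha hab
    have h1 := p.smul_mem a⁻¹ (ht a b hab)
    have h2 : ![1, 0] ∈ p := by simpa [ha] using h1
    have h3 := hs _ _ h2
    refine eq_top_iff.2 fun w _ => ?_
    have : w = w 0 • ![1, 0] + w 1 • ![0, 1] := by
      ext q; fin_cases q <;> simp
    rw [this]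
    exact p.add_mem (p.smul_mem _ h2) (p.smul_mem _ h3)
  obtain ⟨v, hv, hv0⟩ := p.exists_mem_ne_zero_of_ne_bot h0
  have hv' : v = ![v 0, v 1] := by ext q; fin_cases q <;> rfl
  rw [hv'] at hv
  by_cases ha : v 0 = 0
  · refine key _ _ (fun hb => hv0 ?_) (hs _ _ hv)
    ext q; fin_cases q
    · exact ha
    · exact hb
  · exact key _ _ ha hv

omit [NeZero d] in
theorem isIrreducible_repOf : ∀ x ∈ labels d, ((repOf d x).2.over ℂ).IsIrreducible :=
  forall_mem_labels.2 ⟨fun _ _ => isIrreducible_one _, fun _ _ => isIrreducible_one _,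
    fun _ hp => isIrreducible_rhoRep hζ (mem_pairs.1 hp).1 (mem_pairs.1 hp).2.1
      (mem_pairs.1 hp).2.2⟩

theorem intertwining_of_generators {m m' : ℕ} {r : MatRep (Gd1 d 2) m} {r' : MatRep (Gd1 d 2) m'}
    {P : Matrix (Fin m') (Fin m) ℂ} (hs : P * r (sElt d) = r' (sElt d) * P)
    (ht : P * r (tElt ζ) = r' (tElt ζ) * P) (g : Gd1 d 2) : P * r g = r' g * P := by
  have hmul : ∀ g h, P * r g = r' g * P → P * r h = r' h * P →
      P * r (g * h) = r' (g * h) * P := by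
    intro g h hg hh
    rw [map_mul, map_mul, ← Matrix.mul_assoc, hg, Matrix.mul_assoc, hh, Matrix.mul_assoc]
  have hpow : ∀ n, P * r (tElt ζ ^ n) = r' (tElt ζ ^ n) * P := by
    intro n
    induction n with
    | zero => simp
    | succ n ih => rw [pow_succ]; exact hmul _ _ ih ht
  obtain ⟨m, -, n, -, rfl | rfl⟩ := exists_eq_diagElt hζ g
  · exact hmul _ _ (hpow m) (hmul _ _ (hmul _ _ hs (hpow n)) hs)
  · exact hmul _ _ (hmul _ _ (hpow m) (hmul _ _ (hmul _ _ hs (hpow n)) hs)) hs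

/-- The commuting operators `t` and `s t s` have a common eigenvector `v`, and `v` being an
eigenvector of `s t s` means that `s v` is one of `t`. Eigenvalues are powers of `ζ` because `t^d =
1`. -/
theorem exists_common_eigenvector {m : ℕ} [NeZero m] (r : MatRep (Gd1 d 2) m) :
    ∃ v ≠ 0, ∃ a < d, ∃ b < d, (r (tElt ζ)).mulVec v = (((ζ : ℂˣ) : ℂ) ^ a) • v ∧
      (r (tElt ζ)).mulVec ((r (sElt d)).mulVec v) =
        (((ζ : ℂˣ) : ℂ) ^ b) • (r (sElt d)).mulVec v := by
  have hz := isPrimitiveRoot_val hζ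
  have htd : tElt ζ ^ d = 1 := by
    apply toMat_injective
    rw [toMat_tElt_pow, hz.pow_eq_one, toMat_one, Matrix.one_fin_two]
  have hroot : ∀ (μ : ℂ) (v : Fin m → ℂ), v ≠ 0 → (r (tElt ζ)).mulVec v = μ • v →
      ∃ a < d, ((ζ : ℂˣ) : ℂ) ^ a = μ := by
    intro μ v hv h
    refine hz.eq_pow_of_pow_eq_one ?_
    have hpow : ∀ n, (r (tElt ζ ^ n)).mulVec v = μ ^ n • v := by
      intro n
      induction n with
      | zero => simp
      | succ n ih =>
        rw [pow_succ, map_mul, ← Matrix.mulVec_mulVec, h, Matrix.mulVec_smul, ih, smul_smul,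
          pow_succ, mul_comm]
    have h1 := hpow d
    rw [htd, map_one, Matrix.one_mulVec] at h1
    have h2 : (μ ^ d - 1) • v = 0 := by rw [sub_smul, ← h1, one_smul, sub_self]
    exact sub_eq_zero.1 ((smul_eq_zero.1 h2).resolve_right hv)
  have hss : ∀ v, (r (sElt d)).mulVec ((r (sElt d)).mulVec v) = v := by
    intro v
    rw [Matrix.mulVec_mulVec, ← map_mul, sElt_mul_sElt, map_one, Matrix.one_mulVec]
  let T : Module.End ℂ (Fin m → ℂ) := (r (tElt ζ)).mulVecLin
  let T' : Module.End ℂ (Fin m → ℂ) := (r (tElt' ζ 1)).mulVecLin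
  have hcomm : Commute T T' := by
    have h1 : tElt ζ * tElt' ζ 1 = tElt' ζ 1 * tElt ζ := by
      apply toMat_injective
      rw [toMat_mul, toMat_mul, toMat_tElt', toMat_tElt]
      ext p q
      fin_cases p <;> fin_cases q <;> simp
    change (r (tElt ζ)).mulVecLin * (r (tElt' ζ 1)).mulVecLin =
      (r (tElt' ζ 1)).mulVecLin * (r (tElt ζ)).mulVecLin
    rw [Module.End.mul_eq_comp, Module.End.mul_eq_comp, ← Matrix.mulVecLin_mul,
      ← Matrix.mulVecLin_mul, ← map_mul, ← map_mul, h1]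
  obtain ⟨μ, hμ⟩ := Module.End.exists_eigenvalue T
  have hmaps : Set.MapsTo T' (T.eigenspace μ) (T.eigenspace μ) :=
    Module.End.mapsTo_genEigenspace_of_comm hcomm μ 1
  have : Nontrivial (T.eigenspace μ) := Submodule.nontrivial_iff_ne_bot.2 hμ
  obtain ⟨ν, hν⟩ := Module.End.exists_eigenvalue (T'.restrict hmaps)
  obtain ⟨v, hv⟩ := hν.exists_hasEigenvector
  have hv0 : (v : Fin m → ℂ) ≠ 0 := fun h => hv.2 (Subtype.ext h)
  have h1 : (r (tElt ζ)).mulVec v = μ • (v : Fin m → ℂ) := Module.End.mem_eigenspace_iff.1 v.2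
  have h2 : (r (tElt' ζ 1)).mulVec v = ν • (v : Fin m → ℂ) :=
    congrArg Subtype.val (Module.End.mem_eigenspace_iff.1 hv.1)
  have h3 : (r (tElt ζ)).mulVec ((r (sElt d)).mulVec v) =
      ν • (r (sElt d)).mulVec (v : Fin m → ℂ) := by
    have h4 := congrArg (r (sElt d)).mulVec h2
    rw [tElt', pow_one, map_mul, map_mul, ← Matrix.mulVec_mulVec, ← Matrix.mulVec_mulVec, hss,
      Matrix.mulVec_smul] at h4
    exact h4
  obtain ⟨a, ha, rfl⟩ := hroot μ v hv0 h1
  obtain ⟨b, hb, rfl⟩ := hroot ν _ (fun h => hv0 (by rw [← hss v, h, Matrix.mulVec_zero])) h3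
  exact ⟨v, hv0, a, ha, b, hb, h1, h3⟩

/-- With `v` as in `exists_common_eigenvector`, the columns `v`, `s v` (or `s v`, `v`) form a
nonzero intertwiner from some `ρ_{i,j}` when the two exponents differ. When they agree, `v + s v`
generates a copy of some `η_i`, unless it is zero, and then `v` generates a copy of `η'_i`. Schur's
lemma makes the intertwiner invertible. -/
theorem exists_equivalent_repOf {m : ℕ} (r : MatRep (Gd1 d 2) m)
    (hr : (r.over ℂ).IsIrreducible) : ∃ x ∈ labels d, (repOf d x).2.Equivalent r := by
  have hm : NeZero m := ⟨by
    rintro rfl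
    obtain ⟨p, q, hpq⟩ := hr.exists_pair_ne
    exact hpq (Subrepresentation.ext (Subsingleton.elim _ _))⟩
  have key : ∀ x ∈ labels d, ∀ (m' : ℕ) (r' : MatRep (Gd1 d 2) m'), repOf d x = ⟨m', r'⟩ →
      ∀ P : Matrix (Fin m) (Fin m') ℂ, P ≠ 0 →
      P * r' (sElt d) = r (sElt d) * P → P * r' (tElt ζ) = r (tElt ζ) * P →
      ∃ x ∈ labels d, (repOf d x).2.Equivalent r := by
    intro x hx m' r' hr' P hP hs ht
    have h := intertwining_of_generators hζ hs ht
    have hirr := isIrreducible_repOf hζ x hx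
    rw [hr'] at hirr
    obtain ⟨Q, h1, h2⟩ := exists_inverse_of_intertwining hirr hr P hP h
    refine ⟨x, hx, ?_⟩
    rw [hr']
    exact ⟨P, Q, h1, h2, h⟩
  have hss : ∀ v, (r (sElt d)).mulVec ((r (sElt d)).mulVec v) = v := by
    intro v
    rw [Matrix.mulVec_mulVec, ← map_mul, sElt_mul_sElt, map_one, Matrix.one_mulVec]
  have hcol : ∀ (A : Matrix (Fin m) (Fin m) ℂ) (w : Fin m → ℂ) (p : Fin m) (q : Fin 1),
      (A * Matrix.of fun p (_ : Fin 1) => w p) p q = A.mulVec w p := fun _ _ _ _ => rfl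
  have hcol2 : ∀ (A : Matrix (Fin m) (Fin m) ℂ) (v w : Fin m → ℂ) (p : Fin m),
      (A * Matrix.of fun p => ![v p, w p]) p 0 = A.mulVec v p ∧
      (A * Matrix.of fun p => ![v p, w p]) p 1 = A.mulVec w p := fun _ _ _ _ => ⟨rfl, rfl⟩
  have plane : ∀ (v : Fin m → ℂ) (a b : ℕ), v ≠ 0 → a < b → b < d →
      (r (tElt ζ)).mulVec v = (((ζ : ℂˣ) : ℂ) ^ a) • v → (r (tElt ζ)).mulVec
        ((r (sElt d)).mulVec v) = (((ζ : ℂˣ) : ℂ) ^ b) • (r (sElt d)).mulVec v →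
      ∃ x ∈ labels d, (repOf d x).2.Equivalent r := by
    intro v a b hv hab hb h1 h2
    have hx : (.inr (.inr (a + 1, b + 1))) ∈ labels d := by
      simp only [labels, inr_mem_disjSum, mem_pairs]; omega
    refine key _ hx _ _ rfl (Matrix.of fun p => ![v p, (r (sElt d)).mulVec v p]) ?_ ?_ ?_
    · intro h
      exact hv (funext fun p => congrFun (congrFun h p) 0)
    · rw [rhoRep_s]
      ext p q
      fin_cases q
      · refine Eq.trans ?_ (hcol2 _ _ _ p).1.symm
        simp [Matrix.mul_apply]
      · refine Eq.trans ?_ (hcol2 _ _ _ p).2.symm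
        rw [hss]
        simp [Matrix.mul_apply]
    · rw [rhoRep_t]
      ext p q
      fin_cases q
      · refine Eq.trans ?_ (hcol2 _ _ _ p).1.symm
        rw [h1]
        simp [Matrix.mul_apply, mul_comm]
      · refine Eq.trans ?_ (hcol2 _ _ _ p).2.symm
        rw [h2]
        simp [Matrix.mul_apply, mul_comm]
  obtain ⟨v, hv, a, ha, b, hb, h1, h2⟩ := exists_common_eigenvector hζ r
  rcases lt_trichotomy a b with hab | rfl | hab
  · exact plane v a b hv hab hb h1 h2
  · have hx : .inl (a + 1) ∈ labels d := by simp [labels]; omega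
    have hx' : .inr (.inl (a + 1)) ∈ labels d := by simp [labels]; omega
    by_cases h0 : v + (r (sElt d)).mulVec v = 0
    · refine key _ hx' _ _ rfl (Matrix.of fun p _ => v p) ?_ ?_ ?_
      · intro h
        exact hv (funext fun p => congrFun (congrFun h p) 0)
      · rw [etaRep'_s]
        ext p q
        rw [hcol, ← neg_eq_of_add_eq_zero_right h0]
        simp
      · rw [etaRep'_t]
        ext p q
        rw [hcol, h1]
        fin_cases q
        simp [Matrix.mul_apply, mul_comm]
    · refine key _ hx _ _ rfl (Matrix.of fun p _ => (v + (r (sElt d)).mulVec v) p) ?_ ?_ ?_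
      · intro h
        exact h0 (funext fun p => congrFun (congrFun h p) 0)
      · rw [etaRep_s]
        ext p q
        rw [hcol, Matrix.mulVec_add, hss]
        simp [add_comm]
      · rw [etaRep_t]
        ext p q
        rw [hcol, Matrix.mulVec_add, h1, h2, ← smul_add]
        fin_cases q
        simp [Matrix.mul_apply, mul_comm]
  · refine plane _ b a (fun h => hv ?_) hab ha h2 (by rw [hss]; exact h1)
    rw [← hss v, h, Matrix.mulVec_zero]

omit [NeZero d] in
-- The degree and the values at `s` and `t` settle the linear characters. For `ρ_{i,j}` the traces
-- at `t` and `diag(ζ, ζ)` give the sum and twice the product of `ζ^{i-1}` and `ζ^{j-1}`, hence the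
-- pair, ordered by `i < j`.
theorem char_repOf_injOn : Set.InjOn (fun x => (repOf d x).2.char) (labels d) := by
  have hz := isPrimitiveRoot_val hζ
  have hone : ∀ {m : ℕ} (r : MatRep (Gd1 d 2) m), r.char 1 = m := fun r => by
    simp [MatRep.char]
  have hlin : ∀ {i i' : ℕ}, i ∈ Icc 1 d → i' ∈ Icc 1 d →
      ((ζ : ℂˣ) : ℂ) ^ (i - 1) = ((ζ : ℂˣ) : ℂ) ^ (i' - 1) → i = i' := by
    intro i i' hi hi' h
    rw [mem_Icc] at hi hi'
    have := hz.pow_inj (by omega) (by omega) h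
    omega
  intro x hx y hy hxy
  have h1 := congrFun hxy 1
  have hs := congrFun hxy (sElt d)
  have ht := congrFun hxy (tElt ζ)
  have hu := congrFun hxy (diagElt ζ 1 1)
  simp only [mem_coe] at hx hy
  simp only [hone] at h1
  rcases x with i | i | p <;> rcases y with i' | i' | p' <;>
    simp only [labels, inl_mem_disjSum, inr_mem_disjSum, repOf, Nat.cast_inj] at hx hy h1
  · change (etaRep d i (tElt ζ)).trace = (etaRep d i' (tElt ζ)).trace at ht
    rw [etaRep_t, etaRep_t] at ht
    rw [hlin hx hy (by simpa using ht)]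
  · change (etaRep d i (sElt d)).trace = (etaRep' d i' (sElt d)).trace at hs
    rw [etaRep_s, etaRep'_s] at hs
    norm_num at hs
  · norm_num at h1
  · change (etaRep' d i (sElt d)).trace = (etaRep d i' (sElt d)).trace at hs
    rw [etaRep_s, etaRep'_s] at hs
    norm_num at hs
  · change (etaRep' d i (tElt ζ)).trace = (etaRep' d i' (tElt ζ)).trace at ht
    rw [etaRep'_t, etaRep'_t] at ht
    rw [hlin hx hy (by simpa using ht)]
  · norm_num at h1
  · norm_num at h1
  · norm_num at h1
  · obtain ⟨i, j⟩ := p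
    obtain ⟨i', j'⟩ := p'
    simp only [mem_pairs] at hx hy
    have hi : i ∈ Icc 1 d := by rw [mem_Icc]; omega
    have hj : j ∈ Icc 1 d := by rw [mem_Icc]; omega
    have hi' : i' ∈ Icc 1 d := by rw [mem_Icc]; omega
    have hj' : j' ∈ Icc 1 d := by rw [mem_Icc]; omega
    change (rhoRep d i j _).trace = (rhoRep d i' j' _).trace at ht hu
    rw [rhoRep_t, rhoRep_t, Matrix.trace_fin_two, Matrix.trace_fin_two] at ht
    rw [rhoRep_diagElt, rhoRep_diagElt, Matrix.trace_fin_two, Matrix.trace_fin_two] at hu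
    simp at ht hu
    have h3 : (((ζ : ℂˣ) : ℂ) ^ (i - 1) - ((ζ : ℂˣ) : ℂ) ^ (i' - 1)) *
        (((ζ : ℂˣ) : ℂ) ^ (i - 1) - ((ζ : ℂˣ) : ℂ) ^ (j' - 1)) = 0 := by
      linear_combination ((ζ : ℂˣ) : ℂ) ^ (i - 1) * ht - hu / 2
    rcases mul_eq_zero.1 h3 with h | h
    · have e1 := hlin hi hi' (sub_eq_zero.1 h)
      subst e1
      have e2 := hlin hj hj' (add_left_cancel ht)
      rw [e2]
    · have e1 := hlin hi hj' (sub_eq_zero.1 h)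
      subst e1
      have e2 := hlin hj hi' (by linear_combination ht)
      omega

omit hζ [NeZero d] in
theorem finsum_eq_sum_of_bijective {ι κ M : Type*} [Fintype ι] [AddCommMonoid M] (φ : ι → κ)
    (hφ : Function.Bijective φ) (F : κ → M) : ∑ᶠ k, F k = ∑ i, F (φ i) := by
  rw [← finsum_comp_equiv (Equiv.ofBijective φ hφ), finsum_eq_sum_of_fintype]
  rfl

/-- The cellular character attached to a module, from its multiplicities in the listed
representations. -/
theorem cellChar_eq_sum {c : Gd1 d 2 → ℂ} {α : Gd1 d 2 → Module.Dual ℂ (Fin 2 → ℂ)} {L : Type}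
    [AddCommGroup L] [Module (GauK (Gd1 d 2) c α) L] (f : ℕ ⊕ ℕ ⊕ ℕ × ℕ → ℕ)
    (hf : ∀ x ∈ labels d, ∀ (M : Type) [AddCommGroup M] [Module (GauK (Gd1 d 2) c α) M],
      (M ≃ₗ[GauK (Gd1 d 2) c α] extMod (repOf d x).2) →
      compMult (GauK (Gd1 d 2) c α) M L = f x) :
    cellChar (Gd1 d 2) c α L = ∑ x ∈ labels d, f x • (repOf d x).2.char := by
  let φ : labels d → irrChars (Gd1 d 2) := fun x =>
    ⟨(repOf d x).2.char, ⟨_, (repOf d x).2⟩, isIrreducible_repOf hζ x x.2, rfl⟩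
  have hφ : Function.Bijective φ := by
    constructor
    · intro x y hxy
      exact Subtype.ext (char_repOf_injOn hζ x.2 y.2 (congrArg Subtype.val hxy))
    · rintro ⟨_, r, hr, rfl⟩
      obtain ⟨x, hx, he⟩ := exists_equivalent_repOf hζ r.2 hr
      exact ⟨⟨x, hx⟩, Subtype.ext he.char_eq⟩
  -- `affordingRep` is an arbitrary representation with the given character; it is equivalent to
  -- some `repOf d y`, and the character forces `y = x`. This is why `hf` is required for all
  -- modules isomorphic to the listed ones.
  have hmult : ∀ x : labels d,
      compMult (GauK (Gd1 d 2) c α) (extMod (affordingRep (φ x)).2) L = f x := by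
    intro x
    obtain ⟨hirr, hchar⟩ : Affords (affordingRep (φ x)) (φ x) := (φ x).2.choose_spec
    obtain ⟨y, hy, he⟩ := exists_equivalent_repOf hζ _ hirr
    have hyx : y = x := char_repOf_injOn hζ hy x.2 (he.char_eq.trans hchar)
    obtain ⟨e⟩ := he.symm.nonempty_linearEquiv c α
    rw [← hyx]
    exact hf y hy _ e
  have h := finsum_eq_sum_of_bijective φ hφ fun χ => compMult (GauK (Gd1 d 2) c α)
    (extMod (affordingRep χ).2) L • (χ : Gd1 d 2 → ℂ)
  refine h.trans ?_
  simp only [hmult]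
  exact sum_coe_sort (labels d) fun x => f x • (repOf d x).2.char

end Irreducible


/-! ### Equivalence classes and sums of characters -/

section Classes

variable {d : ℕ} {k : ℕ → ℂ} {O O' : Finset ℕ} {i : ℕ}

theorem IsSimClass.mem_Icc (hO : IsSimClass d k O) (hi : i ∈ O) : i ∈ Icc 1 d := by
  obtain ⟨a, -, rfl⟩ := hO
  exact (mem_filter.1 hi).1

theorem IsSimClass.eq_filter (hO : IsSimClass d k O) (hi : i ∈ O) :
    O = {j ∈ Icc 1 d | k j = k i} := by
  obtain ⟨a, -, rfl⟩ := hO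
  rw [(mem_filter.1 hi).2]

theorem IsSimClass.nonempty (hO : IsSimClass d k O) : O.Nonempty := by
  obtain ⟨a, ha, rfl⟩ := hO
  exact ⟨a, mem_filter.2 ⟨ha, rfl⟩⟩

theorem IsSimClass.val_eq (hO : IsSimClass d k O) {j : ℕ} (hi : i ∈ O) (hj : j ∈ O) :
    k j = k i := by
  rw [hO.eq_filter hi] at hj
  exact (mem_filter.1 hj).2

theorem isSimClass_filter (hi : i ∈ Icc 1 d) : IsSimClass d k {j ∈ Icc 1 d | k j = k i} :=
  ⟨i, hi, rfl⟩

theorem self_mem_filter (hi : i ∈ Icc 1 d) : i ∈ ({j ∈ Icc 1 d | k j = k i} : Finset ℕ) :=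
  mem_filter.2 ⟨hi, rfl⟩

theorem IsSimClass.val_ne (hO : IsSimClass d k O) (hO' : IsSimClass d k O') (hne : O ≠ O') {j : ℕ}
    (hi : i ∈ O) (hj : j ∈ O') : k i ≠ k j := by
  intro h
  apply hne
  rw [hO.eq_filter hi, hO'.eq_filter hj, h]

/-- A class at distance `δ` is the fibre of `k` over `k i - δ`, for any `i ∈ O`; uniqueness follows.
-/
theorem IsShift.eq_filter {δ : ℂ} (hi : i ∈ O) (h : IsShift d k δ O O') :
    O' = {j ∈ Icc 1 d | k i - k j = δ} := by
  obtain ⟨b, hb⟩ := h.1.nonempty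
  have hib := h.2 i hi b hb
  rw [h.1.eq_filter hb]
  refine filter_congr fun j _ => ?_
  rw [← hib, sub_right_inj]

/-- When there is no class at distance `δ` the fibre is empty, so a single formula covers both
alternatives. -/
theorem IsShiftOrEmpty.eq_filter {δ : ℂ} (hO : IsSimClass d k O) (hi : i ∈ O)
    (h : IsShiftOrEmpty d k δ O O') : O' = {j ∈ Icc 1 d | k i - k j = δ} := by
  rcases h with h | ⟨rfl, h⟩
  · exact h.eq_filter hi
  · refine (filter_eq_empty_iff.2 fun j hj hij => h _ ⟨isSimClass_filter hj, ?_⟩).symm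
    intro a ha b hb
    rw [hO.val_eq hi ha, (mem_filter.1 hb).2, hij]

theorem exists_isShiftOrEmpty (d : ℕ) (k : ℕ → ℂ) (δ : ℂ) (O : Finset ℕ) :
    ∃ O', IsShiftOrEmpty d k δ O O' := by
  by_cases h : ∃ P, IsShift d k δ O P
  · obtain ⟨P, hP⟩ := h
    exact ⟨P, Or.inl hP⟩
  · exact ⟨∅, Or.inr ⟨rfl, fun P hP => h ⟨P, hP⟩⟩⟩

end Classes

/-! ### The characters `γ` as sums over the labels -/

section Sums

variable {d : ℕ} {M : Type} [AddCommMonoid M] (F : ℕ → ℕ → M) {O O' : Finset ℕ}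

theorem sum_sum_lt_eq_sum_pairs (hO : O ⊆ Icc 1 d) (hO' : O' ⊆ Icc 1 d) :
    ∑ i ∈ O, ∑ j ∈ O' with i < j, F i j =
      ∑ p ∈ pairs d, if p.1 ∈ O ∧ p.2 ∈ O' then F p.1 p.2 else 0 := by
  simp_rw [sum_filter]
  rw [← sum_product' O O' (fun i j => if i < j then F i j else 0), ← sum_filter, ← sum_filter]
  refine sum_congr ?_ fun _ _ => rfl
  ext p
  simp only [pairs, mem_filter, mem_product]
  constructor
  · rintro ⟨⟨h1, h2⟩, h3⟩
    exact ⟨⟨⟨hO h1, hO' h2⟩, h3⟩, h1, h2⟩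
  · rintro ⟨⟨-, h3⟩, h⟩
    exact ⟨h, h3⟩

theorem sum_sum_gt_eq_sum_pairs (hO : O ⊆ Icc 1 d) (hO' : O' ⊆ Icc 1 d) :
    ∑ i ∈ O, ∑ j ∈ O' with j < i, F j i =
      ∑ p ∈ pairs d, if p.2 ∈ O ∧ p.1 ∈ O' then F p.1 p.2 else 0 := by
  simp_rw [and_comm (b := _ ∈ O')]
  rw [← sum_sum_lt_eq_sum_pairs F hO' hO]
  simp_rw [sum_filter]
  exact sum_comm

theorem sum_labels (f : ℕ ⊕ ℕ ⊕ ℕ × ℕ → ℕ) : ∑ x ∈ labels d, f x • (repOf d x).2.char =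
    ∑ i ∈ Icc 1 d, f (.inl i) • xi d i + (∑ i ∈ Icc 1 d, f (.inr (.inl i)) • xi' d i +
      ∑ p ∈ pairs d, f (.inr (.inr p)) • chi d p.1 p.2) := by
  rw [labels, sum_disjSum, sum_disjSum]
  rfl

/-- Disjointness of `O` and `O'` prevents a pair from occurring in both sums of `gammaPair`, so the
coefficient is 1 and never 2. -/
theorem sum_pairs_eq_gammaPair {N : ℕ × ℕ → ℕ} (hO : O ⊆ Icc 1 d) (hO' : O' ⊆ Icc 1 d)
    (hd : Disjoint O O') (h₁ : ∀ p ∈ pairs d, (p.1 ∈ O ∧ p.2 ∈ O') ∨ (p.2 ∈ O ∧ p.1 ∈ O') → N p = 1)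
    (h₀ : ∀ p ∈ pairs d, ¬ ((p.1 ∈ O ∧ p.2 ∈ O') ∨ (p.2 ∈ O ∧ p.1 ∈ O')) → N p = 0) :
    ∑ p ∈ pairs d, N p • chi d p.1 p.2 = gammaPair d O O' := by
  rw [gammaPair, sum_sum_lt_eq_sum_pairs _ hO hO', sum_sum_gt_eq_sum_pairs _ hO hO',
    ← sum_add_distrib]
  refine sum_congr rfl fun p hp => ?_
  by_cases h5 : p.1 ∈ O ∧ p.2 ∈ O' <;> by_cases h6 : p.2 ∈ O ∧ p.1 ∈ O'
  · exact absurd h6.2 (disjoint_left.1 hd h5.1)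
  · rw [h₁ p hp (Or.inl h5), if_pos h5, if_neg h6, add_zero, one_smul]
  · rw [h₁ p hp (Or.inr h6), if_neg h5, if_pos h6, zero_add, one_smul]
  · rw [h₀ p hp (not_or.2 ⟨h5, h6⟩), if_neg h5, if_neg h6, zero_add, zero_smul]

theorem gammaO_eq : gammaO d O O' = ∑ i ∈ O, xi d i + gammaPair d O O' := by
  simp only [gammaO, gammaPair, sum_add_distrib, add_assoc]

theorem gammaO'_eq : gammaO' d O O' = ∑ i ∈ O, xi' d i + gammaPair d O O' := by
  simp only [gammaO', gammaPair, sum_add_distrib, add_assoc]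

variable (d) (k : ℕ → ℂ) {c₀ ε a b : ℂ}

theorem sum_multLine_pairs (hc₀ : ε * c₀ ≠ 0) (k₀ : ℂ) :
    ∑ p ∈ pairs d, multLine k c₀ ε k₀ (.inr (.inr p)) • chi d p.1 p.2 =
      gammaPair d {j ∈ Icc 1 d | k j = k₀} {j ∈ Icc 1 d | k₀ - k j = ε * c₀} := by
  have hmem : ∀ p ∈ pairs d, p.1 ∈ Icc 1 d ∧ p.2 ∈ Icc 1 d := fun p hp =>
    mem_product.1 (mem_filter.1 hp).1
  refine sum_pairs_eq_gammaPair (filter_subset _ _) (filter_subset _ _) ?_ ?_ ?_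
  · refine disjoint_left.2 fun j h1 h2 => hc₀ ?_
    rw [← (mem_filter.1 h2).2, (mem_filter.1 h1).2, sub_self]
  · rintro p - (⟨h1, h2⟩ | ⟨h1, h2⟩)
    · have e := (mem_filter.1 h1).2
      exact if_pos (Or.inl ⟨e, by rw [e]; exact (mem_filter.1 h2).2⟩)
    · have e := (mem_filter.1 h1).2
      exact if_pos (Or.inr ⟨e, by rw [e]; exact (mem_filter.1 h2).2⟩)
  · intro p hp h
    refine if_neg fun h' => h ?_
    rcases h' with ⟨h1, h2⟩ | ⟨h1, h2⟩ <;> rw [h1] at h2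
    · exact Or.inl ⟨mem_filter.2 ⟨(hmem p hp).1, h1⟩, mem_filter.2 ⟨(hmem p hp).2, h2⟩⟩
    · exact Or.inr ⟨mem_filter.2 ⟨(hmem p hp).2, h1⟩, mem_filter.2 ⟨(hmem p hp).1, h2⟩⟩

theorem sum_multLine_one (hc₀ : c₀ ≠ 0) (k₀ : ℂ) :
    ∑ x ∈ labels d, multLine k c₀ 1 k₀ x • (repOf d x).2.char =
      gammaO d {j ∈ Icc 1 d | k j = k₀} {j ∈ Icc 1 d | k₀ - k j = c₀} := by
  have h1 : ¬ (-1 : ℂ) = 1 := by norm_num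
  rw [sum_labels, sum_multLine_pairs d k (by rwa [one_mul]), gammaO_eq, one_mul, sum_filter]
  simp only [multLine, h1, false_and, if_false, zero_smul, sum_const_zero, zero_add, true_and,
    ite_smul, one_smul]

theorem sum_multLine_neg_one (hc₀ : c₀ ≠ 0) (k₀ : ℂ) :
    ∑ x ∈ labels d, multLine k c₀ (-1) k₀ x • (repOf d x).2.char =
      gammaO' d {j ∈ Icc 1 d | k j = k₀} {j ∈ Icc 1 d | k₀ - k j = -c₀} := by
  have h1 : ¬ (1 : ℂ) = -1 := by norm_num
  rw [sum_labels, sum_multLine_pairs d k (by simpa using hc₀), gammaO'_eq, neg_one_mul, sum_filter]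
  simp only [multLine, h1, false_and, if_false, zero_smul, sum_const_zero, zero_add, true_and,
    ite_smul, one_smul]

theorem sum_multPlane (hab : a ≠ b) :
    ∑ x ∈ labels d, multPlane k a b x • (repOf d x).2.char =
      gammaPair d {j ∈ Icc 1 d | k j = a} {j ∈ Icc 1 d | k j = b} := by
  have hmem : ∀ p ∈ pairs d, p.1 ∈ Icc 1 d ∧ p.2 ∈ Icc 1 d := fun p hp =>
    mem_product.1 (mem_filter.1 hp).1
  rw [sum_labels]
  simp only [multPlane.eq_1, multPlane.eq_2, zero_smul, sum_const_zero, zero_add]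
  refine sum_pairs_eq_gammaPair (filter_subset _ _) (filter_subset _ _) ?_ ?_ ?_
  · refine disjoint_left.2 fun j h1 h2 => hab ?_
    rw [← (mem_filter.1 h2).2, (mem_filter.1 h1).2]
  · rintro p - (⟨h1, h2⟩ | ⟨h1, h2⟩)
    · exact if_pos (Or.inl ⟨(mem_filter.1 h1).2, (mem_filter.1 h2).2⟩)
    · exact if_pos (Or.inr ⟨(mem_filter.1 h2).2, (mem_filter.1 h1).2⟩)
  · intro p hp h
    refine if_neg fun h' => h ?_
    rcases h' with ⟨h1, h2⟩ | ⟨h1, h2⟩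
    · exact Or.inl ⟨mem_filter.2 ⟨(hmem p hp).1, h1⟩, mem_filter.2 ⟨(hmem p hp).2, h2⟩⟩
    · exact Or.inr ⟨mem_filter.2 ⟨(hmem p hp).2, h2⟩, mem_filter.2 ⟨(hmem p hp).1, h1⟩⟩

theorem sum_multPlane_self (a : ℂ) :
    ∑ x ∈ labels d, multPlane k a a x • (repOf d x).2.char =
      gammaDiag d {j ∈ Icc 1 d | k j = a} := by
  rw [sum_labels, gammaDiag, sum_sum_lt_eq_sum_pairs _ (filter_subset _ _) (filter_subset _ _)]
  simp only [multPlane, zero_smul, sum_const_zero, zero_add, or_self, ite_smul, one_smul]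
  refine sum_congr rfl fun p hp => ?_
  obtain ⟨h1, h2⟩ := mem_product.1 (mem_filter.1 hp).1
  simp only [mem_filter, h1, h2, true_and]

end Sums


/-! ### The cellular characters of `G(d,1,2)` -/

section Cellular

variable {d : ℕ} [NeZero d] {ζ : rootsOfUnity d ℂ} {c : Gd1 d 2 → ℂ}
  {α : Gd1 d 2 → Module.Dual ℂ (Fin 2 → ℂ)} {O O' : Finset ℕ}
variable {L L' : Type} [AddCommGroup L] [Module (GauK (Gd1 d 2) c α) L]
  [AddCommGroup L'] [Module (GauK (Gd1 d 2) c α) L']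

omit [NeZero d] in
theorem cellChar_congr (e : L ≃ₗ[GauK (Gd1 d 2) c α] L') :
    cellChar (Gd1 d 2) c α L = cellChar (Gd1 d 2) c α L' := by
  have h : ∀ (S : Type) [AddCommGroup S] [Module (GauK (Gd1 d 2) c α) S],
      Nonempty (S ≃ₗ[GauK (Gd1 d 2) c α] L) ↔ Nonempty (S ≃ₗ[GauK (Gd1 d 2) c α] L') :=
    fun S _ _ => ⟨fun ⟨f⟩ => ⟨f.trans e⟩, fun ⟨f⟩ => ⟨f.trans e.symm⟩⟩
  simp only [cellChar, compMult, h]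

variable (hζ : IsPrimitiveRoot ζ d) (hc : IsParameter (Gd1 d 2) c)
  (hα : IsRootChoice (Gd1 d 2) α) (hne : c (sElt d) ≠ 0)
include hζ hc hα hne

theorem cellChar_eq_gammaO (hO : IsSimClass d (kSharp ζ c) O)
    (hO' : IsShiftOrEmpty d (kSharp ζ c) (c (sElt d)) O O') {i : ℕ} (hi : i ∈ O)
    (hL : IsLine (genX c α) (genZ c α) L (lineVal d (c (sElt d)) 1 (kSharp ζ c i))
      (algebraMap ℂ _ (2 * kSharp ζ c i - 1 * c (sElt d)))) :
    cellChar (Gd1 d 2) c α L = gammaO d O O' := by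
  rw [cellChar_eq_sum hζ _ (compMult_eq_multLine hζ hc hα hne (Or.inl rfl) hL),
    sum_multLine_one d _ hne, ← hO.eq_filter hi, ← hO'.eq_filter hO hi]

theorem cellChar_eq_gammaO' (hO : IsSimClass d (kSharp ζ c) O)
    (hO' : IsShiftOrEmpty d (kSharp ζ c) (-c (sElt d)) O O') {i : ℕ} (hi : i ∈ O)
    (hL : IsLine (genX c α) (genZ c α) L (lineVal d (c (sElt d)) (-1) (kSharp ζ c i))
      (algebraMap ℂ _ (2 * kSharp ζ c i - (-1) * c (sElt d)))) :
    cellChar (Gd1 d 2) c α L = gammaO' d O O' := by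
  rw [cellChar_eq_sum hζ _ (compMult_eq_multLine hζ hc hα hne (Or.inr rfl) hL),
    sum_multLine_neg_one d _ hne, ← hO.eq_filter hi, ← hO'.eq_filter hO hi]

theorem cellChar_eq_gammaPair (hO : IsSimClass d (kSharp ζ c) O)
    (hO' : IsSimClass d (kSharp ζ c) O') (hOO' : O ≠ O')
    (h : ∀ i ∈ O, ∀ j ∈ O', c (sElt d) ^ 2 ≠ (kSharp ζ c i - kSharp ζ c j) ^ 2) {i j : ℕ}
    (hi : i ∈ O) (hj : j ∈ O') [IsSimpleModule (GauK (Gd1 d 2) c α) L]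
    (hL : IsPlane (genX c α) (genZ c α) L (algebraMap ℂ _ (kSharp ζ c i + kSharp ζ c j))
      (planeDet d (c (sElt d)) (kSharp ζ c i) (kSharp ζ c j))) :
    cellChar (Gd1 d 2) c α L = gammaPair d O O' := by
  have hij := hO.val_ne hO' hOO' hi hj
  rw [cellChar_eq_sum hζ _ (compMult_eq_multPlane hζ hc hα hne (h i hi j hj) (Or.inl hij) hL),
    sum_multPlane d _ hij, ← hO.eq_filter hi, ← hO'.eq_filter hj]

theorem cellChar_eq_gammaDiag (hO : IsSimClass d (kSharp ζ c) O) (hd : Odd d) {i j : ℕ}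
    (hi : i ∈ O) (hj : j ∈ O) [IsSimpleModule (GauK (Gd1 d 2) c α) L]
    (hL : IsPlane (genX c α) (genZ c α) L (algebraMap ℂ _ (kSharp ζ c i + kSharp ζ c j))
      (planeDet d (c (sElt d)) (kSharp ζ c i) (kSharp ζ c j))) :
    cellChar (Gd1 d 2) c α L = gammaDiag d O := by
  rw [hO.val_eq hi hj] at hL
  have h : c (sElt d) ^ 2 ≠ (kSharp ζ c i - kSharp ζ c i) ^ 2 := by simpa using hne
  rw [cellChar_eq_sum hζ _ (compMult_eq_multPlane hζ hc hα hne h (Or.inr hd) hL),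
    sum_multPlane_self, ← hO.eq_filter hi]

theorem cellChar_eq_gammaDiag_of_even (hO : IsSimClass d (kSharp ζ c) O) (hd : Even d) {i j : ℕ}
    (hi : i ∈ O) (hj : j ∈ O) {ε : ℤ} (hε : ε = 1 ∨ ε = -1)
    (hL : IsLine (genX c α) (genZ c α) L (halfVal d (c (sElt d)) ε (kSharp ζ c i))
      (algebraMap ℂ _ (kSharp ζ c i + kSharp ζ c j))) :
    cellChar (Gd1 d 2) c α L = gammaDiag d O := by
  rw [hO.val_eq hi hj] at hL
  rw [cellChar_eq_sum hζ _ (compMult_eq_multPlane_of_even hζ hc hα hne hd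
    (hε.imp (by rintro rfl; simp) (by rintro rfl; simp)) hL), sum_multPlane_self,
    ← hO.eq_filter hi]

theorem isPlane_of_mem_Icc {i j : ℕ} (hi : i ∈ Icc 1 d) (hj : j ∈ Icc 1 d) (hij : i < j) :
    IsPlane (genX c α) (genZ c α) (extMod (rhoRep d i j))
      (algebraMap ℂ _ (kSharp ζ c i + kSharp ζ c j))
      (planeDet d (c (sElt d)) (kSharp ζ c i) (kSharp ζ c j)) :=
  isPlane_rhoRep hζ hc hα hne (mem_Icc.1 hi).1 hij (mem_Icc.1 hj).2

theorem isSimpleModule_rhoRep {i j : ℕ} (hi : i ∈ Icc 1 d) (hj : j ∈ Icc 1 d) (hij : i < j)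
    (h : c (sElt d) ^ 2 ≠ (kSharp ζ c i - kSharp ζ c j) ^ 2)
    (h' : kSharp ζ c i ≠ kSharp ζ c j ∨ Odd d) :
    IsSimpleModule (GauK (Gd1 d 2) c α) (extMod (rhoRep d i j)) :=
  (isPlane_of_mem_Icc hζ hc hα hne hi hj hij).isSimpleModule
    (quadratic_ne_zero (NeZero.ne d) hne h h')

/-- The order `i < j` may disagree with the order of `O` and `O'`. By symmetry of trace and
determinant the plane is presented with its first parameter from `O`, so the two cases need not be
separated later. -/
theorem exists_isPlane_of_mem (hO : IsSimClass d (kSharp ζ c) O)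
    (hO' : IsSimClass d (kSharp ζ c) O') (hOO' : O ≠ O')
    (h : ∀ i ∈ O, ∀ j ∈ O', c (sElt d) ^ 2 ≠ (kSharp ζ c i - kSharp ζ c j) ^ 2) {i j : ℕ}
    (hij : i < j) (hmem : i ∈ O ∧ j ∈ O' ∨ j ∈ O ∧ i ∈ O') :
    IsSimpleModule (GauK (Gd1 d 2) c α) (extMod (rhoRep d i j)) ∧ ∃ a ∈ O, ∃ b ∈ O',
      IsPlane (genX c α) (genZ c α) (extMod (rhoRep d i j))
        (algebraMap ℂ _ (kSharp ζ c a + kSharp ζ c b))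
        (planeDet d (c (sElt d)) (kSharp ζ c a) (kSharp ζ c b)) := by
  rcases hmem with ⟨hi, hj⟩ | ⟨hj, hi⟩
  · exact ⟨isSimpleModule_rhoRep hζ hc hα hne (hO.mem_Icc hi) (hO'.mem_Icc hj) hij (h i hi j hj)
      (Or.inl (hO.val_ne hO' hOO' hi hj)), i, hi, j, hj,
      isPlane_of_mem_Icc hζ hc hα hne (hO.mem_Icc hi) (hO'.mem_Icc hj) hij⟩
  · refine ⟨isSimpleModule_rhoRep hζ hc hα hne (hO'.mem_Icc hi) (hO.mem_Icc hj) hij ?_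
      (Or.inl (hO.val_ne hO' hOO' hj hi).symm), j, hj, i, hi, ?_⟩
    · rw [← neg_sub, neg_sq]
      exact h j hj i hi
    · have hpl := isPlane_of_mem_Icc hζ hc hα hne (hO'.mem_Icc hi) (hO.mem_Icc hj) hij
      rwa [add_comm, planeDet, mul_comm (kSharp ζ c i)] at hpl

theorem isLine_pmSub_of_mem (hO : IsSimClass d (kSharp ζ c) O) (hd : Even d) {i j : ℕ}
    (hi : i ∈ O) (hj : j ∈ O) (hij : i < j) {ε : ℤ} (hε : ε = 1 ∨ ε = -1) :
    IsLine (genX c α) (genZ c α) (pmSub c α i j ε) (halfVal d (c (sElt d)) ε (kSharp ζ c i))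
      (algebraMap ℂ _ (kSharp ζ c i + kSharp ζ c j)) :=
  isLine_pmSub hζ hc hα hne (mem_Icc.1 (hO.mem_Icc hi)).1 hij (mem_Icc.1 (hO.mem_Icc hj)).2 hd
    (hO.val_eq hj hi) hε

/-- One inclusion evaluates the character on each case of `simple_cases`; the other exhibits one
simple module for each class or admissible pair of classes. -/
theorem cellularCharacters_eq : cellularCharacters (Gd1 d 2) c α =
    {γ | ∃ O O', IsSimClass d (kSharp ζ c) O ∧
      IsShiftOrEmpty d (kSharp ζ c) (c (sElt d)) O O' ∧ γ = gammaO d O O'} ∪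
    {γ | ∃ O O', IsSimClass d (kSharp ζ c) O ∧
      IsShiftOrEmpty d (kSharp ζ c) (-c (sElt d)) O O' ∧ γ = gammaO' d O O'} ∪
    {γ | ∃ O O', IsSimClass d (kSharp ζ c) O ∧ IsSimClass d (kSharp ζ c) O' ∧ O ≠ O' ∧
      (∀ i ∈ O, ∀ j ∈ O', c (sElt d) ^ 2 ≠ (kSharp ζ c i - kSharp ζ c j) ^ 2) ∧
      γ = gammaPair d O O'} ∪
    {γ | ∃ O, IsSimClass d (kSharp ζ c) O ∧ 2 ≤ O.card ∧ γ = gammaDiag d O} := by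
  have hcard : ∀ {i j}, i ∈ Icc 1 d → j ∈ Icc 1 d → i < j → kSharp ζ c i = kSharp ζ c j →
      j ∈ ({l ∈ Icc 1 d | kSharp ζ c l = kSharp ζ c i} : Finset ℕ) ∧
      2 ≤ ({l ∈ Icc 1 d | kSharp ζ c l = kSharp ζ c i} : Finset ℕ).card := by
    intro i j hi hj hij h
    have hj' : j ∈ ({l ∈ Icc 1 d | kSharp ζ c l = kSharp ζ c i} : Finset ℕ) :=
      mem_filter.2 ⟨hj, h.symm⟩
    exact ⟨hj', one_lt_card.2 ⟨i, self_mem_filter hi, j, hj', hij.ne⟩⟩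
  apply Set.Subset.antisymm
  · rintro _ ⟨L, _, _, hL, rfl⟩
    rcases simple_cases hζ hc hα hne L with ⟨i, hi, hl⟩ | ⟨i, hi, hl⟩ |
      ⟨i, hi, j, hj, hij, h, h', ⟨e⟩⟩ | ⟨i, hi, j, hj, hij, h, hd, ε, hε, hl⟩
    · obtain ⟨O', hO'⟩ := exists_isShiftOrEmpty d (kSharp ζ c) (c (sElt d))
        {l ∈ Icc 1 d | kSharp ζ c l = kSharp ζ c i}
      exact Or.inl (Or.inl (Or.inl ⟨_, O', isSimClass_filter hi, hO',
        cellChar_eq_gammaO hζ hc hα hne (isSimClass_filter hi) hO' (self_mem_filter hi) hl⟩))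
    · obtain ⟨O', hO'⟩ := exists_isShiftOrEmpty d (kSharp ζ c) (-c (sElt d))
        {l ∈ Icc 1 d | kSharp ζ c l = kSharp ζ c i}
      exact Or.inl (Or.inl (Or.inr ⟨_, O', isSimClass_filter hi, hO',
        cellChar_eq_gammaO' hζ hc hα hne (isSimClass_filter hi) hO' (self_mem_filter hi) hl⟩))
    · have hsimple := isSimpleModule_rhoRep hζ hc hα hne hi hj hij h h'
      have hpl := isPlane_of_mem_Icc hζ hc hα hne hi hj hij
      rw [cellChar_congr e]
      have hOi : IsSimClass d (kSharp ζ c) _ := isSimClass_filter hi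
      by_cases hk : kSharp ζ c i = kSharp ζ c j
      · obtain ⟨hj', h2⟩ := hcard hi hj hij hk
        exact Or.inr ⟨_, hOi, h2, cellChar_eq_gammaDiag hζ hc hα hne hOi
          (h'.resolve_left (not_not.2 hk)) (self_mem_filter hi) hj' hpl⟩
      · have hOj : IsSimClass d (kSharp ζ c) _ := isSimClass_filter hj
        have hOO' : ({l ∈ Icc 1 d | kSharp ζ c l = kSharp ζ c i} : Finset ℕ) ≠
            ({l ∈ Icc 1 d | kSharp ζ c l = kSharp ζ c j} : Finset ℕ) := by
          intro h5
          have h6 := self_mem_filter (k := kSharp ζ c) hi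
          rw [h5] at h6
          exact hk (mem_filter.1 h6).2
        have h4 : ∀ a ∈ ({l ∈ Icc 1 d | kSharp ζ c l = kSharp ζ c i} : Finset ℕ),
            ∀ b ∈ ({l ∈ Icc 1 d | kSharp ζ c l = kSharp ζ c j} : Finset ℕ),
            c (sElt d) ^ 2 ≠ (kSharp ζ c a - kSharp ζ c b) ^ 2 := by
          intro a ha b hb
          rwa [(mem_filter.1 ha).2, (mem_filter.1 hb).2]
        exact Or.inl (Or.inr ⟨_, _, hOi, hOj, hOO', h4, cellChar_eq_gammaPair hζ hc hα hne hOi hOj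
          hOO' h4 (self_mem_filter hi) (self_mem_filter hj) hpl⟩)
    · obtain ⟨hj', h2⟩ := hcard hi hj hij h
      exact Or.inr ⟨_, isSimClass_filter hi, h2, cellChar_eq_gammaDiag_of_even hζ hc hα hne
        (isSimClass_filter hi) hd (self_mem_filter hi) hj' hε hl⟩
  · rintro γ (((⟨O, O', hO, hO', rfl⟩ | ⟨O, O', hO, hO', rfl⟩) | ⟨O, O', hO, hO', hOO', h, rfl⟩) |
      ⟨O, hO, h2, rfl⟩)
    · obtain ⟨i, hi⟩ := hO.nonempty
      have hl := isLine_etaRep hζ hc hα (mem_Icc.1 (hO.mem_Icc hi)).1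
      exact ⟨extMod (etaRep d i), _, _, hl.simple, cellChar_eq_gammaO hζ hc hα hne hO hO' hi hl⟩
    · obtain ⟨i, hi⟩ := hO.nonempty
      have hl := isLine_etaRep' hζ hc hα (mem_Icc.1 (hO.mem_Icc hi)).1
      exact ⟨extMod (etaRep' d i), _, _, hl.simple, cellChar_eq_gammaO' hζ hc hα hne hO hO' hi hl⟩
    · obtain ⟨i, hi⟩ := hO.nonempty
      obtain ⟨j, hj⟩ := hO'.nonempty
      have hij : i ≠ j := fun hij => hO.val_ne hO' hOO' hi hj (by rw [hij])
      obtain ⟨p, q, hpq, hmem⟩ : ∃ p q, p < q ∧ (p ∈ O ∧ q ∈ O' ∨ q ∈ O ∧ p ∈ O') := by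
        rcases hij.lt_or_gt with hij | hij
        · exact ⟨i, j, hij, Or.inl ⟨hi, hj⟩⟩
        · exact ⟨j, i, hij, Or.inr ⟨hi, hj⟩⟩
      obtain ⟨hs, a, ha, b, hb, hpl⟩ := exists_isPlane_of_mem hζ hc hα hne hO hO' hOO' h hpq hmem
      exact ⟨extMod (rhoRep d p q), _, _, hs,
        cellChar_eq_gammaPair hζ hc hα hne hO hO' hOO' h ha hb hpl⟩
    · obtain ⟨i, hi, j, hj, hij⟩ : ∃ i ∈ O, ∃ j ∈ O, i < j := by
        obtain ⟨i, hi, j, hj, hij⟩ := one_lt_card.1 h2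
        rcases hij.lt_or_gt with hij | hij
        · exact ⟨i, hi, j, hj, hij⟩
        · exact ⟨j, hj, i, hi, hij⟩
      rcases Nat.even_or_odd d with hd | hd
      · have hl := isLine_pmSub_of_mem hζ hc hα hne hO hd hi hj hij (Or.inl rfl)
        exact ⟨pmSub c α i j 1, _, _, hl.simple,
          cellChar_eq_gammaDiag_of_even hζ hc hα hne hO hd hi hj (Or.inl rfl) hl⟩
      · have hs := isSimpleModule_rhoRep hζ hc hα hne (hO.mem_Icc hi) (hO.mem_Icc hj) hij
          (by simpa [hO.val_eq hi hj] using hne) (Or.inr hd)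
        exact ⟨extMod (rhoRep d i j), _, _, hs, cellChar_eq_gammaDiag hζ hc hα hne hO hd hi hj
          (isPlane_of_mem_Icc hζ hc hα hne (hO.mem_Icc hi) (hO.mem_Icc hj) hij)⟩

end Cellular

end

end CalogeroMoser

/-! ### The classification of simple modules and cellular characters -/

theorem mainTheorem5 (d : ℕ) [NeZero d] (ζ : rootsOfUnity d ℂ) (hζ : IsPrimitiveRoot ζ d)
    (c : Gd1 d 2 → ℂ) (hc : IsParameter (Gd1 d 2) c)
    (α : Gd1 d 2 → Module.Dual ℂ (Fin 2 → ℂ)) (hα : IsRootChoice (Gd1 d 2) α)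
    (c₀ : ℂ) (hc₀ : c₀ = c (sElt d)) (hne : c₀ ≠ 0)
    (k : ℕ → ℂ) (hk : k = kSharp ζ c) :
    -- uniqueness of the class at distance `± c₀`
    (∀ O, IsSimClass d k O → ∀ δ, δ = c₀ ∨ δ = -c₀ →
      ∀ P Q, IsShift d k δ O P → IsShift d k δ O Q → P = Q) ∧
    -- the class `ℒ_O` of the restrictions of the `η_i`, `i ∈ O`
    (∀ O O', IsSimClass d k O → IsShiftOrEmpty d k c₀ O O' → ∀ i ∈ O,
      IsSimpleModule (GauK (Gd1 d 2) c α) (extMod (etaRep d i)) ∧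
      (∀ p ∈ O, Nonempty
        (extMod (etaRep d i) ≃ₗ[GauK (Gd1 d 2) c α] extMod (etaRep d p))) ∧
      cellChar (Gd1 d 2) c α (extMod (etaRep d i)) = gammaO d O O') ∧
    -- the class `ℒ'_O` of the restrictions of the `η'_i`, `i ∈ O`
    (∀ O O', IsSimClass d k O → IsShiftOrEmpty d k (-c₀) O O' → ∀ i ∈ O,
      IsSimpleModule (GauK (Gd1 d 2) c α) (extMod (etaRep' d i)) ∧
      (∀ p ∈ O, Nonempty
        (extMod (etaRep' d i) ≃ₗ[GauK (Gd1 d 2) c α] extMod (etaRep' d p))) ∧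
      cellChar (Gd1 d 2) c α (extMod (etaRep' d i)) = gammaO' d O O') ∧
    -- the class `ℒ_{O,O'}`, `O ≠ O'`, of the restrictions of the corresponding `ρ_{i,j}`
    (∀ O O', IsSimClass d k O → IsSimClass d k O' → O ≠ O' →
      (∀ i ∈ O, ∀ j ∈ O', c₀ ^ 2 ≠ (k i - k j) ^ 2) →
      ∀ i j, i < j → (i ∈ O ∧ j ∈ O' ∨ j ∈ O ∧ i ∈ O') →
      IsSimpleModule (GauK (Gd1 d 2) c α) (extMod (rhoRep d i j)) ∧
      (∀ p q, p < q → (p ∈ O ∧ q ∈ O' ∨ q ∈ O ∧ p ∈ O') → Nonempty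
        (extMod (rhoRep d i j) ≃ₗ[GauK (Gd1 d 2) c α] extMod (rhoRep d p q))) ∧
      cellChar (Gd1 d 2) c α (extMod (rhoRep d i j)) = gammaPair d O O') ∧
    -- the class `ℒ_{O,O}`, `d` odd
    (∀ O, IsSimClass d k O → Odd d → ∀ i ∈ O, ∀ j ∈ O, i < j →
      IsSimpleModule (GauK (Gd1 d 2) c α) (extMod (rhoRep d i j)) ∧
      (∀ p ∈ O, ∀ q ∈ O, p < q → Nonempty
        (extMod (rhoRep d i j) ≃ₗ[GauK (Gd1 d 2) c α] extMod (rhoRep d p q))) ∧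
      cellChar (Gd1 d 2) c α (extMod (rhoRep d i j)) = gammaDiag d O) ∧
    -- the two classes `ℒ⁺_{O,O}` and `ℒ⁻_{O,O}`, `d` even
    (∀ O, IsSimClass d k O → Even d → ∀ i ∈ O, ∀ j ∈ O, i < j →
      IsEmpty (pmSub c α i j 1 ≃ₗ[GauK (Gd1 d 2) c α] pmSub c α i j (-1)) ∧
      ∀ ε : ℤ, ε = 1 ∨ ε = -1 →
        IsSimpleModule (GauK (Gd1 d 2) c α) (pmSub c α i j ε) ∧
        (∀ p ∈ O, ∀ q ∈ O, p < q → Nonempty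
          (pmSub c α i j ε ≃ₗ[GauK (Gd1 d 2) c α] pmSub c α p q ε)) ∧
        cellChar (Gd1 d 2) c α (pmSub c α i j ε) = gammaDiag d O) ∧
    -- every simple module belongs to one of these classes
    (∀ (L : Type) [AddCommGroup L] [Module (GauK (Gd1 d 2) c α) L],
      IsSimpleModule (GauK (Gd1 d 2) c α) L →
      (∃ i ∈ Finset.Icc 1 d,
        Nonempty (L ≃ₗ[GauK (Gd1 d 2) c α] extMod (etaRep d i))) ∨
      (∃ i ∈ Finset.Icc 1 d,
        Nonempty (L ≃ₗ[GauK (Gd1 d 2) c α] extMod (etaRep' d i))) ∨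
      (∃ i ∈ Finset.Icc 1 d, ∃ j ∈ Finset.Icc 1 d, i < j ∧ c₀ ^ 2 ≠ (k i - k j) ^ 2 ∧
        (k i ≠ k j ∨ Odd d) ∧
        Nonempty (L ≃ₗ[GauK (Gd1 d 2) c α] extMod (rhoRep d i j))) ∨
      (∃ i ∈ Finset.Icc 1 d, ∃ j ∈ Finset.Icc 1 d, i < j ∧ k i = k j ∧ Even d ∧
        ∃ ε : ℤ, (ε = 1 ∨ ε = -1) ∧
        Nonempty (L ≃ₗ[GauK (Gd1 d 2) c α] pmSub c α i j ε))) ∧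
    -- the complete list of `c`-cellular characters
    cellularCharacters (Gd1 d 2) c α =
      {γ | ∃ O O', IsSimClass d k O ∧ IsShiftOrEmpty d k c₀ O O' ∧ γ = gammaO d O O'} ∪
      {γ | ∃ O O', IsSimClass d k O ∧ IsShiftOrEmpty d k (-c₀) O O' ∧ γ = gammaO' d O O'} ∪
      {γ | ∃ O O', IsSimClass d k O ∧ IsSimClass d k O' ∧ O ≠ O' ∧
        (∀ i ∈ O, ∀ j ∈ O', c₀ ^ 2 ≠ (k i - k j) ^ 2) ∧ γ = gammaPair d O O'} ∪
      {γ | ∃ O, IsSimClass d k O ∧ 2 ≤ O.card ∧ γ = gammaDiag d O} := by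
  subst hc₀ hk
  have hd := NeZero.ne d
  have hA := gauK_mul_comm (α := α) hζ hc hα hne
  have hgen := adjoin_genX_genZ (c := c) (α := α) hζ
  refine ⟨?_, ?_, ?_, ?_, ?_, ?_, ?_, cellularCharacters_eq hζ hc hα hne⟩
  · intro O hO δ _ P Q hP hQ
    obtain ⟨i, hi⟩ := hO.nonempty
    rw [hP.eq_filter hi, hQ.eq_filter hi]
  · intro O O' hO hO' i hi
    have hl := isLine_etaRep hζ hc hα (Finset.mem_Icc.1 (hO.mem_Icc hi)).1
    refine ⟨hl.simple, fun p hp => ?_, cellChar_eq_gammaO hζ hc hα hne hO hO' hi hl⟩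
    refine (hl.nonempty_linearEquiv_iff hA hgen
      (isLine_etaRep hζ hc hα (Finset.mem_Icc.1 (hO.mem_Icc hp)).1)).2 ?_
    rw [hO.val_eq hi hp]
    exact ⟨rfl, rfl⟩
  · intro O O' hO hO' i hi
    have hl := isLine_etaRep' hζ hc hα (Finset.mem_Icc.1 (hO.mem_Icc hi)).1
    refine ⟨hl.simple, fun p hp => ?_, cellChar_eq_gammaO' hζ hc hα hne hO hO' hi hl⟩
    refine (hl.nonempty_linearEquiv_iff hA hgen
      (isLine_etaRep' hζ hc hα (Finset.mem_Icc.1 (hO.mem_Icc hp)).1)).2 ?_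
    rw [hO.val_eq hi hp]
    exact ⟨rfl, rfl⟩
  · intro O O' hO hO' hOO' h i j hij hmem
    obtain ⟨hs, a, ha, b, hb, hpl⟩ := exists_isPlane_of_mem hζ hc hα hne hO hO' hOO' h hij hmem
    refine ⟨hs, fun p q hpq hmem' => ?_, cellChar_eq_gammaPair hζ hc hα hne hO hO' hOO' h ha hb hpl⟩
    obtain ⟨hs', a', ha', b', hb', hpl'⟩ :=
      exists_isPlane_of_mem hζ hc hα hne hO hO' hOO' h hpq hmem'
    refine (hpl.nonempty_linearEquiv_iff hA hgen hpl').2 ?_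
    rw [hO.val_eq ha ha', hO'.val_eq hb hb']
    exact ⟨rfl, rfl⟩
  · intro O hO hodd i hi j hj hij
    have hs : ∀ p ∈ O, ∀ q ∈ O, p < q →
        IsSimpleModule (GauK (Gd1 d 2) c α) (extMod (rhoRep d p q)) := fun p hp q hq hpq =>
      isSimpleModule_rhoRep hζ hc hα hne (hO.mem_Icc hp) (hO.mem_Icc hq) hpq
        (by simpa [hO.val_eq hp hq] using hne) (Or.inr hodd)
    have hpl : ∀ p ∈ O, ∀ q ∈ O, p < q → IsPlane (genX c α) (genZ c α) (extMod (rhoRep d p q)) _ _ :=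
      fun p hp q hq hpq =>
        isPlane_of_mem_Icc hζ hc hα hne (hO.mem_Icc hp) (hO.mem_Icc hq) hpq
    have := hs i hi j hj hij
    refine ⟨this, fun p hp q hq hpq => ?_,
      cellChar_eq_gammaDiag hζ hc hα hne hO hodd hi hj (hpl i hi j hj hij)⟩
    have := hs p hp q hq hpq
    refine ((hpl i hi j hj hij).nonempty_linearEquiv_iff hA hgen (hpl p hp q hq hpq)).2 ?_
    rw [hO.val_eq hi hp, hO.val_eq hi hq, hO.val_eq hi hj]
    exact ⟨rfl, rfl⟩
  · intro O hO hd2 i hi j hj hij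
    constructor
    -- On `ℒ⁺` and `ℒ⁻` the scalars of `z` agree, but the eigenvalues of `x` differ because `c₀ ≠
    -- 0`.
    · refine not_nonempty_iff.1 fun h => halfVal_ne (a := kSharp ζ c i) hd hne ?_
      have h1 := ((isLine_pmSub_of_mem hζ hc hα hne hO hd2 hi hj hij
        (Or.inl rfl)).nonempty_linearEquiv_iff hA hgen
        (isLine_pmSub_of_mem hζ hc hα hne hO hd2 hi hj hij (Or.inr rfl))).1 h
      simpa using h1.1
    · intro ε hε
      have hl := isLine_pmSub_of_mem hζ hc hα hne hO hd2 hi hj hij hε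
      refine ⟨hl.simple, fun p hp q hq hpq => ?_,
        cellChar_eq_gammaDiag_of_even hζ hc hα hne hO hd2 hi hj hε hl⟩
      refine (hl.nonempty_linearEquiv_iff hA hgen
        (isLine_pmSub_of_mem hζ hc hα hne hO hd2 hp hq hpq hε)).2 ?_
      rw [hO.val_eq hi hp, hO.val_eq hi hq, hO.val_eq hi hj]
      exact ⟨rfl, rfl⟩
  · intro L _ _ hL
    rcases simple_cases hζ hc hα hne L with ⟨i, hi, hl⟩ | ⟨i, hi, hl⟩ | h |
      ⟨i, hi, j, hj, hij, h, hd2, ε, hε, hl⟩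
    · exact Or.inl ⟨i, hi, (hl.nonempty_linearEquiv_iff hA hgen
        (isLine_etaRep hζ hc hα (Finset.mem_Icc.1 hi).1)).2 ⟨rfl, rfl⟩⟩
    · exact Or.inr (Or.inl ⟨i, hi, (hl.nonempty_linearEquiv_iff hA hgen
        (isLine_etaRep' hζ hc hα (Finset.mem_Icc.1 hi).1)).2 ⟨rfl, rfl⟩⟩)
    · exact Or.inr (Or.inr (Or.inl h))
    · exact Or.inr (Or.inr (Or.inr ⟨i, hi, j, hj, hij, h, hd2, ε, hε,
        (hl.nonempty_linearEquiv_iff hA hgen (isLine_pmSub hζ hc hα hne (Finset.mem_Icc.1 hi).1 hij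
          (Finset.mem_Icc.1 hj).2 hd2 h hε)).2 ⟨rfl, rfl⟩⟩))
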